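/- Let $N\ge 2$ be an integer, $1<p<N$, $p^*=\frac{Np}{N-p}$, $p'=\frac{p}{p-1}$ and $R>0$. Let $H:\mathbb{R}^N\to[0,\infty)$ be a Finsler norm, i.e. $H$ is convex, $H(\xi)=0$ iff $\xi=0$, $H(t\xi)=|t|H(\xi)$ for all $t\in\mathbb{R}$, $\xi\in\mathbb{R}^N$, and $H\in C^1(\mathbb{R}^N\setminus\{0\})$. Let $H^0(x)=\sup_{\xi\ne0}\frac{\xi\cdot x}{H(\xi)}$ be its dual norm, $\mathcal{W}_R=\{x\in\mathbb{R}^N: H^0(x)<R\}$ the Wulff ball of radius $R$, $\kappa_N=|\mathcal{W}_1|$ the Lebesgue measure of the unit Wulff ball, and $\omega_{N-1}$ the surface measure of the Euclidean unit sphere in $\mathbb{R}^N$. Put $$S_{N,p}=\pi^{p/2}N\Big(\frac{N-p}{p-1}\Big)^{p-1}\left(\frac{\Gamma(\frac Np)\,\Gamma(1+\frac N{p'})}{\Gamma(N)\,\Gamma(1+\frac N2)}\right)^{p/N},\qquad \tilde S_{N,p}=S_{N,p}\Big(\frac{\omega_{N-1}}{N\kappa_N}\Big)^{p/p^*-1}.$$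 Call a real function $v$ on $\mathcal{W}_R$ Finsler radially symmetric if $v(y)=V(H^0(y))$ for almost every $y\in\mathcal{W}_R$, for some function $V$ on $[0,R)$. Then for every Finsler radially symmetric $v\in W^{1,p}_0(\mathcal{W}_R)$ both integrals below are finite and $$\tilde S_{N,p}\left(\int_{\mathcal{W}_R}\frac{|v(y)|^{p^*}}{\Big(1-\big(\frac{H^0(y)}R\big)^{\frac{N-p}{p-1}}\Big)^{\frac{p(N-1)}{N-p}}}\,dy\right)^{p/p^*}\le\int_{\mathcal{W}_R}H(\nabla v(y))^p\,dy .$$ If $v$ is not almost everywhere zero, equality holds if and only if there are $a,b>0$ such that $v$ or $-v$ is equal almost everywhere in $\mathcal{W}_R$ to $$y\mapsto\Big(a+b\big(H^0(y)^{\frac{p-N}{p-1}}-R^{\frac{p-N}{p-1}}\big)^{\frac p{p-N}}\Big)^{\frac{p-N}p}.$$ For all $a,b>0$ this function is Finsler radially symmetric and belongs to $W^{1,p}_0(\mathcal{W}_R)$. -/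

import Mathlib

open MeasureTheory Filter Topology
open scoped ContDiff Gradient

noncomputable section

/-- A Finsler norm on `ℝ^N`: a convex, nonnegative, definite, absolutely 1-homogeneous function
which is `C^1` away from the origin. -/
structure IsFinslerNorm {N : ℕ} (H : EuclideanSpace ℝ (Fin N) → ℝ) : Prop where
  convexOn : ConvexOn ℝ Set.univ H
  nonneg : ∀ ξ, 0 ≤ H ξ
  eq_zero_iff : ∀ ξ, H ξ = 0 ↔ ξ = 0
  homogeneous : ∀ (t : ℝ) (ξ : EuclideanSpace ℝ (Fin N)), H (t • ξ) = |t| * H ξ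
  contDiffOn : ContDiffOn ℝ 1 H {0}ᶜ

/-- The dual norm `H⁰(x) = sup_{ξ ≠ 0} (ξ · x) / H(ξ)`. -/
def dualNorm {N : ℕ} (H : EuclideanSpace ℝ (Fin N) → ℝ) (x : EuclideanSpace ℝ (Fin N)) : ℝ :=
  ⨆ ξ : {ξ : EuclideanSpace ℝ (Fin N) // ξ ≠ 0}, inner ℝ (ξ : EuclideanSpace ℝ (Fin N)) x / H ξ

/-- The Wulff ball `W_R = {x : H⁰(x) < R}`. -/
def wulffBall {N : ℕ} (H : EuclideanSpace ℝ (Fin N) → ℝ) (R : ℝ) :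
    Set (EuclideanSpace ℝ (Fin N)) :=
  {x | dualNorm H x < R}

/-- `κ_N`: the `N`-dimensional (Lebesgue) measure of the unit Wulff ball. -/
def wulffVolume {N : ℕ} (H : EuclideanSpace ℝ (Fin N) → ℝ) : ℝ :=
  (volume : Measure (EuclideanSpace ℝ (Fin N))).real (wulffBall H 1)

/-- `ω_{N-1}`: the surface measure of the Euclidean unit sphere of `ℝ^N`. -/
def sphereArea (N : ℕ) : ℝ :=
  ((volume : Measure (EuclideanSpace ℝ (Fin N))).toSphere).real Set.univ

/-- Test functions: `φ ∈ C_c^∞(Ω)`. -/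
structure IsTestFunction {N : ℕ} (Ω : Set (EuclideanSpace ℝ (Fin N)))
    (φ : EuclideanSpace ℝ (Fin N) → ℝ) : Prop where
  contDiff : ContDiff ℝ ∞ φ
  hasCompactSupport : HasCompactSupport φ
  tsupport_subset : tsupport φ ⊆ Ω

/-- `g` is the weak (distributional) gradient of `v` on the open set `Ω`. -/
structure HasWeakGradient {N : ℕ} (Ω : Set (EuclideanSpace ℝ (Fin N)))
    (v : EuclideanSpace ℝ (Fin N) → ℝ)
    (g : EuclideanSpace ℝ (Fin N) → EuclideanSpace ℝ (Fin N)) : Prop where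
  locallyIntegrableOn : LocallyIntegrableOn v Ω volume
  locallyIntegrableOn_grad : LocallyIntegrableOn g Ω volume
  integral_eq : ∀ φ : EuclideanSpace ℝ (Fin N) → ℝ, IsTestFunction Ω φ →
    ∫ x in Ω, v x • gradient φ x = -∫ x in Ω, φ x • g x

/-- `v ∈ W^{1,p}_0(Ω)`: `v` and its weak gradient lie in `L^p(Ω)`, and `v` is the limit in
`W^{1,p}(Ω)` of a sequence of test functions in `C_c^∞(Ω)`. -/
def MemSobolevZero {N : ℕ} (Ω : Set (EuclideanSpace ℝ (Fin N))) (p : ℝ)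
    (v : EuclideanSpace ℝ (Fin N) → ℝ) : Prop :=
  MemLp v (ENNReal.ofReal p) (volume.restrict Ω) ∧
  ∃ g : EuclideanSpace ℝ (Fin N) → EuclideanSpace ℝ (Fin N),
    HasWeakGradient Ω v g ∧ MemLp g (ENNReal.ofReal p) (volume.restrict Ω) ∧
    ∃ φ : ℕ → EuclideanSpace ℝ (Fin N) → ℝ, (∀ n, IsTestFunction Ω (φ n)) ∧
      Tendsto (fun n => eLpNorm (fun x => φ n x - v x) (ENNReal.ofReal p) (volume.restrict Ω))
        atTop (𝓝 0) ∧
      Tendsto (fun n => eLpNorm (fun x => gradient (φ n) x - g x) (ENNReal.ofReal p)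
        (volume.restrict Ω)) atTop (𝓝 0)

/-- `v` is Finsler radially symmetric on `W_R`: `v(y) = V(H⁰(y))` for a.e. `y ∈ W_R`. -/
def IsFinslerRadial {N : ℕ} (H : EuclideanSpace ℝ (Fin N) → ℝ) (R : ℝ)
    (v : EuclideanSpace ℝ (Fin N) → ℝ) : Prop :=
  ∃ V : ℝ → ℝ, ∀ᵐ y ∂(volume.restrict (wulffBall H R)), v y = V (dualNorm H y)

/-- The critical exponent `p^* = N p / (N - p)`. -/
def sobolevExponent (N : ℕ) (p : ℝ) : ℝ := N * p / (N - p)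

/-- The best constant `S_{N,p}` in the Sobolev inequality on `ℝ^N`, `1 < p < N`
(here `N / p' = N (p - 1) / p`). -/
def sobolevConst (N : ℕ) (p : ℝ) : ℝ :=
  Real.pi ^ (p / 2) * N * ((N - p) / (p - 1)) ^ (p - 1) *
    (Real.Gamma (N / p) * Real.Gamma (1 + N / (p / (p - 1))) /
      (Real.Gamma N * Real.Gamma (1 + N / 2))) ^ (p / N)

/-- The constant `S_{N,p} (ω_{N-1} / (N κ_N))^{p/p^* - 1}`. -/
def finslerSobolevConst {N : ℕ} (H : EuclideanSpace ℝ (Fin N) → ℝ) (p : ℝ) : ℝ :=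
  sobolevConst N p *
    (sphereArea N / (N * wulffVolume H)) ^ (p / sobolevExponent N p - 1)

/-- The weight `(1 - (H⁰(y)/R)^{(N-p)/(p-1)})^{p(N-1)/(N-p)}`, which stands in the denominator. -/
def finslerWeight {N : ℕ} (H : EuclideanSpace ℝ (Fin N) → ℝ) (p R : ℝ)
    (y : EuclideanSpace ℝ (Fin N)) : ℝ :=
  (1 - (dualNorm H y / R) ^ (((N : ℝ) - p) / (p - 1))) ^ (p * (N - 1) / (N - p))

/-- The profile
`(a + b (H⁰(y)^{(p-N)/(p-1)} - R^{(p-N)/(p-1)})^{p/(p-N)})^{(p-N)/p}`.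
It is meant for `0 < H⁰(y) < R`; its value at the single point `y = 0` is immaterial. -/
def finslerProfile {N : ℕ} (H : EuclideanSpace ℝ (Fin N) → ℝ) (p R a b : ℝ)
    (y : EuclideanSpace ℝ (Fin N)) : ℝ :=
  (a + b * (dualNorm H y ^ ((p - N) / (p - 1)) - R ^ ((p - N) / (p - 1))) ^ (p / (p - N)))
    ^ ((p - N) / p)

end

section

open Set

noncomputable section

/-! ### The incomplete beta integral and its inverse -/

/-! The problem is one-dimensional. A Finsler radial `v` in W₀^{1,p} has the form V(H⁰(y)) with V(r)
= ∫_r^R f, its weak gradient is -f(H⁰)∇H⁰, and H(∇H⁰) = 1 almost everywhere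
(`IsFinslerNorm.eikonal`). In polar coordinates for H⁰ the energy is therefore Nκ ∫ |f|^p r^{N-1}
dr. Put β = (N-p)/(p-1) and α = p/(N-p). The coordinate t = r^{-β} - R^{-β} maps (0, R) onto (0, ∞),
removes the weight from the energy, and turns the critical integral, with its singular weight, into
a multiple of ∫ |u|^q t^{α-q} dt, where u(t) = V(r) and q = p(1+α) = p*. What remains is Bliss'
inequality for functions with u(0) = 0 (`bliss_inequality`). Its extremals (a + b t^{-α})^{-1/α} are
the stated profiles, and `finslerSobolevConst_eq` matches the constants.

Bliss' inequality is proved by calibration (`bliss_calibration`). For an extremal, η = t u'/u equals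
b/(b + a t^α), and the fraction M of the mass of w = u^q t^{α-q} accumulated up to t is the
normalized upper incomplete beta integral at η. For a general nonnegative derivative f = u', this
relation is used to define η from M (`betaQuantile`). The tangent form of Young's inequality at y =
uη/t, followed by integration by parts of (u^p)'(η/t)^{p-1}, bounds ∫ f^p below by the integral of a
density proportional to 1 + D with D = -tη'/(η(1-η)). Weighted Bernoulli bounds 1 + D below by a
power of D, and the beta parameters are such that the result is a constant multiple of w
(`bliss_pointwise`). Equality forces D = α, the logistic equation for η, which is solved explicitly
in `bliss_equality_formula`. Signed functions are compared with the primitive of |f|.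

The passage between W₀^{1,p} and one variable has two directions.
`IsFinslerNorm.memSobolevZero_radial` shows that primitives of finite energy belong to the space, by
truncation, mollification and a Hardy inequality. `IsFinslerNorm.exists_radial_derivative` recovers
f from `v` by restricting an approximating sequence of test functions to one well-chosen ray. -/

def betaKernel (a b s : ℝ) : ℝ := s ^ (a - 1) * (1 - s) ^ (b - 1)

/-- The upper incomplete beta integral. -/
def incBeta (a b x : ℝ) : ℝ := ∫ s in x..1, betaKernel a b s

lemma betaKernel_pos {a b s : ℝ} (h0 : 0 < s) (h1 : s < 1) : 0 < betaKernel a b s :=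
  mul_pos (Real.rpow_pos_of_pos h0 _) (Real.rpow_pos_of_pos (by linarith) _)

lemma betaKernel_continuousAt {a b s : ℝ} (h0 : 0 < s) (h1 : s < 1) :
    ContinuousAt (betaKernel a b) s := by
  unfold betaKernel
  refine ContinuousAt.mul ?_ ?_
  · exact Real.continuousAt_rpow_const _ _ (Or.inl h0.ne')
  · exact ContinuousAt.rpow_const (by fun_prop) (Or.inl (by linarith))

lemma betaKernel_measurable (a b : ℝ) : Measurable (betaKernel a b) := by
  unfold betaKernel; fun_prop

lemma betaKernel_ofReal {a b s : ℝ} (hs : s ∈ uIoc (0 : ℝ) 1) :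
    ((s : ℂ) ^ ((a : ℂ) - 1) * (1 - (s : ℂ)) ^ ((b : ℂ) - 1)) = ((betaKernel a b s : ℝ) : ℂ) := by
  rw [uIoc_of_le zero_le_one] at hs
  unfold betaKernel
  rw [Complex.ofReal_mul, Complex.ofReal_cpow hs.1.le, Complex.ofReal_cpow (by linarith [hs.2])]
  push_cast; rfl

lemma betaKernel_intervalIntegrable {a b : ℝ} (ha : 0 < a) (hb : 0 < b) :
    IntervalIntegrable (betaKernel a b) volume 0 1 := by
  have h := Complex.betaIntegral_convergent (u := a) (v := b) (by simpa) (by simpa)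
  have h2 : IntervalIntegrable (fun s => ((betaKernel a b s : ℝ) : ℂ)) volume 0 1 :=
    h.congr (fun s hs => betaKernel_ofReal hs)
  rw [intervalIntegrable_iff] at h2 ⊢
  exact h2.re

lemma incBeta_zero {a b : ℝ} (ha : 0 < a) (hb : 0 < b) :
    incBeta a b 0 = ProbabilityTheory.beta a b := by
  rw [ProbabilityTheory.beta_eq_betaIntegralReal a b ha hb, Complex.betaIntegral, incBeta,
    intervalIntegral.integral_congr_ae (g := fun s => ((betaKernel a b s : ℝ) : ℂ))
      (ae_of_all _ fun s hs => betaKernel_ofReal hs), intervalIntegral.integral_ofReal,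
    Complex.ofReal_re]

@[simp] lemma incBeta_one (a b : ℝ) : incBeta a b 1 = 0 := by simp [incBeta]

/-- Strict differentiability is what the local inverse argument in `betaQuantile_hasDerivAt` needs.
-/
lemma incBeta_hasStrictDerivAt {a b x : ℝ} (ha : 0 < a) (hb : 0 < b) (h0 : 0 < x) (h1 : x < 1) :
    HasStrictDerivAt (incBeta a b) (-betaKernel a b x) x := by
  refine intervalIntegral.integral_hasStrictDerivAt_left ?_ ?_ (betaKernel_continuousAt h0 h1)
  · refine (betaKernel_intervalIntegrable ha hb).mono_set ?_
    rw [uIcc_of_le h1.le, uIcc_of_le zero_le_one]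
    exact Icc_subset_Icc_left h0.le
  · exact (betaKernel_measurable a b).stronglyMeasurable.stronglyMeasurableAtFilter

lemma incBeta_continuousOn {a b : ℝ} (ha : 0 < a) (hb : 0 < b) :
    ContinuousOn (incBeta a b) (Icc 0 1) := by
  have h := intervalIntegral.continuousOn_primitive_interval_left
    (f := betaKernel a b) (μ := volume) (a := 0) (b := 1)
    (by rw [uIcc_of_le zero_le_one, integrableOn_Icc_iff_integrableOn_Ioc]
        exact (betaKernel_intervalIntegrable ha hb).1)
  rwa [uIcc_of_le zero_le_one] at h

lemma incBeta_strictAntiOn {a b : ℝ} (ha : 0 < a) (hb : 0 < b) :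
    StrictAntiOn (incBeta a b) (Icc 0 1) := by
  refine strictAntiOn_of_deriv_neg (convex_Icc 0 1) (incBeta_continuousOn ha hb) fun x hx => ?_
  rw [interior_Icc] at hx
  rw [(incBeta_hasStrictDerivAt ha hb hx.1 hx.2).hasDerivAt.deriv]
  linarith [betaKernel_pos (a := a) (b := b) hx.1 hx.2]

/-- The inverse of the normalized incomplete beta integral. -/
def betaQuantile (a b y : ℝ) : ℝ :=
  Function.invFunOn (fun x => incBeta a b x / ProbabilityTheory.beta a b) (Ioo 0 1) y

/-- Intermediate value theorem: `incBeta` falls continuously from the full beta value at 0 to 0 at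
1. The quantile thus reverses order: small `y` corresponds to values near 1. -/
lemma betaQuantile_spec {a b y : ℝ} (ha : 0 < a) (hb : 0 < b) (hy : y ∈ Ioo (0 : ℝ) 1) :
    betaQuantile a b y ∈ Ioo (0 : ℝ) 1 ∧
      incBeta a b (betaQuantile a b y) = y * ProbabilityTheory.beta a b := by
  have hB := ProbabilityTheory.beta_pos ha hb
  have hex : ∃ x ∈ Ioo (0 : ℝ) 1, incBeta a b x / ProbabilityTheory.beta a b = y := by
    have := intermediate_value_Ioo' (zero_le_one (α := ℝ)) (incBeta_continuousOn ha hb)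
    rw [incBeta_one, incBeta_zero ha hb] at this
    obtain ⟨x, hx, hxy⟩ := this (show y * ProbabilityTheory.beta a b ∈ _ from
      ⟨mul_pos hy.1 hB, by nlinarith [hy.2]⟩)
    exact ⟨x, hx, by rw [hxy]; field_simp⟩
  refine ⟨Function.invFunOn_mem hex, ?_⟩
  have := Function.invFunOn_eq hex
  rw [div_eq_iff hB.ne'] at this
  exact this

/-- Derivative of an inverse function; injectivity on (0, 1) makes the quantile a left inverse near
the point. -/
lemma betaQuantile_hasDerivAt {a b y : ℝ} (ha : 0 < a) (hb : 0 < b) (hy : y ∈ Ioo (0 : ℝ) 1) :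
    HasDerivAt (betaQuantile a b)
      (-(ProbabilityTheory.beta a b / betaKernel a b (betaQuantile a b y))) y := by
  have hB := ProbabilityTheory.beta_pos ha hb
  obtain ⟨hm, he⟩ := betaQuantile_spec ha hb hy
  set x := betaQuantile a b y with hx
  have hd := (incBeta_hasStrictDerivAt ha hb hm.1 hm.2).div_const (ProbabilityTheory.beta a b)
  have hk := betaKernel_pos (a := a) (b := b) hm.1 hm.2
  have hne : -betaKernel a b x / ProbabilityTheory.beta a b ≠ 0 :=
    div_ne_zero (neg_ne_zero.2 hk.ne') hB.ne'
  have hinj : InjOn (fun x => incBeta a b x / ProbabilityTheory.beta a b) (Ioo 0 1) := by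
    intro s hs t ht hst
    exact (incBeta_strictAntiOn ha hb).injOn (Ioo_subset_Icc_self hs) (Ioo_subset_Icc_self ht)
      ((div_left_inj' hB.ne').1 hst)
  have hl : ∀ᶠ s in 𝓝 x, betaQuantile a b (incBeta a b s / ProbabilityTheory.beta a b) = s := by
    filter_upwards [isOpen_Ioo.mem_nhds hm] with s hs
    exact hinj.leftInvOn_invFunOn hs
  have := (hd.to_local_left_inverse hne hl).hasDerivAt
  rw [he, mul_div_cancel_right₀ _ hB.ne'] at this
  rwa [neg_div, inv_neg, inv_div] at this

/-! ### Pointwise inequalities behind Bliss' inequality. -/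

/-- The sharp constant in Bliss' inequality. -/
def blissConst (p α : ℝ) : ℝ :=
  (p - 1) * (1 + α) *
    (ProbabilityTheory.beta ((p - 1) * ((1 + α) / α)) ((1 + α) / α) / α) ^ (α / (1 + α))

lemma blissConst_pos {p α : ℝ} (hp : 1 < p) (hα : 0 < α) : 0 < blissConst p α := by
  have hB : 0 < ProbabilityTheory.beta ((p - 1) * ((1 + α) / α)) ((1 + α) / α) :=
    ProbabilityTheory.beta_pos (mul_pos (by linarith) (by positivity)) (by positivity)
  unfold blissConst
  have : 0 < p - 1 := by linarith
  positivity

/-- Weighted Bernoulli inequality. -/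
lemma bernoulli_weighted {α D : ℝ} (hα : 0 < α) (hD : 0 ≤ D) :
    (1 + α) * (D / α) ^ (α / (1 + α)) ≤ 1 + D ∧
      ((1 + α) * (D / α) ^ (α / (1 + α)) = 1 + D → D = α) := by
  have h1 : 0 < α / (1 + α) := by positivity
  have h2 : α / (1 + α) < 1 := by rw [div_lt_one (by positivity)]; linarith
  -- The right side 1 + D is (1 + α) times the tangent line of x ↦ x^{α/(1+α)} at x = 1, evaluated
  -- at x = D/α.
  have key : (1 + α) * (1 + α / (1 + α) * (D / α - 1)) = 1 + D := by field_simp; ring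
  by_cases h : D = α
  · subst h
    refine ⟨?_, fun _ => rfl⟩
    rw [div_self hα.ne', Real.one_rpow, mul_one]
  · have hne : D / α - 1 ≠ 0 := by
      rw [sub_ne_zero]; intro h'; exact h ((div_eq_one_iff_eq hα.ne').1 h')
    have := rpow_one_add_lt_one_add_mul_self (s := D / α - 1)
      (by have : 0 ≤ D / α := by positivity
          linarith) hne h1 h2
    rw [add_sub_cancel] at this
    have h3 := mul_lt_mul_of_pos_left this (show 0 < 1 + α by linarith)
    rw [key] at h3
    exact ⟨h3.le, fun he => absurd he h3.ne⟩

/-- Young's inequality in tangent form. -/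
lemma young_tangent {p x y : ℝ} (hp : 1 < p) (hx : 0 ≤ x) (hy : 0 ≤ y) :
    p * y ^ (p - 1) * x - (p - 1) * y ^ p ≤ x ^ p := by
  have hpq : p.HolderConjugate (p / (p - 1)) := Real.HolderConjugate.conjExponent hp
  have h := Real.young_inequality_of_nonneg hx (Real.rpow_nonneg hy (p - 1)) hpq
  rw [← Real.rpow_mul hy, mul_div_cancel₀ _ (by linarith : p - 1 ≠ 0)] at h
  have hp0 : 0 < p := by linarith
  have h2 := mul_le_mul_of_nonneg_left h hp0.le
  have h3 : p * (x ^ p / p + y ^ p / (p / (p - 1))) = x ^ p + (p - 1) * y ^ p := by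
    field_simp
  rw [h3] at h2
  nlinarith

/-- The pointwise estimate behind Bliss' inequality. -/
lemma bliss_pointwise {p α U t η I : ℝ} (hp : 1 < p) (hα : 0 < α) (hU : 0 < U) (ht : 0 < t)
    (hη0 : 0 < η) (hη1 : η < 1) (hI : 0 < I) :
    let γ := (1 + α) / α
    let B := ProbabilityTheory.beta ((p - 1) * γ) γ
    let w := U ^ (p * (1 + α)) * t ^ (α - p * (1 + α))
    let D := t * (B * w / (I * betaKernel ((p - 1) * γ) γ η)) / (η * (1 - η))
    blissConst p α * I ^ (-(α / (1 + α))) * w ≤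
        (p - 1) * U ^ p * t ^ (-p) * (η ^ (p - 1) * (1 - η)) * (1 + D) ∧
      (blissConst p α * I ^ (-(α / (1 + α))) * w =
        (p - 1) * U ^ p * t ^ (-p) * (η ^ (p - 1) * (1 - η)) * (1 + D) → D = α) := by
  intro γ B w D
  have hγ : 0 < γ := by positivity
  have hB : 0 < B := ProbabilityTheory.beta_pos (mul_pos (by linarith) hγ) hγ
  have hw : 0 < w := by positivity
  have h1η : 0 < 1 - η := by linarith
  have hp1 : 0 < p - 1 := by linarith
  have hk := betaKernel_pos (a := (p - 1) * γ) (b := γ) hη0 hη1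
  have hD : 0 < D := by positivity
  have hDe : D / α = (B / α) * I⁻¹ * U ^ (p * (1 + α)) * t ^ (α - p * (1 + α) + 1) *
      η ^ (-((p - 1) * γ)) * (1 - η) ^ (-γ) := by
    have e1 : t ^ (α - p * (1 + α) + 1) = t ^ (α - p * (1 + α)) * t := by
      rw [Real.rpow_add ht, Real.rpow_one]
    have e2 : η ^ (-((p - 1) * γ)) = (η ^ ((p - 1) * γ - 1) * η)⁻¹ := by
      rw [Real.rpow_neg hη0.le]
      congr 1
      conv_rhs => rw [← Real.rpow_one η, ← Real.rpow_mul hη0.le, one_mul, ← Real.rpow_add hη0]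
      congr 1; ring
    have e3 : (1 - η) ^ (-γ) = ((1 - η) ^ (γ - 1) * (1 - η))⁻¹ := by
      rw [Real.rpow_neg h1η.le]
      congr 1
      conv_rhs => rw [← Real.rpow_one (1 - η), ← Real.rpow_mul h1η.le, one_mul,
        ← Real.rpow_add h1η]
      congr 1; ring
    rw [e1, e2, e3]
    simp only [D, w, betaKernel]
    field_simp
  have hθ : α / (1 + α) = γ⁻¹ := by simp only [γ]; rw [inv_div]
  -- Raising D/α to the power α/(1+α) = 1/γ turns η^{-(p-1)γ}(1-η)^{-γ} into the reciprocal of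
  -- η^{p-1}(1-η). The beta parameters (p-1)γ and γ are chosen for this cancellation, after which
  -- only a multiple of `w` is left.
  have key : U ^ p * t ^ (-p) * (η ^ (p - 1) * (1 - η)) * (D / α) ^ (α / (1 + α)) =
      (B / α) ^ (α / (1 + α)) * I ^ (-(α / (1 + α))) * w := by
    rw [hDe]
    rw [Real.mul_rpow (by positivity) (by positivity), Real.mul_rpow (by positivity) (by positivity),
      Real.mul_rpow (by positivity) (by positivity), Real.mul_rpow (by positivity) (by positivity),
      Real.mul_rpow (by positivity) (by positivity), ← Real.rpow_mul hη0.le, ← Real.rpow_mul h1η.le,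
      ← Real.rpow_mul hU.le, ← Real.rpow_mul ht.le, Real.inv_rpow hI.le, ← Real.rpow_neg hI.le]
    have e1 : -((p - 1) * γ) * (α / (1 + α)) = -(p - 1) := by rw [hθ]; field_simp
    have e2 : -γ * (α / (1 + α)) = -1 := by rw [hθ]; field_simp
    have e3 : p * (1 + α) * (α / (1 + α)) = p * α := by field_simp
    have e4 : (α - p * (1 + α) + 1) * (α / (1 + α)) = α - p * α := by field_simp; ring
    rw [e1, e2, e3, e4, Real.rpow_neg hη0.le, Real.rpow_neg h1η.le (1 : ℝ), Real.rpow_one]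
    have e5 : U ^ (p * (1 + α)) = U ^ p * U ^ (p * α) := by
      rw [← Real.rpow_add hU]; congr 1; ring
    have e6 : t ^ (α - p * (1 + α)) = t ^ (-p) * t ^ (α - p * α) := by
      rw [← Real.rpow_add ht]; congr 1; ring
    simp only [w]
    rw [e5, e6]
    field_simp
  have hb := bernoulli_weighted hα hD.le
  have hpos : 0 < (p - 1) * U ^ p * t ^ (-p) * (η ^ (p - 1) * (1 - η)) := by positivity
  have hL : blissConst p α * I ^ (-(α / (1 + α))) * w =
      (p - 1) * U ^ p * t ^ (-p) * (η ^ (p - 1) * (1 - η)) *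
        ((1 + α) * (D / α) ^ (α / (1 + α))) := by
    unfold blissConst
    change (p - 1) * (1 + α) * (B / α) ^ (α / (1 + α)) * I ^ (-(α / (1 + α))) * w = _
    linear_combination (-(p - 1) * (1 + α)) * key
  rw [hL]
  exact ⟨mul_le_mul_of_nonneg_left hb.1 hpos.le,
    fun h => hb.2 (mul_left_cancel₀ hpos.ne' h)⟩

/-! ### The calibration on a compact interval. -/

lemma AbsolutelyContinuousOnInterval.comp_lipschitzOnWith {f g : ℝ → ℝ} {a b : ℝ} {K : NNReal}
    {s : Set ℝ} (hf : AbsolutelyContinuousOnInterval f a b) (hg : LipschitzOnWith K g s)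
    (hs : MapsTo f (uIcc a b) s) : AbsolutelyContinuousOnInterval (g ∘ f) a b := by
  rw [absolutelyContinuousOnInterval_iff] at hf ⊢
  intro ε hε
  obtain ⟨δ, hδ, h⟩ := hf (ε / (K + 1)) (by positivity)
  refine ⟨δ, hδ, fun E hE hsum => ?_⟩
  have h1 := h E hE hsum
  have h2 : ∑ i ∈ Finset.range E.1, dist ((g ∘ f) (E.2 i).1) ((g ∘ f) (E.2 i).2) ≤
      K * ∑ i ∈ Finset.range E.1, dist (f (E.2 i).1) (f (E.2 i).2) := by
    rw [Finset.mul_sum]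
    refine Finset.sum_le_sum fun i hi => ?_
    have := hE.1 i hi
    exact hg.dist_le_mul _ (hs this.1) _ (hs this.2)
  have h3 : (0:ℝ) ≤ ∑ i ∈ Finset.range E.1, dist (f (E.2 i).1) (f (E.2 i).2) :=
    Finset.sum_nonneg fun _ _ => dist_nonneg
  rw [lt_div_iff₀ (by positivity)] at h1
  nlinarith

/-- The integrand of the lower bound in the calibration argument for Bliss' inequality. -/
def blissDensity (p α I : ℝ) (u M : ℝ → ℝ) (t : ℝ) : ℝ :=
  let γ := (1 + α) / α
  let η := betaQuantile ((p - 1) * γ) γ (M t)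
  (p - 1) * u t ^ p * t ^ (-p) * (η ^ (p - 1) * (1 - η)) *
    (1 + t * (ProbabilityTheory.beta ((p - 1) * γ) γ *
      (u t ^ (p * (1 + α)) * t ^ (α - p * (1 + α))) / (I * betaKernel ((p - 1) * γ) γ η)) /
        (η * (1 - η)))

/-- Jensen's inequality on [0, a], from integrating Young's tangent inequality at the mean value
`y`. It absorbs the left boundary term of the calibration. -/
lemma rpow_primitive_le {p a : ℝ} {f : ℝ → ℝ} (hp : 1 < p) (ha : 0 < a) (hf0 : ∀ t, 0 ≤ f t)
    (hfi : IntervalIntegrable f volume 0 a)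
    (hfp : IntervalIntegrable (fun t => f t ^ p) volume 0 a) :
    (∫ s in (0 : ℝ)..a, f s) ^ p * a ^ (1 - p) ≤ ∫ s in (0 : ℝ)..a, f s ^ p := by
  set U := ∫ s in (0 : ℝ)..a, f s with hU
  have hU0 : 0 ≤ U := intervalIntegral.integral_nonneg ha.le fun t _ => hf0 t
  set y := U / a with hy
  have hy0 : 0 ≤ y := by positivity
  have h1 : ∫ s in (0 : ℝ)..a, (p * y ^ (p - 1) * f s - (p - 1) * y ^ p) ≤
      ∫ s in (0 : ℝ)..a, f s ^ p := by
    refine intervalIntegral.integral_mono_on ha.le ?_ hfp fun t _ => young_tangent hp (hf0 t) hy0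
    exact (hfi.const_mul _).sub intervalIntegrable_const
  rw [intervalIntegral.integral_sub (hfi.const_mul _) intervalIntegrable_const,
    intervalIntegral.integral_const_mul, ← hU, intervalIntegral.integral_const, sub_zero,
    smul_eq_mul] at h1
  refine le_trans (le_of_eq ?_) h1
  have hUy : U = y * a := by rw [hy]; field_simp
  rcases hy0.eq_or_lt with h0 | h0
  · rw [hUy, ← h0]
    simp [Real.zero_rpow (by linarith : p ≠ 0)]
  · have e : y ^ p = y ^ (p - 1) * y := by
      conv_lhs => rw [show p = (p - 1) + 1 by ring, Real.rpow_add h0, Real.rpow_one]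
    have e2 : a ^ (1 - p) = a * (a ^ p)⁻¹ := by
      rw [sub_eq_add_neg, Real.rpow_add ha, Real.rpow_one, Real.rpow_neg ha.le]
    rw [hUy, Real.mul_rpow hy0 ha.le, e2, e]
    have : a ^ p ≠ 0 := by positivity
    field_simp
    ring

lemma lipschitzOnWith_of_hasDerivAt {g g' : ℝ → ℝ} {a b : ℝ}
    (hg : ∀ t ∈ Icc a b, HasDerivAt g (g' t) t) (hg' : ContinuousOn g' (Icc a b)) :
    ∃ K : NNReal, LipschitzOnWith K g (Icc a b) := by
  obtain ⟨C, hC⟩ := isCompact_Icc.exists_bound_of_continuousOn hg'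
  refine ⟨C.toNNReal, ?_⟩
  refine (convex_Icc a b).lipschitzOnWith_of_nnnorm_hasDerivWithin_le (f' := g')
    (fun t ht => (hg t ht).hasDerivWithinAt) fun t ht => ?_
  rw [← NNReal.coe_le_coe]
  exact (hC t ht).trans (Real.le_coe_toNNReal C)

/-- With g = (η/t)^{p-1}, Young's inequality gives f^p ≥ (u^p g)' + Q almost everywhere, where Q is
`blissDensity`. After integration the boundary term at `b` has the good sign and the one at `a` is
covered by ∫_0^a f^p. The normalization `I` is left free, since it is taken larger than the mass of
the interval for the inequality and equal to the total mass for the equality case. -/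
lemma bliss_calibration {p α a b I : ℝ} {f M : ℝ → ℝ} (hp : 1 < p) (hα : 0 < α) (ha : 0 < a)
    (hab : a ≤ b) (hI : 0 < I) (hf0 : ∀ t, 0 ≤ f t) (hfi : IntervalIntegrable f volume 0 b)
    (hfp : IntervalIntegrable (fun t => f t ^ p) volume 0 b)
    (hua : 0 < ∫ s in (0 : ℝ)..a, f s)
    (hM : ∀ t ∈ Icc a b, M t ∈ Ioo (0 : ℝ) 1)
    (hM' : ∀ t ∈ Icc a b, HasDerivAt M
      (((∫ s in (0 : ℝ)..t, f s) ^ (p * (1 + α)) * t ^ (α - p * (1 + α))) / I) t) :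
    ContinuousOn (blissDensity p α I (fun t => ∫ s in (0 : ℝ)..t, f s) M) (Icc a b) ∧
      ∫ t in a..b, blissDensity p α I (fun t => ∫ s in (0 : ℝ)..t, f s) M t ≤
        ∫ t in (0 : ℝ)..b, f t ^ p := by
  set u : ℝ → ℝ := fun t => ∫ s in (0 : ℝ)..t, f s with hu
  have hb : 0 < b := ha.trans_le hab
  set γ := (1 + α) / α with hγdef
  have hγ : 0 < γ := by positivity
  have hA : 0 < (p - 1) * γ := mul_pos (by linarith) hγ
  set B := ProbabilityTheory.beta ((p - 1) * γ) γ with hBdef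
  set w : ℝ → ℝ := fun t => u t ^ (p * (1 + α)) * t ^ (α - p * (1 + α)) with hw
  set η : ℝ → ℝ := fun t => betaQuantile ((p - 1) * γ) γ (M t) with hη
  set k : ℝ → ℝ := fun t => betaKernel ((p - 1) * γ) γ (η t) with hk
  set η' : ℝ → ℝ := fun t => -(B / k t) * (w t / I) with hη'
  have hsub : ∀ {c d : ℝ}, 0 ≤ c → c ≤ d → d ≤ b → uIcc c d ⊆ uIcc 0 b := by
    intro c d h0 h1 h2
    rw [uIcc_of_le h1, uIcc_of_le hb.le]
    exact Icc_subset_Icc h0 h2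
  have huc : ContinuousOn u (Icc a b) := by
    have := intervalIntegral.continuousOn_primitive_interval (μ := volume) (a := 0) (b := b)
      (f := f) (by rw [uIcc_of_le hb.le, integrableOn_Icc_iff_integrableOn_Ioc]; exact hfi.1)
    rw [uIcc_of_le hb.le] at this
    exact this.mono (Icc_subset_Icc_left ha.le)
  have hmono : ∀ t ∈ Icc a b, u a ≤ u t := by
    intro t ht
    have h1 := hfi.mono_set (hsub le_rfl ha.le hab)
    have h2 := hfi.mono_set (hsub ha.le ht.1 ht.2)
    simp only [u]
    rw [← intervalIntegral.integral_add_adjacent_intervals h1 h2]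
    have := intervalIntegral.integral_nonneg (μ := volume) ht.1 (f := f) fun s _ => hf0 s
    linarith
  have hmono' : ∀ t ∈ Icc a b, u t ≤ u b := by
    intro t ht
    have h1 := hfi.mono_set (hsub le_rfl (ha.le.trans ht.1) ht.2)
    have h2 := hfi.mono_set (hsub (ha.le.trans ht.1) ht.2 le_rfl)
    simp only [u]
    rw [← intervalIntegral.integral_add_adjacent_intervals h1 h2]
    have := intervalIntegral.integral_nonneg (μ := volume) ht.2 (f := f) fun s _ => hf0 s
    linarith
  have hupos : ∀ t ∈ Icc a b, 0 < u t := fun t ht => hua.trans_le (hmono t ht)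
  have htpos : ∀ t ∈ Icc a b, 0 < t := fun t ht => ha.trans_le ht.1
  have hwc : ContinuousOn w (Icc a b) := by
    refine (huc.rpow_const fun t ht => Or.inl (hupos t ht).ne').mul ?_
    exact continuousOn_id.rpow_const fun t ht => Or.inl (htpos t ht).ne'
  have hηm : ∀ t ∈ Icc a b, η t ∈ Ioo (0 : ℝ) 1 := fun t ht =>
    (betaQuantile_spec hA hγ (hM t ht)).1
  have hηd : ∀ t ∈ Icc a b, HasDerivAt η (η' t) t := fun t ht =>
    (betaQuantile_hasDerivAt hA hγ (hM t ht)).comp t (hM' t ht)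
  have hηc : ContinuousOn η (Icc a b) := fun t ht => (hηd t ht).continuousAt.continuousWithinAt
  have hkpos : ∀ t ∈ Icc a b, 0 < k t := fun t ht => betaKernel_pos (hηm t ht).1 (hηm t ht).2
  have hkc : ContinuousOn k (Icc a b) := fun t ht =>
    ContinuousAt.comp_continuousWithinAt (g := betaKernel ((p - 1) * γ) γ)
      (betaKernel_continuousAt (hηm t ht).1 (hηm t ht).2) (hηc t ht)
  have hη'c : ContinuousOn η' (Icc a b) := by
    refine ContinuousOn.mul (ContinuousOn.neg ?_) (hwc.div_const _)
    exact continuousOn_const.div hkc fun t ht => (hkpos t ht).ne'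
  set Q : ℝ → ℝ := blissDensity p α I u M with hQ
  -- The derivative of the quantile enters here: the factor 1 + D equals 1 - tη'/(η(1-η)).
  have hQe : ∀ t ∈ Icc a b, Q t = (p - 1) * u t ^ p * t ^ (-p) *
      (η t ^ (p - 1) * (1 - η t)) * (1 - t * η' t / (η t * (1 - η t))) := by
    intro t ht
    have : Q t = (p - 1) * u t ^ p * t ^ (-p) * (η t ^ (p - 1) * (1 - η t)) *
      (1 + t * (B * w t / (I * k t)) / (η t * (1 - η t))) := rfl
    rw [this]
    congr 1
    have := (hkpos t ht).ne'
    have h1 := (hηm t ht).1.ne'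
    have h2 : 1 - η t ≠ 0 := by linarith [(hηm t ht).2]
    simp only [hη']
    field_simp
    ring
  have hQc : ContinuousOn Q (Icc a b) := by
    refine ContinuousOn.congr ?_ hQe
    have c1 : ContinuousOn (fun t : ℝ => u t ^ p) (Icc a b) :=
      huc.rpow_const fun t ht => Or.inl (hupos t ht).ne'
    have c2 : ContinuousOn (fun t : ℝ => t ^ (-p)) (Icc a b) :=
      continuousOn_id.rpow_const fun t ht => Or.inl (htpos t ht).ne'
    have c3 : ContinuousOn (fun t : ℝ => η t ^ (p - 1)) (Icc a b) :=
      hηc.rpow_const fun t ht => Or.inl (hηm t ht).1.ne'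
    have c4 : ContinuousOn (fun t => t * η' t / (η t * (1 - η t))) (Icc a b) := by
      refine (continuousOn_id.mul hη'c).div (hηc.mul (continuousOn_const.sub hηc)) fun t ht => ?_
      exact mul_ne_zero (hηm t ht).1.ne' (by linarith [(hηm t ht).2])
    exact ((((continuousOn_const.mul c1).mul c2).mul
      (c3.mul (continuousOn_const.sub hηc)))).mul (continuousOn_const.sub c4)
  refine ⟨hQc, ?_⟩
  set g : ℝ → ℝ := fun t => (η t / t) ^ (p - 1) with hg
  set g' : ℝ → ℝ := fun t => (η' t * t - η t * 1) / t ^ 2 * (p - 1) * (η t / t) ^ (p - 1 - 1)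
    with hg'
  have hgd : ∀ t ∈ Icc a b, HasDerivAt g (g' t) t := fun t ht =>
    ((hηd t ht).div (hasDerivAt_id t) (htpos t ht).ne').rpow_const
      (Or.inl (div_pos (hηm t ht).1 (htpos t ht)).ne')
  have hg'c : ContinuousOn g' (Icc a b) := by
    refine ContinuousOn.mul (ContinuousOn.mul ?_ continuousOn_const) ?_
    · refine ContinuousOn.div ?_ (continuousOn_id.pow 2) fun t ht => pow_ne_zero 2 (htpos t ht).ne'
      exact (hη'c.mul continuousOn_id).sub (hηc.mul continuousOn_const)
    · refine (hηc.div continuousOn_id fun t ht => (htpos t ht).ne').rpow_const fun t ht => ?_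
      exact Or.inl (div_pos (hηm t ht).1 (htpos t ht)).ne'
  -- The function `u` is only absolutely continuous, so the fundamental theorem is used for a
  -- product of absolutely continuous functions; `g` is C¹ on a compact interval, hence Lipschitz.
  have hgAC : AbsolutelyContinuousOnInterval g a b := by
    obtain ⟨K, hK⟩ := lipschitzOnWith_of_hasDerivAt hgd hg'c
    exact LipschitzOnWith.absolutelyContinuousOnInterval (by rwa [uIcc_of_le hab])
  have huAC : AbsolutelyContinuousOnInterval u a b :=
    (hfi.absolutelyContinuousOnInterval_intervalIntegral left_mem_uIcc).mono
      (hsub ha.le hab le_rfl)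
  have hupAC : AbsolutelyContinuousOnInterval (fun t => u t ^ p) a b := by
    obtain ⟨K, hK⟩ := lipschitzOnWith_of_hasDerivAt (g := fun x : ℝ => x ^ p)
      (g' := fun x => p * x ^ (p - 1)) (a := u a) (b := u b)
      (fun x hx => Real.hasDerivAt_rpow_const (Or.inr hp.le))
      (continuousOn_const.mul (continuousOn_id.rpow_const fun x _ => Or.inr (by linarith)))
    have hmaps : MapsTo u (uIcc a b) (Icc (u a) (u b)) := by
      rw [uIcc_of_le hab]
      exact fun t ht => ⟨hmono t ht, hmono' t ht⟩
    exact AbsolutelyContinuousOnInterval.comp_lipschitzOnWith (g := fun x : ℝ => x ^ p)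
      huAC hK hmaps
  have hPAC := hupAC.mul hgAC
  have hPint := hPAC.integral_deriv_eq_sub
  have hPii : IntervalIntegrable (deriv ((fun t => u t ^ p) * g)) volume a b :=
    hPAC.intervalIntegrable_deriv
  have hQii : IntervalIntegrable Q volume a b := hQc.intervalIntegrable_of_Icc hab
  have hfp_a := hfp.mono_set (hsub le_rfl ha.le hab)
  have hfp_b := hfp.mono_set (hsub ha.le hab le_rfl)
  have hae : ∀ᵐ t, t ∈ Icc a b →
      deriv ((fun t => u t ^ p) * g) t + Q t ≤ f t ^ p := by
    filter_upwards [hfi.ae_hasDerivAt_integral] with t ht htab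
    have hd := ht (hsub ha.le hab le_rfl (by rwa [uIcc_of_le hab])) 0 left_mem_uIcc
    have hu0 := hupos t htab
    have ht0 := htpos t htab
    have hη0 := (hηm t htab).1
    have hη1 : 0 < 1 - η t := by linarith [(hηm t htab).2]
    have hdP := (hd.rpow_const (p := p) (Or.inr hp.le)).mul (hgd t htab)
    rw [hdP.deriv, hQe t htab]
    -- The tangent point uη/t is the value that u' would have if η were exactly t u'/u.
    have hY := young_tangent hp (hf0 t) (y := u t * η t / t) (by positivity)
    refine le_trans (le_of_eq ?_) hY
    change f t * p * u t ^ (p - 1) * g t + u t ^ p * g' t + _ = _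
    have e1 : (u t * η t / t) ^ (p - 1) = u t ^ (p - 1) * g t := by
      rw [mul_div_assoc, Real.mul_rpow hu0.le (by positivity)]
    have e2 : (u t * η t / t) ^ p = u t ^ p * (η t ^ (p - 2) * η t ^ 2) * t ^ (-p) := by
      rw [Real.div_rpow (by positivity) ht0.le, Real.mul_rpow hu0.le hη0.le, Real.rpow_neg ht0.le]
      congr 1; congr 1
      rw [← Real.rpow_natCast, ← Real.rpow_add hη0]
      congr 1; push_cast; ring
    have e3 : (η t / t) ^ (p - 1 - 1) = η t ^ (p - 2) * t ^ (-p) * t ^ 2 := by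
      rw [Real.div_rpow hη0.le ht0.le, show p - 1 - 1 = p - 2 by ring, div_eq_mul_inv,
        ← Real.rpow_neg ht0.le, mul_assoc, ← Real.rpow_natCast t 2, ← Real.rpow_add ht0]
      congr 2; push_cast; ring
    have e4 : η t ^ (p - 1) = η t ^ (p - 2) * η t := by
      conv_rhs => rw [← Real.rpow_one (η t), ← Real.rpow_mul hη0.le, one_mul, ← Real.rpow_add hη0]
      congr 1; ring
    simp only [hg']
    rw [e1, e2, e3, e4]
    field_simp
    ring
  have hle : ∫ t in a..b, (deriv ((fun t => u t ^ p) * g) t + Q t) ≤ ∫ t in a..b, f t ^ p := by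
    refine intervalIntegral.integral_mono_ae_restrict hab (hPii.add hQii) hfp_b ?_
    rw [EventuallyLE, ae_restrict_iff' measurableSet_Icc]
    exact hae
  rw [intervalIntegral.integral_add hPii hQii, hPint] at hle
  simp only [Pi.mul_apply] at hle
  have hPb : 0 ≤ u b ^ p * g b :=
    mul_nonneg (Real.rpow_nonneg (hupos b ⟨hab, le_rfl⟩).le _)
      (Real.rpow_nonneg (div_nonneg (hηm b ⟨hab, le_rfl⟩).1.le hb.le) _)
  -- Because η(a) < 1, the factor g(a) is at most a^{1-p}, the factor in Jensen's inequality on [0,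
  -- a].
  have hPa : u a ^ p * g a ≤ ∫ t in (0 : ℝ)..a, f t ^ p := by
    refine le_trans ?_ (rpow_primitive_le hp ha hf0 (hfi.mono_set (hsub le_rfl ha.le hab)) hfp_a)
    refine mul_le_mul_of_nonneg_left ?_ (Real.rpow_nonneg hua.le _)
    rw [show (1 - p) = -(p - 1) by ring, Real.rpow_neg ha.le, ← Real.inv_rpow ha.le]
    have h1 := hηm a ⟨le_rfl, hab⟩
    refine Real.rpow_le_rpow (div_nonneg h1.1.le ha.le) ?_ (by linarith)
    rw [inv_eq_one_div]
    exact div_le_div_of_nonneg_right h1.2.le ha.le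
  have hadd := intervalIntegral.integral_add_adjacent_intervals hfp_a hfp_b
  linarith

/-- The bound |f| ≤ 1 + |f|^p makes the primitive from 0 meaningful. -/
lemma intervalIntegrable_of_rpow {p b : ℝ} {f : ℝ → ℝ} (hp : 1 < p) (hb : 0 ≤ b)
    (hm : AEStronglyMeasurable f (volume.restrict (Ioi 0)))
    (hf : IntegrableOn (fun t => |f t| ^ p) (Ioi 0)) : IntervalIntegrable f volume 0 b := by
  rw [intervalIntegrable_iff_integrableOn_Ioc_of_le hb]
  have h1 : IntegrableOn (fun t => 1 + |f t| ^ p) (Ioc 0 b) :=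
    Integrable.add (integrable_const _) (hf.mono_set Ioc_subset_Ioi_self)
  refine Integrable.mono' h1 (hm.mono_measure (Measure.restrict_mono Ioc_subset_Ioi_self le_rfl)) ?_
  refine ae_of_all _ fun t => ?_
  rw [Real.norm_eq_abs]
  rcases le_total (|f t|) 1 with h | h
  · have : 0 ≤ |f t| ^ p := by positivity
    linarith
  · have := Real.self_le_rpow_of_one_le h hp.le
    linarith

/-! ### Bliss' inequality for nonnegative derivatives: from intervals to the half-line. -/

/-- The weight integrand `u^q t^{α - q}`, `q = p (1 + α)`. -/
def blissWeight (p α : ℝ) (u : ℝ → ℝ) (t : ℝ) : ℝ := u t ^ (p * (1 + α)) * t ^ (α - p * (1 + α))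

lemma blissWeight_pos {p α t : ℝ} {u : ℝ → ℝ} (ht : 0 < t) (hu : 0 < u t) :
    0 < blissWeight p α u t := by unfold blissWeight; positivity

lemma blissDensity_ge {p α t I : ℝ} {u M : ℝ → ℝ} (hp : 1 < p) (hα : 0 < α) (ht : 0 < t)
    (hu : 0 < u t) (hI : 0 < I) (hM : M t ∈ Ioo (0 : ℝ) 1) :
    blissConst p α * I ^ (-(α / (1 + α))) * blissWeight p α u t ≤ blissDensity p α I u M t := by
  have hA : 0 < (p - 1) * ((1 + α) / α) := mul_pos (by linarith) (by positivity)
  have h := (betaQuantile_spec hA (by positivity : 0 < (1 + α) / α) hM).1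
  exact (bliss_pointwise hp hα hu ht h.1 h.2 hI).1

section nonneg

variable {p α : ℝ} {f : ℝ → ℝ}

/-- The calibration is applied with `M` the fraction of the mass of [a, b], padded by ε at both
ends; then ε tends to 0. -/
lemma bliss_on_interval {a b : ℝ} (hp : 1 < p) (hα : 0 < α) (ha : 0 < a) (hab : a < b)
    (hf0 : ∀ t, 0 ≤ f t) (hm : AEStronglyMeasurable f (volume.restrict (Ioi 0)))
    (hf : IntegrableOn (fun t => f t ^ p) (Ioi 0)) (hua : 0 < ∫ s in (0 : ℝ)..a, f s)
    (hupos : ∀ t ∈ Icc a b, 0 < ∫ s in (0 : ℝ)..t, f s) :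
    blissConst p α *
        (∫ t in a..b, blissWeight p α (fun t => ∫ s in (0 : ℝ)..t, f s) t) ^ (1 / (1 + α)) ≤
      ∫ t in Ioi 0, f t ^ p := by
  set u : ℝ → ℝ := fun t => ∫ s in (0 : ℝ)..t, f s with hu
  have hb : 0 < b := ha.trans hab
  have hfi : ∀ b, 0 ≤ b → IntervalIntegrable f volume 0 b := fun b hb =>
    intervalIntegrable_of_rpow hp hb hm (by simpa only [abs_of_nonneg (hf0 _)] using hf)
  have hfp : IntervalIntegrable (fun t => f t ^ p) volume 0 b := by
    rw [intervalIntegrable_iff_integrableOn_Ioc_of_le hb.le]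
    exact hf.mono_set Ioc_subset_Ioi_self
  have huc : ContinuousOn u (Ioi 0) := by
    intro t ht
    have h := intervalIntegral.continuousOn_primitive_interval (μ := volume) (a := 0) (b := t + 1)
      (f := f) (by
        have ht0 : (0 : ℝ) < t := ht
        rw [uIcc_of_le (by linarith), integrableOn_Icc_iff_integrableOn_Ioc]
        exact (hfi _ (by linarith)).1)
    have ht0 : (0 : ℝ) < t := ht
    rw [uIcc_of_le (by linarith)] at h
    exact (h.continuousAt (Icc_mem_nhds ht0 (by linarith))).continuousWithinAt
  have hwc : ∀ t ∈ Icc a b, ContinuousAt (blissWeight p α u) t := by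
    intro t ht
    have ht0 : 0 < t := ha.trans_le ht.1
    refine ContinuousAt.mul ?_ (Real.continuousAt_rpow_const _ _ (Or.inl ht0.ne'))
    exact (huc.continuousAt (Ioi_mem_nhds ht0)).rpow_const (Or.inl (hupos t ht).ne')
  have hwc' : ContinuousOn (blissWeight p α u) (Icc a b) := fun t ht =>
    (hwc t ht).continuousWithinAt
  have hwpos : ∀ t ∈ Icc a b, 0 < blissWeight p α u t := fun t ht =>
    blissWeight_pos (ha.trans_le ht.1) (hupos t ht)
  set W := ∫ t in a..b, blissWeight p α u t with hW
  have hWpos : 0 < W := by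
    refine intervalIntegral.intervalIntegral_pos_of_pos_on (hwc'.intervalIntegrable_of_Icc hab.le)
      (fun t ht => hwpos t (Ioo_subset_Icc_self ht)) hab
  have key : ∀ ε > 0, blissConst p α * (W + 2 * ε) ^ (-(α / (1 + α))) * W ≤
      ∫ t in Ioi 0, f t ^ p := by
    intro ε hε
    -- With this total, `M` runs from ε/I to 1 - ε/I and so stays in the open unit interval on all
    -- of [a, b].
    set I := W + 2 * ε with hI
    have hIpos : 0 < I := by positivity
    set M : ℝ → ℝ := fun t => (ε + ∫ s in a..t, blissWeight p α u s) / I with hM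
    have hint : ∀ t ∈ Icc a b, IntervalIntegrable (blissWeight p α u) volume a t ∧
        IntervalIntegrable (blissWeight p α u) volume t b := by
      intro t ht
      exact ⟨(hwc'.mono (Icc_subset_Icc_right ht.2)).intervalIntegrable_of_Icc ht.1,
        (hwc'.mono (Icc_subset_Icc_left ht.1)).intervalIntegrable_of_Icc ht.2⟩
    have hMm : ∀ t ∈ Icc a b, M t ∈ Ioo (0 : ℝ) 1 := by
      intro t ht
      have h1 : 0 ≤ ∫ s in a..t, blissWeight p α u s :=
        intervalIntegral.integral_nonneg ht.1 fun s hs => (hwpos s ⟨hs.1, hs.2.trans ht.2⟩).le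
      have h2 : 0 ≤ ∫ s in t..b, blissWeight p α u s :=
        intervalIntegral.integral_nonneg ht.2 fun s hs => (hwpos s ⟨ht.1.trans hs.1, hs.2⟩).le
      have h3 := intervalIntegral.integral_add_adjacent_intervals (hint t ht).1 (hint t ht).2
      refine ⟨by positivity, ?_⟩
      simp only [hM]
      rw [div_lt_one hIpos]
      linarith
    have hMd : ∀ t ∈ Icc a b, HasDerivAt M (blissWeight p α u t / I) t := by
      intro t ht
      refine HasDerivAt.div_const ?_ I
      refine HasDerivAt.const_add ε ?_
      refine intervalIntegral.integral_hasDerivAt_right (hint t ht).1 ?_ (hwc t ht)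
      have hopen : Ioi 0 ∩ u ⁻¹' Ioi 0 ∈ 𝓝 t := by
        have ht0 : 0 < t := ha.trans_le ht.1
        exact Filter.inter_mem (Ioi_mem_nhds ht0)
          ((huc.continuousAt (Ioi_mem_nhds ht0)) (Ioi_mem_nhds (hupos t ht)))
      have hcont : ContinuousOn (blissWeight p α u) (Ioi 0 ∩ u ⁻¹' Ioi 0) := by
        refine ContinuousOn.mul ?_ ?_
        · exact (huc.mono inter_subset_left).rpow_const fun s hs => Or.inl (ne_of_gt hs.2)
        · exact continuousOn_id.rpow_const fun s hs => Or.inl (ne_of_gt hs.1)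
      have ho : IsOpen (Ioi 0 ∩ u ⁻¹' Ioi 0) := huc.isOpen_inter_preimage isOpen_Ioi isOpen_Ioi
      exact hcont.stronglyMeasurableAtFilter ho t (mem_of_mem_nhds hopen)
    obtain ⟨hQc, hQ⟩ := bliss_calibration hp hα ha hab.le hIpos hf0 (hfi b hb.le) hfp hua hMm hMd
    have h1 : ∫ t in (0 : ℝ)..b, f t ^ p ≤ ∫ t in Ioi 0, f t ^ p := by
      rw [intervalIntegral.integral_of_le hb.le]
      exact setIntegral_mono_set hf (ae_of_all _ fun t => Real.rpow_nonneg (hf0 t) _)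
        (LE.le.eventuallyLE Ioc_subset_Ioi_self)
    have h2 : blissConst p α * I ^ (-(α / (1 + α))) * W ≤
        ∫ t in a..b, blissDensity p α I u M t := by
      rw [hW, ← intervalIntegral.integral_const_mul]
      refine intervalIntegral.integral_mono_on hab.le
        ((hwc'.intervalIntegrable_of_Icc hab.le).const_mul _)
        (hQc.intervalIntegrable_of_Icc hab.le) fun t ht => ?_
      exact blissDensity_ge hp hα (ha.trans_le ht.1) (hupos t ht) hIpos (hMm t ht)
    linarith
  have hlim : Tendsto (fun ε : ℝ => blissConst p α * (W + 2 * ε) ^ (-(α / (1 + α))) * W)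
      (𝓝[>] 0) (𝓝 (blissConst p α * (W + 2 * 0) ^ (-(α / (1 + α))) * W)) := by
    refine Tendsto.mono_left (ContinuousAt.tendsto ?_) nhdsWithin_le_nhds
    have : ContinuousAt (fun ε : ℝ => (W + 2 * ε) ^ (-(α / (1 + α)))) 0 :=
      ContinuousAt.rpow_const (by fun_prop) (Or.inl (by simpa using hWpos.ne'))
    fun_prop
  have := le_of_tendsto hlim (eventually_mem_nhdsWithin.mono fun ε hε => key ε hε)
  refine le_trans (le_of_eq ?_) this
  rw [mul_zero, add_zero, mul_assoc]
  congr 1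
  conv_rhs => rw [← Real.rpow_one W, ← Real.rpow_mul hWpos.le, one_mul, ← Real.rpow_add hWpos]
  congr 1
  field_simp
  ring

end nonneg

section nonneg

variable {p α : ℝ} {f : ℝ → ℝ}

lemma continuousOn_primitive_Ioi (hfi : ∀ b, 0 ≤ b → IntervalIntegrable f volume 0 b) :
    ContinuousOn (fun t => ∫ s in (0 : ℝ)..t, f s) (Ici 0) := by
  intro t ht
  have ht0 : (0 : ℝ) ≤ t := ht
  have h := intervalIntegral.continuousOn_primitive_interval (μ := volume) (a := 0) (b := t + 1)
    (f := f) (by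
      rw [uIcc_of_le (by linarith), integrableOn_Icc_iff_integrableOn_Ioc]
      exact (hfi _ (by linarith)).1)
  rw [uIcc_of_le (by linarith)] at h
  refine (h t ⟨ht0, by linarith⟩).mono_of_mem_nhdsWithin ?_
  exact mem_nhdsWithin.2 ⟨Iio (t + 1), isOpen_Iio, by simp, fun s hs => ⟨hs.2, le_of_lt hs.1⟩⟩

/-- The primitive of a nonnegative function vanishes up to some threshold and is positive
afterwards. -/
lemma exists_threshold (hfi : ∀ b, 0 ≤ b → IntervalIntegrable f volume 0 b)
    (hf0 : ∀ t, 0 ≤ f t) (hne : ∃ t > 0, 0 < ∫ s in (0 : ℝ)..t, f s) :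
    ∃ t₀ : ℝ, 0 ≤ t₀ ∧ (∀ t ∈ Icc 0 t₀, ∫ s in (0 : ℝ)..t, f s = 0) ∧
      ∀ t, t₀ < t → 0 < ∫ s in (0 : ℝ)..t, f s := by
  set u : ℝ → ℝ := fun t => ∫ s in (0 : ℝ)..t, f s with hu
  have huc : ContinuousOn u (Ici 0) := continuousOn_primitive_Ioi hfi
  have hmono : ∀ s t, 0 ≤ s → s ≤ t → u s ≤ u t := by
    intro s t hs hst
    have h1 := hfi s hs
    have h2 : IntervalIntegrable f volume s t := (hfi s hs).symm.trans (hfi t (hs.trans hst))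
    simp only [u]
    rw [← intervalIntegral.integral_add_adjacent_intervals h1 h2]
    have := intervalIntegral.integral_nonneg (μ := volume) hst (f := f) fun s _ => hf0 s
    linarith
  have hu0 : u 0 = 0 := by simp [u]
  -- The threshold is the infimum of `T`: monotonicity gives `u = 0` before it, and continuity from
  -- the left gives `u = 0` at it.
  set T : Set ℝ := {t | 0 < t ∧ 0 < u t} with hT
  have hTne : T.Nonempty := let ⟨t, h1, h2⟩ := hne; ⟨t, h1, h2⟩
  have hTb : BddBelow T := ⟨0, fun t ht => ht.1.le⟩
  have ht0 : 0 ≤ sInf T := le_csInf hTne fun t ht => ht.1.le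
  have hlt : ∀ t, 0 ≤ t → t < sInf T → u t = 0 := by
    intro t ht htl
    refine le_antisymm ?_ (hu0 ▸ hmono 0 t le_rfl ht)
    by_contra hcon
    push Not at hcon
    have : 0 < t := by
      rcases ht.eq_or_lt with h | h
      · rw [← h, hu0] at hcon; exact absurd hcon (lt_irrefl _)
      · exact h
    exact absurd (csInf_le hTb (show t ∈ T from ⟨this, hcon⟩)) (not_le.2 htl)
  refine ⟨sInf T, ht0, fun t ht => ?_, fun t ht => ?_⟩
  · rcases ht.2.lt_or_eq with h | h
    · exact hlt t ht.1 h
    · subst h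
      rcases ht.1.eq_or_lt with h0 | h0
      · change u (sInf T) = 0
        rw [← h0, hu0]
      · have hc : Tendsto u (𝓝[<] (sInf T)) (𝓝 (u (sInf T))) :=
          ((huc.continuousAt (Ici_mem_nhds h0)).tendsto).mono_left nhdsWithin_le_nhds
        have hz : Tendsto u (𝓝[<] (sInf T)) (𝓝 0) := by
          refine tendsto_const_nhds.congr' ?_
          filter_upwards [Ioo_mem_nhdsLT h0] with s hs
          exact (hlt s hs.1.le hs.2).symm
        exact tendsto_nhds_unique hc hz
  · obtain ⟨s, hs, hst⟩ := exists_lt_of_csInf_lt hTne ht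
    exact hs.2.trans_le (hmono s t hs.1.le hst.le)

lemma tendsto_Ioc_left (t₀ : ℝ) :
    Tendsto (fun n : ℕ => t₀ + 1 / ((n : ℝ) + 1)) atTop (𝓝 t₀) := by
  simpa using tendsto_const_nhds.add (tendsto_one_div_add_atTop_nhds_zero_nat (𝕜 := ℝ))

/-- The summand 2 keeps the right end point strictly beyond the left one already at n = 0. -/
lemma tendsto_Ioc_right (t₀ : ℝ) :
    Tendsto (fun n : ℕ => t₀ + ((n : ℝ) + 2)) atTop atTop :=
  tendsto_atTop_add_const_left _ _
    (tendsto_atTop_add_const_right _ _ tendsto_natCast_atTop_atTop)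

lemma aecover_Ioc_Ioi (t₀ : ℝ) : AECover (volume.restrict (Ioi t₀)) atTop
    fun n : ℕ => Ioc (t₀ + 1 / ((n : ℝ) + 1)) (t₀ + ((n : ℝ) + 2)) :=
  (aecover_Ioi_of_Ioi (tendsto_Ioc_left t₀)).inter (aecover_Iic (tendsto_Ioc_right t₀))

lemma one_div_succ_lt (t₀ : ℝ) (n : ℕ) : t₀ + 1 / ((n : ℝ) + 1) < t₀ + ((n : ℝ) + 2) := by
  have h : (0 : ℝ) ≤ n := n.cast_nonneg
  have : 1 / ((n : ℝ) + 1) ≤ 1 := by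
    rw [div_le_one (by positivity)]; linarith
  linarith

lemma Ioc_approx_subset (t₀ : ℝ) (n : ℕ) :
    Ioc (t₀ + 1 / ((n : ℝ) + 1)) (t₀ + ((n : ℝ) + 2)) ⊆ Ioi t₀ := fun t ht => by
  have h : 0 < 1 / ((n : ℝ) + 1) := by positivity
  have := ht.1
  rw [mem_Ioi]; linarith

lemma blissWeight_continuousOn {t₀ : ℝ} {u : ℝ → ℝ} (ht₀ : 0 ≤ t₀)
    (huc : ContinuousOn u (Ici 0)) (hpos : ∀ t, t₀ < t → 0 < u t) :
    ContinuousOn (blissWeight p α u) (Ioi t₀) := by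
  refine ContinuousOn.mul ?_ ?_
  · exact (huc.mono fun t (ht : t₀ < t) => ht₀.trans ht.le).rpow_const
      fun t ht => Or.inl (hpos t ht).ne'
  · exact continuousOn_id.rpow_const fun t (ht : t₀ < t) => Or.inl (ht₀.trans_lt ht).ne'

/-- The interval inequality has a right side independent of the interval. Exhausting (t₀, ∞)
therefore yields first integrability of the weight and then the inequality in the limit. -/
lemma bliss_nonneg_aux {t₀ : ℝ} (hp : 1 < p) (hα : 0 < α) (hf0 : ∀ t, 0 ≤ f t)
    (hm : AEStronglyMeasurable f (volume.restrict (Ioi 0)))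
    (hf : IntegrableOn (fun t => f t ^ p) (Ioi 0)) (ht₀ : 0 ≤ t₀)
    (hpos : ∀ t, t₀ < t → 0 < ∫ s in (0 : ℝ)..t, f s) :
    IntegrableOn (blissWeight p α (fun t => ∫ s in (0 : ℝ)..t, f s)) (Ioi t₀) ∧
    blissConst p α *
        (∫ t in Ioi t₀, blissWeight p α (fun t => ∫ s in (0 : ℝ)..t, f s) t) ^ (1 / (1 + α)) ≤
      ∫ t in Ioi 0, f t ^ p := by
  set u : ℝ → ℝ := fun t => ∫ s in (0 : ℝ)..t, f s with hu
  set A := ∫ t in Ioi 0, f t ^ p with hA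
  have hfi : ∀ b, 0 ≤ b → IntervalIntegrable f volume 0 b := fun b hb =>
    intervalIntegrable_of_rpow hp hb hm (by simpa only [abs_of_nonneg (hf0 _)] using hf)
  have huc : ContinuousOn u (Ici 0) := continuousOn_primitive_Ioi hfi
  have hwc : ContinuousOn (blissWeight p α u) (Ioi t₀) := blissWeight_continuousOn ht₀ huc hpos
  have hC := blissConst_pos hp hα
  have hn : ∀ n : ℕ, t₀ < t₀ + 1 / ((n : ℝ) + 1) := fun n => by
    have : 0 < 1 / ((n : ℝ) + 1) := by positivity
    linarith
  have hint : ∀ n : ℕ, IntegrableOn (blissWeight p α u)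
      (Ioc (t₀ + 1 / ((n : ℝ) + 1)) (t₀ + ((n : ℝ) + 2))) := by
    intro n
    refine (ContinuousOn.integrableOn_Icc (hwc.mono ?_)).mono_set Ioc_subset_Icc_self
    exact fun t ht => (hn n).trans_le ht.1
  have hle : ∀ n : ℕ, blissConst p α * (∫ t in Ioc (t₀ + 1 / ((n : ℝ) + 1)) (t₀ + ((n : ℝ) + 2)),
      blissWeight p α u t) ^ (1 / (1 + α)) ≤ A := by
    intro n
    rw [← intervalIntegral.integral_of_le (one_div_succ_lt t₀ n).le]
    exact bliss_on_interval hp hα (ht₀.trans_lt (hn n)) (one_div_succ_lt t₀ n) hf0 hm hf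
      (hpos _ (hn n)) fun t ht => hpos t ((hn n).trans_le ht.1)
  have hnn : ∀ n : ℕ, 0 ≤ ∫ t in Ioc (t₀ + 1 / ((n : ℝ) + 1)) (t₀ + ((n : ℝ) + 2)),
      blissWeight p α u t := fun n => setIntegral_nonneg measurableSet_Ioc fun t ht =>
        (blissWeight_pos (ht₀.trans_lt ((hn n).trans ht.1)) (hpos t ((hn n).trans ht.1))).le
  have hI : IntegrableOn (blissWeight p α u) (Ioi t₀) := by
    refine (aecover_Ioc_Ioi t₀).integrable_of_integral_norm_bounded ((A / blissConst p α) ^ (1 + α))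
      (fun n => (hint n).mono_measure Measure.restrict_le_self) ?_
    refine Eventually.of_forall fun n => ?_
    have hsub : Ioc (t₀ + 1 / ((n : ℝ) + 1)) (t₀ + ((n : ℝ) + 2)) ⊆ Ioi t₀ :=
      fun t ht => (hn n).trans ht.1
    rw [Measure.restrict_restrict_of_subset hsub]
    rw [setIntegral_congr_fun (g := blissWeight p α u) measurableSet_Ioc fun t ht => by
      rw [Real.norm_of_nonneg (blissWeight_pos (ht₀.trans_lt (hsub ht)) (hpos t (hsub ht))).le]]
    -- Solving the interval inequality for the integral gives the uniform bound.
    have h1 := hle n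
    rw [mul_comm, ← le_div_iff₀ hC] at h1
    have h2 := Real.rpow_le_rpow (Real.rpow_nonneg (hnn n) _) h1 (show 0 ≤ 1 + α by linarith)
    rwa [← Real.rpow_mul (hnn n), one_div_mul_cancel (by linarith : 1 + α ≠ 0),
      Real.rpow_one] at h2
  refine ⟨hI, ?_⟩
  have hlim := (aecover_Ioc_Ioi t₀).integral_tendsto_of_countably_generated hI
  have hlim2 : Tendsto (fun n : ℕ => blissConst p α *
      (∫ t in Ioc (t₀ + 1 / ((n : ℝ) + 1)) (t₀ + ((n : ℝ) + 2)), blissWeight p α u t) ^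
        (1 / (1 + α))) atTop
      (𝓝 (blissConst p α * (∫ t in Ioi t₀, blissWeight p α u t) ^ (1 / (1 + α)))) := by
    refine Tendsto.const_mul _ (Tendsto.rpow_const ?_ (Or.inr (by positivity)))
    refine hlim.congr fun n => ?_
    rw [Measure.restrict_restrict_of_subset (Ioc_approx_subset t₀ n)]
  exact le_of_tendsto' hlim2 hle

/-! ### Equality in Bliss' inequality for nonnegative derivatives. -/

/-- In the case of equality the calibration is tight at every point. -/
lemma bliss_equality_density {t₀ : ℝ} (hp : 1 < p) (hα : 0 < α) (hf0 : ∀ t, 0 ≤ f t)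
    (hm : AEStronglyMeasurable f (volume.restrict (Ioi 0)))
    (hf : IntegrableOn (fun t => f t ^ p) (Ioi 0)) (ht₀ : 0 ≤ t₀)
    (hpos : ∀ t, t₀ < t → 0 < ∫ s in (0 : ℝ)..t, f s)
    (heq : blissConst p α *
        (∫ t in Ioi t₀, blissWeight p α (fun t => ∫ s in (0 : ℝ)..t, f s) t) ^ (1 / (1 + α)) =
      ∫ t in Ioi 0, f t ^ p) :
    ∃ I > 0, ∃ M : ℝ → ℝ, ∀ t, t₀ < t → M t ∈ Ioo (0 : ℝ) 1 ∧
      HasDerivAt M (blissWeight p α (fun t => ∫ s in (0 : ℝ)..t, f s) t / I) t ∧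
      blissConst p α * I ^ (-(α / (1 + α))) *
        blissWeight p α (fun t => ∫ s in (0 : ℝ)..t, f s) t =
      blissDensity p α I (fun t => ∫ s in (0 : ℝ)..t, f s) M t := by
  obtain ⟨hI, -⟩ := bliss_nonneg_aux hp hα hf0 hm hf ht₀ hpos
  set u : ℝ → ℝ := fun t => ∫ s in (0 : ℝ)..t, f s with hu
  set w := blissWeight p α u with hw
  set A := ∫ t in Ioi 0, f t ^ p with hA
  have hfi : ∀ b, 0 ≤ b → IntervalIntegrable f volume 0 b := fun b hb =>
    intervalIntegrable_of_rpow hp hb hm (by simpa only [abs_of_nonneg (hf0 _)] using hf)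
  have huc : ContinuousOn u (Ici 0) := continuousOn_primitive_Ioi hfi
  have hwc : ContinuousOn w (Ioi t₀) := blissWeight_continuousOn ht₀ huc hpos
  have hwpos : ∀ t, t₀ < t → 0 < w t := fun t ht => blissWeight_pos (ht₀.trans_lt ht) (hpos t ht)
  set I := ∫ t in Ioi t₀, w t with hIdef
  have hii : ∀ a b, t₀ ≤ a → a ≤ b → IntervalIntegrable w volume a b := by
    intro a b ha hab
    rw [intervalIntegrable_iff_integrableOn_Ioc_of_le hab]
    exact hI.mono_set fun t ht => ha.trans_lt ht.1
  have hipos : ∀ a b, t₀ ≤ a → a < b → 0 < ∫ s in a..b, w s := fun a b ha hab =>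
    intervalIntegral.intervalIntegral_pos_of_pos_on (hii a b ha hab.le)
      (fun t ht => hwpos t (ha.trans_lt ht.1)) hab
  have hsplit : ∀ a b, t₀ ≤ a → a ≤ b → ∫ s in Ioi a, w s = (∫ s in a..b, w s) + ∫ s in Ioi b, w s := by
    intro a b ha hab
    rw [intervalIntegral.integral_of_le hab, ← setIntegral_union Ioc_disjoint_Ioi_same
      measurableSet_Ioi (hI.mono_set fun t ht => ha.trans_lt ht.1)
      (hI.mono_set fun t (ht : b < t) => (ha.trans hab).trans_lt ht), Ioc_union_Ioi_eq_Ioi hab]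
  have hIoi_nn : ∀ a, t₀ ≤ a → 0 ≤ ∫ s in Ioi a, w s := fun a ha =>
    setIntegral_nonneg measurableSet_Ioi fun t ht => (hwpos t (ha.trans_lt ht)).le
  have hIoi_pos : ∀ a, t₀ ≤ a → 0 < ∫ s in Ioi a, w s := by
    intro a ha
    rw [hsplit a (a + 1) ha (by linarith)]
    have := hipos a (a + 1) ha (by linarith)
    have := hIoi_nn (a + 1) (by linarith)
    linarith
  have hIpos : 0 < I := hIoi_pos t₀ le_rfl
  -- No padding is needed: for t > t₀ there is positive mass on both sides of `t`.
  set M : ℝ → ℝ := fun t => (∫ s in t₀..t, w s) / I with hM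
  have hMm : ∀ t, t₀ < t → M t ∈ Ioo (0 : ℝ) 1 := by
    intro t ht
    refine ⟨div_pos (hipos t₀ t le_rfl ht) hIpos, ?_⟩
    simp only [hM]
    rw [div_lt_one hIpos, hIdef, hsplit t₀ t le_rfl ht.le]
    linarith [hIoi_pos t ht.le]
  have hMd : ∀ t, t₀ < t → HasDerivAt M (w t / I) t := by
    intro t ht
    refine HasDerivAt.div_const ?_ I
    exact intervalIntegral.integral_hasDerivAt_right (hii t₀ t le_rfl ht.le)
      (hwc.stronglyMeasurableAtFilter isOpen_Ioi t ht) (hwc.continuousAt (Ioi_mem_nhds ht))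
  refine ⟨I, hIpos, M, fun t ht => ⟨hMm t ht, hMd t ht, ?_⟩⟩
  set c := blissConst p α * I ^ (-(α / (1 + α))) with hc
  have hge : ∀ t, t₀ < t → c * w t ≤ blissDensity p α I u M t := fun t ht =>
    blissDensity_ge hp hα (ht₀.trans_lt ht) (hpos t ht) hIpos (hMm t ht)
  refine le_antisymm (hge t ht) ?_
  by_contra hcon
  push Not at hcon
  have hcal : ∀ a b, t₀ < a → a ≤ b → ContinuousOn (blissDensity p α I u M) (Icc a b) ∧
      ∫ t in a..b, blissDensity p α I u M t ≤ A := by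
    intro a b ha hab
    have ha0 : 0 < a := ht₀.trans_lt ha
    have hb0 : 0 < b := ha0.trans_le hab
    have hfp : IntervalIntegrable (fun t => f t ^ p) volume 0 b := by
      rw [intervalIntegrable_iff_integrableOn_Ioc_of_le hb0.le]
      exact hf.mono_set Ioc_subset_Ioi_self
    obtain ⟨h1, h2⟩ := bliss_calibration (M := M) hp hα ha0 hab hIpos hf0 (hfi b hb0.le) hfp
      (hpos a ha) (fun t ht => hMm t (ha.trans_le ht.1)) (fun t ht => hMd t (ha.trans_le ht.1))
    refine ⟨h1, h2.trans ?_⟩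
    rw [intervalIntegral.integral_of_le hb0.le]
    exact setIntegral_mono_set hf (ae_of_all _ fun t => Real.rpow_nonneg (hf0 t) _)
      (LE.le.eventuallyLE Ioc_subset_Ioi_self)
  have hwcc : ∀ a b, t₀ < a → ContinuousOn w (Icc a b) := fun a b ha =>
    hwc.mono fun t ht => ha.trans_le ht.1
  have hdii : ∀ a b, t₀ < a → a ≤ b →
      IntervalIntegrable (fun t => blissDensity p α I u M t - c * w t) volume a b := by
    intro a b ha hab
    exact ((hcal a b ha hab).1.sub (continuousOn_const.mul (hwcc a b ha))).intervalIntegrable_of_Icc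
      hab
  -- By continuity, strictness at the one point `t` costs a fixed δ > 0 on every interval containing
  -- [t, t + 1].
  set δ := ∫ s in t..(t + 1), (blissDensity p α I u M s - c * w s) with hδ
  have hδpos : 0 < δ := by
    refine intervalIntegral.integral_pos (by linarith)
      ((hcal t (t + 1) ht (by linarith)).1.sub (continuousOn_const.mul (hwcc t _ ht)))
      (fun s hs => sub_nonneg.2 (hge s (ht.trans hs.1))) ⟨t, ⟨le_rfl, by linarith⟩, ?_⟩
    exact sub_pos.2 hcon
  have hlim := (aecover_Ioc_Ioi t₀).integral_tendsto_of_countably_generated hI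
  have hn : ∀ n : ℕ, t₀ < t₀ + 1 / ((n : ℝ) + 1) := fun n => by
    have : 0 < 1 / ((n : ℝ) + 1) := by positivity
    linarith
  have hev : ∀ᶠ n : ℕ in atTop,
      c * (∫ s in Ioc (t₀ + 1 / ((n : ℝ) + 1)) (t₀ + ((n : ℝ) + 2)), w s
        ∂(volume.restrict (Ioi t₀))) ≤ A - δ := by
    filter_upwards [(tendsto_Ioc_left t₀).eventually_le_const ht,
      (tendsto_Ioc_right t₀).eventually_ge_atTop (t + 1)] with n h1 h2
    rw [Measure.restrict_restrict_of_subset (Ioc_approx_subset t₀ n),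
      ← intervalIntegral.integral_of_le (one_div_succ_lt t₀ n).le]
    set a := t₀ + 1 / ((n : ℝ) + 1)
    set b := t₀ + ((n : ℝ) + 2)
    have hab : a ≤ b := (one_div_succ_lt t₀ n).le
    have h3 := (hcal a b (hn n) hab).2
    have h4 : δ ≤ ∫ s in a..b, (blissDensity p α I u M s - c * w s) := by
      refine intervalIntegral.integral_mono_interval h1 (by linarith) h2 ?_ (hdii a b (hn n) hab)
      refine (ae_restrict_mem measurableSet_Ioc).mono fun s hs => ?_
      exact sub_nonneg.2 (hge s ((hn n).trans hs.1))
    rw [intervalIntegral.integral_sub ((hcal a b (hn n) hab).1.intervalIntegrable_of_Icc hab)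
      (((hwcc a b (hn n)).intervalIntegrable_of_Icc hab).const_mul c),
      intervalIntegral.integral_const_mul] at h4
    linarith
  have hfin := le_of_tendsto (hlim.const_mul c) hev
  rw [← heq, ← hIdef] at hfin
  -- Hence `c * I` equals the energy `A`, against the bound A - δ obtained in the limit.
  have : c * I = blissConst p α * I ^ (1 / (1 + α)) := by
    rw [hc, mul_assoc]
    congr 1
    conv_lhs => rw [← Real.rpow_one I, ← Real.rpow_mul hIpos.le, one_mul, ← Real.rpow_add hIpos]
    congr 1
    field_simp
    ring
  linarith

end nonneg

/-- The extremal functions of Bliss' inequality. -/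
def blissExtremal (α a b t : ℝ) : ℝ := (a + b * t ^ (-α)) ^ (-(1 / α))

lemma blissExtremal_pos {α a b t : ℝ} (ha : 0 < a) (hb : 0 < b) (ht : 0 < t) :
    0 < blissExtremal α a b t := by unfold blissExtremal; positivity

section nonneg

variable {p α : ℝ} {f : ℝ → ℝ}

/-- Tightness in the Bernoulli step means D = α, which is the logistic equation tη' = -αη(1-η). Its
solutions are 1/(1 + c t^α). Substituting them back, D = α becomes an algebraic equation for `u`. -/
lemma bliss_equality_formula {t₀ : ℝ} (hp : 1 < p) (hα : 0 < α) (hf0 : ∀ t, 0 ≤ f t)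
    (hm : AEStronglyMeasurable f (volume.restrict (Ioi 0)))
    (hf : IntegrableOn (fun t => f t ^ p) (Ioi 0)) (ht₀ : 0 ≤ t₀)
    (hut₀ : ∫ s in (0 : ℝ)..t₀, f s = 0)
    (hpos : ∀ t, t₀ < t → 0 < ∫ s in (0 : ℝ)..t, f s)
    (heq : blissConst p α *
        (∫ t in Ioi t₀, blissWeight p α (fun t => ∫ s in (0 : ℝ)..t, f s) t) ^ (1 / (1 + α)) =
      ∫ t in Ioi 0, f t ^ p) :
    ∃ a > 0, ∃ b > 0, ∀ t > 0, ∫ s in (0 : ℝ)..t, f s = blissExtremal α a b t := by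
  obtain ⟨I, hI, M, hM⟩ := bliss_equality_density hp hα hf0 hm hf ht₀ hpos heq
  set u : ℝ → ℝ := fun t => ∫ s in (0 : ℝ)..t, f s with hu
  have hfi : ∀ b, 0 ≤ b → IntervalIntegrable f volume 0 b := fun b hb =>
    intervalIntegrable_of_rpow hp hb hm (by simpa only [abs_of_nonneg (hf0 _)] using hf)
  have huc : ContinuousOn u (Ici 0) := continuousOn_primitive_Ioi hfi
  set γ := (1 + α) / α with hγdef
  have hγ : 0 < γ := by positivity
  have hA : 0 < (p - 1) * γ := mul_pos (by linarith) hγ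
  set B := ProbabilityTheory.beta ((p - 1) * γ) γ with hBdef
  have hB : 0 < B := ProbabilityTheory.beta_pos hA hγ
  set η : ℝ → ℝ := fun t => betaQuantile ((p - 1) * γ) γ (M t) with hη
  set k : ℝ → ℝ := fun t => betaKernel ((p - 1) * γ) γ (η t) with hk
  have hηm : ∀ t, t₀ < t → η t ∈ Ioo (0 : ℝ) 1 := fun t ht =>
    (betaQuantile_spec hA hγ (hM t ht).1).1
  have hkpos : ∀ t, t₀ < t → 0 < k t := fun t ht => betaKernel_pos (hηm t ht).1 (hηm t ht).2
  have hD : ∀ t, t₀ < t → t * (B * blissWeight p α u t / (I * k t)) / (η t * (1 - η t)) = α := by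
    intro t ht
    exact (bliss_pointwise hp hα (hpos t ht) (ht₀.trans_lt ht) (hηm t ht).1 (hηm t ht).2 hI).2
      (hM t ht).2.2
  have hηd : ∀ t, t₀ < t → HasDerivAt η (-(α * (η t * (1 - η t)) / t)) t := by
    intro t ht
    have h := (betaQuantile_hasDerivAt hA hγ (hM t ht).1).comp t (hM t ht).2.1
    refine HasDerivAt.congr_deriv (f := η) h ?_
    have h1 := hD t ht
    have h2 : 0 < η t * (1 - η t) := mul_pos (hηm t ht).1 (by linarith [(hηm t ht).2])
    have h3 := ht₀.trans_lt ht
    have h4 := hkpos t ht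
    rw [div_eq_iff h2.ne'] at h1
    rw [← h1]
    change -(B / k t) * (blissWeight p α u t / I) = _
    field_simp
  -- A first integral of the logistic equation.
  set κ : ℝ → ℝ := fun t => (1 - η t) / η t * t ^ (-α) with hκ
  have hκd : ∀ t, t₀ < t → HasDerivAt κ 0 t := by
    intro t ht
    have ht0 := ht₀.trans_lt ht
    have h1 := (hηm t ht).1
    have h := (((hηd t ht).const_sub 1).div (hηd t ht) h1.ne').mul
      (Real.hasDerivAt_rpow_const (x := t) (p := -α) (Or.inl ht0.ne'))
    refine HasDerivAt.congr_deriv (f := κ) h ?_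
    rw [Real.rpow_sub ht0, Real.rpow_one]
    simp only [Pi.div_apply]
    field_simp
    ring
  obtain ⟨c, hc⟩ : ∃ c, ∀ t, t₀ < t → κ t = c := by
    obtain ⟨c, hc⟩ := isOpen_Ioi.exists_is_const_of_deriv_eq_zero (s := Ioi t₀) (f := κ)
      isPreconnected_Ioi (fun t ht => (hκd t ht).differentiableAt.differentiableWithinAt)
      (fun t ht => (hκd t ht).deriv)
    exact ⟨c, fun t ht => hc t ht⟩
  have hcpos : 0 < c := by
    rw [← hc (t₀ + 1) (by linarith)]
    have h1 := hηm (t₀ + 1) (by linarith)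
    have : 0 < 1 - η (t₀ + 1) := by linarith [h1.2]
    have := h1.1
    have : 0 < t₀ + 1 := by linarith
    positivity
  have hηe : ∀ t, t₀ < t → η t = (1 + c * t ^ α)⁻¹ := by
    intro t ht
    have ht0 := ht₀.trans_lt ht
    have h1 := (hηm t ht).1
    have h2 := hc t ht
    simp only [hκ] at h2
    rw [Real.rpow_neg ht0.le] at h2
    have h3 : 0 < t ^ α := Real.rpow_pos_of_pos ht0 _
    refine eq_inv_of_mul_eq_one_left ?_
    rw [← h2]
    field_simp
    ring
  set K := α * I / B * c ^ γ with hKdef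
  have hK : 0 < K := by positivity
  set q := p * (1 + α) with hq
  have hqpos : 0 < q := by positivity
  -- Solve D = α for the weight, insert the explicit η into the beta kernel, and multiply by t^{q-α}
  -- to isolate u^q.
  have huq : ∀ t, t₀ < t → u t ^ q = K * (t * (1 + c * t ^ α) ^ (-(1 / α))) ^ q := by
    intro t ht
    have ht0 := ht₀.trans_lt ht
    have h1 := (hηm t ht).1
    have h1' : 0 < 1 - η t := by linarith [(hηm t ht).2]
    have hta : 0 < t ^ α := Real.rpow_pos_of_pos ht0 _
    set S := 1 + c * t ^ α with hS
    have hSpos : 0 < S := by positivity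
    have hηS : η t = S⁻¹ := hηe t ht
    have h1S : 1 - η t = c * t ^ α * S⁻¹ := by
      rw [hηS]; field_simp; rw [hS]; ring
    have h2 := hD t ht
    have hwe : blissWeight p α u t = α * I / B * (k t * (η t * (1 - η t))) / t := by
      rw [div_eq_iff (by positivity)] at h2
      have := hkpos t ht
      field_simp at h2 ⊢
      linarith
    have hkk : k t * (η t * (1 - η t)) = c ^ γ * t ^ (1 + α) * S ^ (-(q / α)) := by
      have e0 : k t * (η t * (1 - η t)) = η t ^ ((p - 1) * γ) * (1 - η t) ^ γ := by
        simp only [hk, betaKernel]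
        conv_rhs => rw [show (p - 1) * γ = ((p - 1) * γ - 1) + 1 by ring,
          show (γ : ℝ) = (γ - 1) + 1 by ring, Real.rpow_add h1, Real.rpow_add h1',
          Real.rpow_one, Real.rpow_one]
        ring_nf
      rw [e0, h1S, Real.mul_rpow (by positivity) (by positivity),
        Real.mul_rpow (by positivity) (by positivity), hηS, Real.inv_rpow hSpos.le,
        Real.inv_rpow hSpos.le, ← Real.rpow_neg hSpos.le, ← Real.rpow_neg hSpos.le,
        ← Real.rpow_mul ht0.le]
      have e1 : α * γ = 1 + α := by rw [hγdef]; field_simp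
      have e2 : S ^ (-(q / α)) = S ^ (-((p - 1) * γ)) * S ^ (-γ) := by
        rw [← Real.rpow_add hSpos]; congr 1; rw [hγdef, hq]; field_simp; ring
      rw [e1, e2]; ring
    have hwu : u t ^ q = blissWeight p α u t * t ^ (q - α) := by
      simp only [blissWeight]
      rw [mul_assoc, ← Real.rpow_add ht0, ← hq]
      simp
    rw [hwu, hwe, hkk, Real.mul_rpow ht0.le (by positivity), ← Real.rpow_mul hSpos.le]
    have e3 : t ^ (1 + α) * t ^ (q - α) = t * t ^ q := by
      rw [← Real.rpow_add ht0]
      conv_rhs => rw [← Real.rpow_one t, ← Real.rpow_mul ht0.le, one_mul, ← Real.rpow_add ht0]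
      congr 1; ring
    have e4 : -(1 / α) * q = -(q / α) := by ring
    rw [e4, hKdef]
    field_simp
    linear_combination e3
  set E := K ^ (1 / q) with hE
  have hEpos : 0 < E := by positivity
  have hue : ∀ t, t₀ < t → u t = E * (t * (1 + c * t ^ α) ^ (-(1 / α))) := by
    intro t ht
    have ht0 := ht₀.trans_lt ht
    have hta : 0 < t ^ α := Real.rpow_pos_of_pos ht0 _
    have hX : 0 ≤ t * (1 + c * t ^ α) ^ (-(1 / α)) := by positivity
    have h := congrArg (fun x : ℝ => x ^ (1 / q)) (huq t ht)
    rwa [Real.mul_rpow hK.le (by positivity), ← Real.rpow_mul (hpos t ht).le,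
      ← Real.rpow_mul hX, mul_one_div_cancel hqpos.ne', Real.rpow_one, Real.rpow_one] at h
  -- At a positive threshold the explicit formula has a positive limit from the right, whereas `u`
  -- is continuous and vanishes there.
  have ht00 : t₀ = 0 := by
    by_contra hne
    have h0 : 0 < t₀ := lt_of_le_of_ne ht₀ (Ne.symm hne)
    have c1 : Tendsto u (𝓝[>] t₀) (𝓝 (u t₀)) :=
      ((huc.continuousAt (Ici_mem_nhds h0)).tendsto).mono_left nhdsWithin_le_nhds
    have c2 : ContinuousAt (fun t : ℝ => E * (t * (1 + c * t ^ α) ^ (-(1 / α)))) t₀ := by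
      have : 0 < t₀ ^ α := Real.rpow_pos_of_pos h0 _
      have h3 : ContinuousAt (fun t : ℝ => t ^ α) t₀ :=
        Real.continuousAt_rpow_const _ _ (Or.inl h0.ne')
      refine continuousAt_const.mul (continuousAt_id.mul (ContinuousAt.rpow_const ?_ (Or.inl ?_)))
      · exact continuousAt_const.add (continuousAt_const.mul h3)
      · positivity
    have c3 : Tendsto u (𝓝[>] t₀) (𝓝 (E * (t₀ * (1 + c * t₀ ^ α) ^ (-(1 / α))))) := by
      refine (c2.tendsto.mono_left nhdsWithin_le_nhds).congr' ?_
      filter_upwards [self_mem_nhdsWithin] with t ht using (hue t ht).symm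
    have h4 := tendsto_nhds_unique c1 c3
    have h5 : u t₀ = 0 := hut₀
    have : 0 < t₀ ^ α := Real.rpow_pos_of_pos h0 _
    have h6 : 0 < E * (t₀ * (1 + c * t₀ ^ α) ^ (-(1 / α))) := by positivity
    linarith
  -- Moving the factor E t inside the power -1/α turns E t (1 + c t^α)^{-1/α} into the two-parameter
  -- form.
  refine ⟨E ^ (-α) * c, by positivity, E ^ (-α), by positivity, fun t ht => ?_⟩
  change u t = _
  rw [hue t (by rw [ht00]; exact ht), blissExtremal]
  have hta : 0 < t ^ α := Real.rpow_pos_of_pos ht _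
  have e1 : E ^ (-α) * c + E ^ (-α) * t ^ (-α) = E ^ (-α) * (t ^ (-α) * (1 + c * t ^ α)) := by
    rw [Real.rpow_neg ht.le]; field_simp; ring
  rw [e1, Real.mul_rpow (by positivity) (by positivity), Real.mul_rpow (by positivity)
    (by positivity), ← Real.rpow_mul hEpos.le, ← Real.rpow_mul ht.le]
  have e2 : -α * -(1 / α) = 1 := by field_simp
  rw [e2, Real.rpow_one, Real.rpow_one]

end nonneg

/-! ### The extremals attain equality. -/

/-- The derivative of `blissExtremal`. -/
def blissExtremalDeriv (α a b t : ℝ) : ℝ := b * (b + a * t ^ α) ^ (-(1 / α) - 1)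

section extremal

variable {p α a b : ℝ}

/-- The right side is continuous at t = 0 with value 0, as the fundamental theorem on [0, t]
requires. -/
lemma blissExtremal_eq {t : ℝ} (hα : 0 < α) (ha : 0 < a) (hb : 0 < b) (ht : 0 < t) :
    blissExtremal α a b t = t * (b + a * t ^ α) ^ (-(1 / α)) := by
  have hta : 0 < t ^ α := Real.rpow_pos_of_pos ht _
  have e1 : a + b * t ^ (-α) = t ^ (-α) * (b + a * t ^ α) := by
    rw [Real.rpow_neg ht.le]; field_simp; ring
  rw [blissExtremal, e1, Real.mul_rpow (by positivity) (by positivity), ← Real.rpow_mul ht.le]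
  have e2 : -α * -(1 / α) = 1 := by field_simp
  rw [e2, Real.rpow_one]

lemma hasDerivAt_add_mul_rpow {t : ℝ} (ht : 0 < t) :
    HasDerivAt (fun t : ℝ => b + a * t ^ α) (a * (α * t ^ (α - 1))) t :=
  ((Real.hasDerivAt_rpow_const (Or.inl ht.ne')).const_mul a).const_add b

lemma blissExtremal_hasDerivAt {t : ℝ} (hα : 0 < α) (ha : 0 < a) (hb : 0 < b) (ht : 0 < t) :
    HasDerivAt (fun t => t * (b + a * t ^ α) ^ (-(1 / α))) (blissExtremalDeriv α a b t) t := by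
  have hta : 0 < t ^ α := Real.rpow_pos_of_pos ht _
  set S := b + a * t ^ α with hS
  have hSpos : 0 < S := by positivity
  have h := (hasDerivAt_id t).mul ((hasDerivAt_add_mul_rpow (α := α) (a := a) (b := b) ht).rpow_const
    (p := -(1 / α)) (Or.inl hSpos.ne'))
  refine h.congr_deriv ?_
  simp only [id]
  rw [blissExtremalDeriv, ← hS]
  have e : S ^ (-(1 / α)) = S ^ (-(1 / α) - 1) * S := by
    rw [Real.rpow_sub_one hSpos.ne']; field_simp
  rw [e, Real.rpow_sub_one ht.ne']
  field_simp
  rw [hS]; ring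

lemma add_mul_rpow_continuousOn (hα : 0 < α) :
    ContinuousOn (fun t : ℝ => b + a * t ^ α) (Ici 0) :=
  continuousOn_const.add (continuousOn_const.mul
    (continuousOn_id.rpow_const fun _ _ => Or.inr hα.le))

lemma add_mul_rpow_pos {t : ℝ} (ha : 0 < a) (hb : 0 < b) (ht : 0 ≤ t) :
    0 < b + a * t ^ α := by
  have := Real.rpow_nonneg ht α
  positivity

lemma blissExtremalDeriv_continuousOn (hα : 0 < α) (ha : 0 < a) (hb : 0 < b) :
    ContinuousOn (blissExtremalDeriv α a b) (Ici 0) :=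
  continuousOn_const.mul ((add_mul_rpow_continuousOn hα).rpow_const
    fun _ ht => Or.inl (add_mul_rpow_pos ha hb ht).ne')

lemma blissExtremalDeriv_pos {t : ℝ} (ha : 0 < a) (hb : 0 < b) (ht : 0 ≤ t) :
    0 < blissExtremalDeriv α a b t :=
  mul_pos hb (Real.rpow_pos_of_pos (add_mul_rpow_pos ha hb ht) _)

lemma integral_blissExtremalDeriv {t : ℝ} (hα : 0 < α) (ha : 0 < a) (hb : 0 < b) (ht : 0 < t) :
    ∫ s in (0 : ℝ)..t, blissExtremalDeriv α a b s = blissExtremal α a b t := by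
  rw [blissExtremal_eq hα ha hb ht]
  have hsub : Icc 0 t ⊆ Ici (0 : ℝ) := fun s hs => hs.1
  rw [intervalIntegral.integral_eq_sub_of_hasDerivAt_of_le ht.le
    (f := fun t => t * (b + a * t ^ α) ^ (-(1 / α))) ?_
    (fun s hs => blissExtremal_hasDerivAt hα ha hb hs.1)
    (((blissExtremalDeriv_continuousOn hα ha hb).mono hsub).intervalIntegrable_of_Icc ht.le)]
  · simp
  · exact continuousOn_id.mul (((add_mul_rpow_continuousOn hα).mono hsub).rpow_const
      fun s hs => Or.inl (add_mul_rpow_pos ha hb hs.1).ne')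

lemma tendsto_div_add_mul_rpow (hα : 0 < α) (ha : 0 < a) :
    Tendsto (fun t : ℝ => b / (b + a * t ^ α)) atTop (𝓝 0) :=
  Tendsto.div_atTop tendsto_const_nhds
    (tendsto_atTop_add_const_left _ _ ((tendsto_rpow_atTop hα).const_mul_atTop ha))

lemma div_add_mul_rpow_mem {t : ℝ} (ha : 0 < a) (hb : 0 < b) (ht : 0 ≤ t) :
    b / (b + a * t ^ α) ∈ Icc (0 : ℝ) 1 := by
  have h := add_mul_rpow_pos (α := α) ha hb ht
  refine ⟨by positivity, ?_⟩
  rw [div_le_one h]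
  have := Real.rpow_nonneg ht α
  nlinarith

/-- Here η = b/(b + a t^α), and both integrands have antiderivatives. The weight is a multiple of
the derivative of `G`, the incomplete beta integral at η. The p-th power of u' differs from a
multiple of the weight by the derivative of `P`, the calibration's boundary function u^p(η/t)^{p-1},
which vanishes at 0 and at infinity. Both integrals are then explicit multiples of the beta value.
-/
lemma bliss_extremal (hp : 1 < p) (hα : 0 < α) (ha : 0 < a) (hb : 0 < b) :
    IntegrableOn (fun t => blissExtremalDeriv α a b t ^ p) (Ioi 0) ∧
      blissConst p α * (∫ t in Ioi 0, blissWeight p α (blissExtremal α a b) t) ^ (1 / (1 + α)) =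
        ∫ t in Ioi 0, blissExtremalDeriv α a b t ^ p := by
  set γ := (1 + α) / α with hγdef
  have hγ : 0 < γ := by positivity
  have hA : 0 < (p - 1) * γ := mul_pos (by linarith) hγ
  set B := ProbabilityTheory.beta ((p - 1) * γ) γ with hBdef
  have hB : 0 < B := ProbabilityTheory.beta_pos hA hγ
  set κ := a * b ^ (p - 1) with hκ
  have hκpos : 0 < κ := by positivity
  set w := blissWeight p α (blissExtremal α a b) with hw
  set G : ℝ → ℝ := fun t => incBeta ((p - 1) * γ) γ (b / (b + a * t ^ α)) with hG
  set m := p / α + p - 1 with hm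
  have hmpos : 0 < m := by
    have : 0 < p / α := div_pos (by linarith) hα
    rw [hm]; linarith
  set P : ℝ → ℝ := fun t => b ^ (p - 1) * (t * (b + a * t ^ α) ^ (-m)) with hP
  have hwe : ∀ t, 0 < t → w t = t ^ α * (b + a * t ^ α) ^ (-m - 1) := by
    intro t ht
    have hS := add_mul_rpow_pos (α := α) ha hb ht.le
    rw [hw, blissWeight, blissExtremal_eq hα ha hb ht, Real.mul_rpow ht.le (by positivity),
      ← Real.rpow_mul hS.le]
    have e1 : -(1 / α) * (p * (1 + α)) = -m - 1 := by rw [hm]; field_simp; ring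
    have e2 : t ^ α = t ^ (p * (1 + α)) * t ^ (α - p * (1 + α)) := by
      rw [← Real.rpow_add ht]; congr 1; ring
    rw [e1, e2]; ring
  have hwpos : ∀ t, 0 < t → 0 < w t := fun t ht => by
    have hS := add_mul_rpow_pos (α := α) ha hb ht.le
    rw [hwe t ht]; positivity
  have hGd : ∀ t ∈ Ioi (0 : ℝ), HasDerivAt G (α * κ ^ γ * w t) t := by
    intro t ht
    have ht0 : 0 < t := ht
    have hta : 0 < t ^ α := Real.rpow_pos_of_pos ht0 _
    set S := b + a * t ^ α with hS
    have hSpos : 0 < S := by positivity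
    have h0 : 0 < b / S := by positivity
    have h1 : b / S < 1 := by rw [div_lt_one hSpos, hS]; nlinarith
    have hd := (hasDerivAt_const t b).div (hasDerivAt_add_mul_rpow (α := α) (a := a) (b := b) ht0)
      hSpos.ne'
    have h := HasDerivAt.comp t (incBeta_hasStrictDerivAt hA hγ h0 h1).hasDerivAt hd
    refine HasDerivAt.congr_deriv (f := G) h ?_
    have e1 : 1 - b / S = a * t ^ α / S := by field_simp; rw [hS]; ring
    rw [hwe t ht0, ← hS, betaKernel, e1, Real.rpow_sub_one h0.ne', Real.rpow_sub_one (by positivity),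
      Real.rpow_sub_one ht0.ne', Real.div_rpow hb.le hSpos.le, Real.div_rpow (by positivity) hSpos.le,
      Real.mul_rpow ha.le hta.le, ← Real.rpow_mul ht0.le, hκ, Real.mul_rpow ha.le (by positivity),
      ← Real.rpow_mul hb.le]
    have e2 : t ^ (α * γ) = t * t ^ α := by
      have : α * γ = 1 + α := by rw [hγdef]; field_simp
      rw [this, Real.rpow_add ht0, Real.rpow_one]
    have e3 : S ^ (-m - 1) = (S ^ ((p - 1) * γ) * S ^ γ)⁻¹ := by
      rw [← Real.rpow_add hSpos, ← Real.rpow_neg hSpos.le]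
      congr 1; rw [hm, hγdef]; field_simp; ring
    rw [e2, e3]
    field_simp
    ring
  have hPd : ∀ t ∈ Ioi (0 : ℝ), HasDerivAt P
      (blissExtremalDeriv α a b t ^ p - (p - 1) * (1 + α) * κ * w t) t := by
    intro t ht
    have ht0 : 0 < t := ht
    have hta : 0 < t ^ α := Real.rpow_pos_of_pos ht0 _
    set S := b + a * t ^ α with hS
    have hSpos : 0 < S := by positivity
    have h := ((hasDerivAt_id t).mul ((hasDerivAt_add_mul_rpow (α := α) (a := a) (b := b)
      ht0).rpow_const (p := -m) (Or.inl hSpos.ne'))).const_mul (b ^ (p - 1))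
    refine HasDerivAt.congr_deriv (f := P) h ?_
    simp only [id]
    rw [hwe t ht0, ← hS, blissExtremalDeriv, ← hS, Real.mul_rpow hb.le (by positivity),
      ← Real.rpow_mul hSpos.le]
    have e1 : (-(1 / α) - 1) * p = -m - 1 := by rw [hm]; ring
    have e2 : S ^ (-m) = S ^ (-m - 1) * S := by rw [Real.rpow_sub_one hSpos.ne']; field_simp
    have e3 : b ^ p = b ^ (p - 1) * b := by rw [Real.rpow_sub_one hb.ne']; field_simp
    rw [e1, e2, e3, Real.rpow_sub_one ht0.ne', hκ, hm, hS]
    field_simp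
    ring
  have hcw : ∀ g : ℝ → ℝ, ContinuousOn g (Ici 0) → ContinuousWithinAt g (Ici 0) 0 :=
    fun g hg => hg 0 (le_refl (0 : ℝ))
  have hGc : ContinuousOn G (Ici 0) := by
    refine (incBeta_continuousOn hA hγ).comp ?_ fun t ht => div_add_mul_rpow_mem ha hb ht
    exact continuousOn_const.div (add_mul_rpow_continuousOn hα)
      fun t ht => (add_mul_rpow_pos ha hb ht).ne'
  have hPc : ContinuousOn P (Ici 0) :=
    continuousOn_const.mul (continuousOn_id.mul ((add_mul_rpow_continuousOn hα).rpow_const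
      fun s hs => Or.inl (add_mul_rpow_pos ha hb hs).ne'))
  have hG0 : G 0 = 0 := by
    simp only [hG]
    rw [Real.zero_rpow hα.ne', mul_zero, add_zero, div_self hb.ne', incBeta_one]
  have hP0 : P 0 = 0 := by simp [hP]
  have hGlim : Tendsto G atTop (𝓝 B) := by
    have h := (incBeta_continuousOn hA hγ) 0 (left_mem_Icc.2 zero_le_one)
    rw [ContinuousWithinAt, incBeta_zero hA hγ] at h
    refine h.comp (tendsto_nhdsWithin_iff.2 ⟨tendsto_div_add_mul_rpow hα ha, ?_⟩)
    filter_upwards [eventually_ge_atTop 0] with t ht using div_add_mul_rpow_mem ha hb ht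
  have hPlim : Tendsto P atTop (𝓝 0) := by
    rw [show (0 : ℝ) = b ^ (p - 1) * (a ^ (-m) * 0) by ring]
    refine Tendsto.const_mul _ ?_
    -- `P` is bounded by a multiple of t^{1-αm}, and αm = p + α(p-1) exceeds 1.
    have hexp : 0 < α * m - 1 := by
      rw [hm]
      have : α * (p / α + p - 1) = p + α * (p - 1) := by field_simp; ring
      have h2 : 0 < α * (p - 1) := mul_pos hα (by linarith)
      rw [this]; linarith
    have h0 := (tendsto_rpow_neg_atTop hexp).const_mul (a ^ (-m))
    refine tendsto_of_tendsto_of_tendsto_of_le_of_le' (by simpa using tendsto_const_nhds) h0 ?_ ?_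
    · filter_upwards [eventually_gt_atTop 0] with t ht
      have := add_mul_rpow_pos (α := α) ha hb ht.le
      positivity
    · filter_upwards [eventually_gt_atTop 0] with t ht
      have hta : 0 < t ^ α := Real.rpow_pos_of_pos ht _
      have h3 : (b + a * t ^ α) ^ (-m) ≤ (a * t ^ α) ^ (-m) :=
        Real.rpow_le_rpow_of_nonpos (by positivity) (by linarith) (by linarith)
      rw [Real.mul_rpow ha.le hta.le, ← Real.rpow_mul ht.le] at h3
      refine (mul_le_mul_of_nonneg_left h3 ht.le).trans (le_of_eq ?_)
      have : t ^ (-(α * m - 1)) = t * t ^ (α * -m) := by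
        rw [show -(α * m - 1) = 1 + α * -m by ring, Real.rpow_add ht, Real.rpow_one]
      rw [this]; ring
  have hI := integral_Ioi_of_hasDerivAt_of_nonneg (hcw G hGc) hGd
    (fun t ht => by have := hwpos t ht; positivity) hGlim
  rw [hG0, sub_zero, integral_const_mul] at hI
  -- Chosen so that the weight terms cancel in the derivative of P + cG, leaving the energy density.
  set c := (p - 1) * (1 + α) * κ / (α * κ ^ γ) with hc
  have hT : ∀ t ∈ Ioi (0 : ℝ), HasDerivAt (fun t => P t + c * G t)
      (blissExtremalDeriv α a b t ^ p) t := by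
    intro t ht
    refine ((hPd t ht).add ((hGd t ht).const_mul c)).congr_deriv ?_
    rw [hc]
    field_simp
    ring
  have hTc : ContinuousWithinAt (fun t => P t + c * G t) (Ici 0) 0 :=
    hcw _ (hPc.add (continuousOn_const.mul hGc))
  have hTnn : ∀ t ∈ Ioi (0 : ℝ), 0 ≤ blissExtremalDeriv α a b t ^ p := fun t ht =>
    Real.rpow_nonneg (blissExtremalDeriv_pos ha hb (le_of_lt ht)).le _
  have hTlim : Tendsto (fun t => P t + c * G t) atTop (𝓝 (0 + c * B)) :=
    hPlim.add (hGlim.const_mul c)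
  refine ⟨integrableOn_Ioi_deriv_of_nonneg hTc hT hTnn hTlim, ?_⟩
  rw [integral_Ioi_of_hasDerivAt_of_nonneg hTc hT hTnn hTlim, hP0, hG0]
  have hIe : ∫ t in Ioi 0, w t = (B / α) * κ ^ (-γ) := by
    rw [Real.rpow_neg hκpos.le, ← hI]; field_simp
  rw [hIe, blissConst, ← hγdef, ← hBdef, Real.mul_rpow (by positivity) (by positivity),
    ← Real.rpow_mul hκpos.le, hc]
  have e1 : -γ * (1 / (1 + α)) = 1 - γ := by rw [hγdef]; field_simp; ring
  have e2 : (B / α) ^ (α / (1 + α)) * (B / α) ^ (1 / (1 + α)) = B / α := by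
    rw [← Real.rpow_add (by positivity)]
    have : α / (1 + α) + 1 / (1 + α) = 1 := by field_simp; ring
    rw [this, Real.rpow_one]
  rw [e1, Real.rpow_sub hκpos, Real.rpow_one]
  linear_combination ((p - 1) * (1 + α) * (κ / κ ^ γ)) * e2

end extremal

/-! ### Bliss' inequality for nonnegative and then for signed derivatives. -/

section nonneg

variable {p α : ℝ} {f : ℝ → ℝ}

lemma blissWeight_zero {t : ℝ} {u : ℝ → ℝ} (hp : 1 < p) (hα : 0 < α) (hu : u t = 0) :
    blissWeight p α u t = 0 := by
  rw [blissWeight, hu, Real.zero_rpow (by positivity), zero_mul]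

/-- Bliss' inequality for nonnegative functions. -/
lemma bliss_nonneg (hp : 1 < p) (hα : 0 < α) (hf0 : ∀ t, 0 ≤ f t)
    (hm : AEStronglyMeasurable f (volume.restrict (Ioi 0)))
    (hf : IntegrableOn (fun t => f t ^ p) (Ioi 0)) :
    IntegrableOn (blissWeight p α (fun t => ∫ s in (0 : ℝ)..t, f s)) (Ioi 0) ∧
    blissConst p α *
        (∫ t in Ioi 0, blissWeight p α (fun t => ∫ s in (0 : ℝ)..t, f s) t) ^ (1 / (1 + α)) ≤
      ∫ t in Ioi 0, f t ^ p ∧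
    ((∃ t > 0, ∫ s in (0 : ℝ)..t, f s ≠ 0) → blissConst p α *
        (∫ t in Ioi 0, blissWeight p α (fun t => ∫ s in (0 : ℝ)..t, f s) t) ^ (1 / (1 + α)) =
      ∫ t in Ioi 0, f t ^ p →
      ∃ a > 0, ∃ b > 0, ∀ t > 0, ∫ s in (0 : ℝ)..t, f s = blissExtremal α a b t) := by
  have hfi : ∀ b, 0 ≤ b → IntervalIntegrable f volume 0 b := fun b hb =>
    intervalIntegrable_of_rpow hp hb hm (by simpa only [abs_of_nonneg (hf0 _)] using hf)
  have hnn : ∀ t, 0 < t → 0 ≤ ∫ s in (0 : ℝ)..t, f s := fun t ht =>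
    intervalIntegral.integral_nonneg ht.le fun s _ => hf0 s
  by_cases hne : ∃ t > 0, 0 < ∫ s in (0 : ℝ)..t, f s
  · obtain ⟨t₀, ht₀, hz, hpos⟩ := exists_threshold hfi hf0 hne
    obtain ⟨h1, h2⟩ := bliss_nonneg_aux hp hα hf0 hm hf ht₀ hpos
    set w := blissWeight p α (fun t => ∫ s in (0 : ℝ)..t, f s) with hw
    have hw0 : ∀ t ∈ Ioc 0 t₀, w t = 0 := fun t ht =>
      blissWeight_zero hp hα (hz t ⟨ht.1.le, ht.2⟩)
    have hU : Ioi (0 : ℝ) = Ioc 0 t₀ ∪ Ioi t₀ := (Ioc_union_Ioi_eq_Ioi ht₀).symm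
    have hI0 : IntegrableOn w (Ioc 0 t₀) :=
      integrableOn_zero.congr_fun (fun t ht => (hw0 t ht).symm) measurableSet_Ioc
    have hI : IntegrableOn w (Ioi 0) := by
      rw [hU]; exact hI0.union h1
    have hE : ∫ t in Ioi 0, w t = ∫ t in Ioi t₀, w t := by
      rw [hU, setIntegral_union Ioc_disjoint_Ioi_same measurableSet_Ioi hI0 h1,
        setIntegral_congr_fun measurableSet_Ioc hw0]
      simp
    refine ⟨hI, by rw [hE]; exact h2, fun _ heq => ?_⟩
    rw [hE] at heq
    exact bliss_equality_formula hp hα hf0 hm hf ht₀ (hz t₀ ⟨ht₀, le_rfl⟩) hpos heq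
  · push Not at hne
    have hz : ∀ t, 0 < t → ∫ s in (0 : ℝ)..t, f s = 0 := fun t ht =>
      le_antisymm (hne t ht) (hnn t ht)
    set w := blissWeight p α (fun t => ∫ s in (0 : ℝ)..t, f s) with hw
    have hw0 : ∀ t ∈ Ioi (0 : ℝ), w t = 0 := fun t ht => blissWeight_zero hp hα (hz t ht)
    refine ⟨integrableOn_zero.congr_fun (fun t ht => (hw0 t ht).symm) measurableSet_Ioi, ?_, ?_⟩
    · rw [setIntegral_congr_fun measurableSet_Ioi hw0]
      simp only [integral_zero]
      rw [Real.zero_rpow (by positivity), mul_zero]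
      exact setIntegral_nonneg measurableSet_Ioi fun t _ => Real.rpow_nonneg (hf0 t) _
    · rintro ⟨t, ht, h⟩
      exact absurd (hz t ht) h

end nonneg

section signed

variable {p α : ℝ} {f : ℝ → ℝ}

/-- Lebesgue differentiation on each [0, n]: both functions are almost everywhere derivatives of the
common primitive. -/
lemma ae_eq_of_primitive_eq {g : ℝ → ℝ} (hfi : ∀ b, 0 ≤ b → IntervalIntegrable f volume 0 b)
    (hgi : ∀ b, 0 ≤ b → IntervalIntegrable g volume 0 b)
    (h : ∀ t > 0, ∫ s in (0 : ℝ)..t, f s = ∫ s in (0 : ℝ)..t, g s) :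
    ∀ᵐ t ∂(volume.restrict (Ioi (0 : ℝ))), f t = g t := by
  rw [ae_restrict_iff' measurableSet_Ioi]
  have h1 : ∀ᵐ t : ℝ, ∀ n : ℕ, t ∈ uIcc 0 (n : ℝ) → ∀ c ∈ uIcc 0 (n : ℝ),
      HasDerivAt (fun x => ∫ s in c..x, f s) (f t) t :=
    ae_all_iff.2 fun n => (hfi n n.cast_nonneg).ae_hasDerivAt_integral
  have h2 : ∀ᵐ t : ℝ, ∀ n : ℕ, t ∈ uIcc 0 (n : ℝ) → ∀ c ∈ uIcc 0 (n : ℝ),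
      HasDerivAt (fun x => ∫ s in c..x, g s) (g t) t :=
    ae_all_iff.2 fun n => (hgi n n.cast_nonneg).ae_hasDerivAt_integral
  filter_upwards [h1, h2] with t ht1 ht2 ht
  obtain ⟨n, hn⟩ := exists_nat_ge t
  have hm : t ∈ uIcc 0 (n : ℝ) := by
    rw [uIcc_of_le n.cast_nonneg]; exact ⟨le_of_lt ht, hn⟩
  have d1 := ht1 n hm 0 left_mem_uIcc
  have d2 := ht2 n hm 0 left_mem_uIcc
  refine d1.unique (d2.congr_of_eventuallyEq ?_)
  filter_upwards [Ioi_mem_nhds ht] with s hs using h s hs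

/-- **Bliss' inequality**, with the description of the equality case. -/
theorem bliss_inequality (hp : 1 < p) (hα : 0 < α)
    (hm : AEStronglyMeasurable f (volume.restrict (Ioi 0)))
    (hf : IntegrableOn (fun t => |f t| ^ p) (Ioi 0)) :
    IntegrableOn (blissWeight p α (fun t => |∫ s in (0 : ℝ)..t, f s|)) (Ioi 0) ∧
    blissConst p α *
        (∫ t in Ioi 0, blissWeight p α (fun t => |∫ s in (0 : ℝ)..t, f s|) t) ^ (1 / (1 + α)) ≤
      ∫ t in Ioi 0, |f t| ^ p ∧
    ((∃ t > 0, ∫ s in (0 : ℝ)..t, f s ≠ 0) → (blissConst p α *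
        (∫ t in Ioi 0, blissWeight p α (fun t => |∫ s in (0 : ℝ)..t, f s|) t) ^ (1 / (1 + α)) =
      ∫ t in Ioi 0, |f t| ^ p ↔
      ∃ a b : ℝ, 0 < a ∧ 0 < b ∧ ((∀ t > 0, ∫ s in (0 : ℝ)..t, f s = blissExtremal α a b t) ∨
        (∀ t > 0, ∫ s in (0 : ℝ)..t, f s = -blissExtremal α a b t)))) := by
  have hfi : ∀ b, 0 ≤ b → IntervalIntegrable f volume 0 b := fun b hb =>
    intervalIntegrable_of_rpow hp hb hm hf
  have hgi : ∀ b, 0 ≤ b → IntervalIntegrable (fun t => |f t|) volume 0 b := fun b hb => (hfi b hb).abs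
  have hgm : AEStronglyMeasurable (fun t => |f t|) (volume.restrict (Ioi 0)) := hm.norm
  obtain ⟨hB1, hB2, hB3⟩ := bliss_nonneg hp hα (fun t => abs_nonneg (f t)) hgm hf
  set u : ℝ → ℝ := fun t => ∫ s in (0 : ℝ)..t, f s with hu
  set U : ℝ → ℝ := fun t => ∫ s in (0 : ℝ)..t, |f s| with hU
  have huc : ContinuousOn u (Ici 0) := continuousOn_primitive_Ioi hfi
  have hUc : ContinuousOn U (Ici 0) := continuousOn_primitive_Ioi hgi
  -- Replacing `f` by |f| leaves the energy unchanged and can only enlarge the weighted integral.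
  have huU : ∀ t, 0 < t → |u t| ≤ U t := fun t ht =>
    intervalIntegral.abs_integral_le_integral_abs ht.le
  have hq : 0 < p * (1 + α) := by positivity
  have hww : ∀ t, 0 < t → blissWeight p α (fun t => |u t|) t ≤ blissWeight p α U t := fun t ht =>
    mul_le_mul_of_nonneg_right (Real.rpow_le_rpow (abs_nonneg _) (huU t ht) hq.le)
      (Real.rpow_nonneg ht.le _)
  have hwc : ∀ v : ℝ → ℝ, ContinuousOn v (Ici 0) → ContinuousOn (blissWeight p α v) (Ioi 0) := by
    intro v hv
    refine ContinuousOn.mul ?_ ?_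
    · exact (hv.mono fun t (ht : 0 < t) => ht.le).rpow_const fun t ht => Or.inr hq.le
    · exact continuousOn_id.rpow_const fun t (ht : 0 < t) => Or.inl ht.ne'
  have hwn : ∀ t, 0 < t → 0 ≤ blissWeight p α (fun t => |u t|) t := fun t ht =>
    mul_nonneg (Real.rpow_nonneg (abs_nonneg _) _) (Real.rpow_nonneg ht.le _)
  have hwi : IntegrableOn (blissWeight p α (fun t => |u t|)) (Ioi 0) := by
    refine Integrable.mono' hB1 ((hwc _ huc.abs).aestronglyMeasurable measurableSet_Ioi) ?_
    refine (ae_restrict_mem measurableSet_Ioi).mono fun t ht => ?_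
    rw [Real.norm_of_nonneg (hwn t ht)]
    exact hww t ht
  have hle : ∫ t in Ioi 0, blissWeight p α (fun t => |u t|) t ≤ ∫ t in Ioi 0, blissWeight p α U t :=
    setIntegral_mono_on hwi hB1 measurableSet_Ioi hww
  have hnn : 0 ≤ ∫ t in Ioi 0, blissWeight p α (fun t => |u t|) t :=
    setIntegral_nonneg measurableSet_Ioi hwn
  have hC := blissConst_pos hp hα
  have h1α : 0 < 1 / (1 + α) := by positivity
  have hle2 := mul_le_mul_of_nonneg_left (Real.rpow_le_rpow hnn hle h1α.le) hC.le
  refine ⟨hwi, hle2.trans hB2, fun hne => ⟨fun heq => ?_, ?_⟩⟩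
  · have hne' : ∃ t > 0, U t ≠ 0 := by
      obtain ⟨t, ht, h⟩ := hne
      exact ⟨t, ht, (lt_of_lt_of_le (abs_pos.2 h) (huU t ht)).ne'⟩
    have heqU : blissConst p α * (∫ t in Ioi 0, blissWeight p α U t) ^ (1 / (1 + α)) =
        ∫ t in Ioi 0, |f t| ^ p := le_antisymm hB2 (heq ▸ hle2)
    obtain ⟨a, ha, b, hb, hab⟩ := hB3 hne' heqU
    have hII : ∫ t in Ioi 0, blissWeight p α (fun t => |u t|) t =
        ∫ t in Ioi 0, blissWeight p α U t := by
      have h3 := mul_left_cancel₀ hC.ne' (heq.trans heqU.symm)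
      exact (Real.rpow_left_inj hnn (hnn.trans hle) h1α.ne').1 h3
    have hUpos : ∀ t, 0 < t → 0 < U t := fun t ht => by
      rw [show U t = _ from hab t ht]; exact blissExtremal_pos ha hb ht
    -- The two weights are ordered and have equal integrals, so they agree almost everywhere, and
    -- everywhere by continuity.
    have habs : ∀ t, 0 < t → |u t| = U t := by
      intro t ht
      by_contra hcon
      have hlt : |u t| < U t := lt_of_le_of_ne (huU t ht) hcon
      have hae : ∀ᵐ s ∂(volume.restrict (Ioi (0:ℝ))),
          blissWeight p α U s - blissWeight p α (fun t => |u t|) s = 0 := by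
        have h4 : ∫ s in Ioi 0, (blissWeight p α U s - blissWeight p α (fun t => |u t|) s) = 0 := by
          rw [integral_sub hB1 hwi, hII, sub_self]
        refine (setIntegral_eq_zero_iff_of_nonneg_ae ?_ (hB1.sub hwi)).1 h4
        exact (ae_restrict_mem measurableSet_Ioi).mono fun s hs => sub_nonneg.2 (hww s hs)
      have hcont : ContinuousOn (fun s => blissWeight p α U s -
          blissWeight p α (fun t => |u t|) s) (Ioi 0) := (hwc _ hUc).sub (hwc _ huc.abs)
      have hz := Measure.eqOn_of_ae_eq hae hcont continuousOn_const
        (by rw [interior_Ioi]; exact subset_closure) (show t ∈ Ioi (0:ℝ) from ht)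
      have hz' : blissWeight p α U t - blissWeight p α (fun t => |u t|) t = 0 := hz
      have hlt' : blissWeight p α (fun t => |u t|) t < blissWeight p α U t :=
        mul_lt_mul_of_pos_right (Real.rpow_lt_rpow (abs_nonneg _) hlt hq)
          (Real.rpow_pos_of_pos ht _)
      linarith
    -- A continuous function whose square is that of the nonvanishing `U` has constant sign relative
    -- to `U` on a connected set.
    have hsgn : (∀ t ∈ Ioi (0 : ℝ), u t = U t) ∨ (∀ t ∈ Ioi (0 : ℝ), u t = -U t) := by
      have := isPreconnected_Ioi.eq_or_eq_neg_of_sq_eq (S := Ioi (0 : ℝ)) (f := u) (g := U)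
        (huc.mono Ioi_subset_Ici_self) (hUc.mono Ioi_subset_Ici_self)
        (fun t ht => by
          simp only [Pi.pow_apply]
          rw [← habs t ht, sq_abs]) (fun {t} ht => (hUpos t ht).ne')
      exact this
    refine ⟨a, b, ha, hb, hsgn.imp (fun h t ht => ?_) (fun h t ht => ?_)⟩
    · rw [← hab t ht]; exact h t ht
    · rw [← hab t ht]; exact h t ht
  · rintro ⟨a, b, ha, hb, h⟩
    have hei : ∀ c, 0 ≤ c → IntervalIntegrable (blissExtremalDeriv α a b) volume 0 c := fun c hc =>
      ((blissExtremalDeriv_continuousOn hα ha hb).mono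
        (fun s hs => hs.1)).intervalIntegrable_of_Icc hc
    -- Only the primitive of `f` is prescribed, so `f` itself is determined almost everywhere, which
    -- suffices for the energy.
    have hfe : ∀ᵐ t ∂(volume.restrict (Ioi (0 : ℝ))), |f t| ^ p = blissExtremalDeriv α a b t ^ p := by
      have hor : (∀ᵐ t ∂(volume.restrict (Ioi (0 : ℝ))), f t = blissExtremalDeriv α a b t) ∨
          (∀ᵐ t ∂(volume.restrict (Ioi (0 : ℝ))), f t = -blissExtremalDeriv α a b t) := by
        refine h.imp (fun h => ae_eq_of_primitive_eq hfi hei fun t ht => ?_)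
          (fun h => ae_eq_of_primitive_eq (g := fun t => -blissExtremalDeriv α a b t) hfi
            (fun c hc => (hei c hc).neg) fun t ht => ?_)
        · rw [integral_blissExtremalDeriv hα ha hb ht]; exact h t ht
        · rw [intervalIntegral.integral_neg, integral_blissExtremalDeriv hα ha hb ht]; exact h t ht
      rcases hor with h | h
      all_goals
        filter_upwards [h, ae_restrict_mem measurableSet_Ioi] with t ht ht0
        rw [ht]
        first | rw [abs_neg] | skip
        rw [abs_of_pos (blissExtremalDeriv_pos ha hb (le_of_lt ht0))]
    have hue : ∀ t ∈ Ioi (0 : ℝ), blissWeight p α (fun t => |u t|) t =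
        blissWeight p α (blissExtremal α a b) t := by
      intro t ht
      have h0 := blissExtremal_pos (α := α) ha hb ht
      have : |u t| = blissExtremal α a b t := by
        rcases h with h | h
        · rw [show u t = _ from h t ht, abs_of_pos h0]
        · rw [show u t = _ from h t ht, abs_neg, abs_of_pos h0]
      simp only [blissWeight, this]
    rw [integral_congr_ae hfe, setIntegral_congr_fun measurableSet_Ioi hue]
    exact (bliss_extremal hp hα ha hb).2

end signed

/-! ### Geometry of a Finsler norm and its dual norm. -/

namespace IsFinslerNorm

variable {N : ℕ} {H : EuclideanSpace ℝ (Fin N) → ℝ}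

lemma pos (hH : IsFinslerNorm H) {ξ : EuclideanSpace ℝ (Fin N)} (hξ : ξ ≠ 0) : 0 < H ξ :=
  lt_of_le_of_ne (hH.nonneg ξ) fun h => hξ ((hH.eq_zero_iff ξ).1 h.symm)

lemma map_zero (hH : IsFinslerNorm H) : H 0 = 0 := (hH.eq_zero_iff 0).2 rfl

lemma eq_norm_mul (hH : IsFinslerNorm H) (ξ : EuclideanSpace ℝ (Fin N)) :
    H ξ = ‖ξ‖ * H (‖ξ‖⁻¹ • ξ) := by
  by_cases hξ : ξ = 0
  · simp [hξ, hH.map_zero]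
  · have h : 0 < ‖ξ‖ := norm_pos_iff.2 hξ
    rw [hH.homogeneous, abs_of_pos (inv_pos.2 h), ← mul_assoc, mul_inv_cancel₀ h.ne', one_mul]

/-- Extreme values of `H` on the Euclidean unit sphere, extended by homogeneity. -/
lemma exists_bounds (hH : IsFinslerNorm H) :
    ∃ c > 0, ∃ C > 0, ∀ ξ, c * ‖ξ‖ ≤ H ξ ∧ H ξ ≤ C * ‖ξ‖ := by
  by_cases hne : (Metric.sphere (0 : EuclideanSpace ℝ (Fin N)) 1).Nonempty
  · have hs : ∀ ξ ∈ Metric.sphere (0 : EuclideanSpace ℝ (Fin N)) 1, ξ ≠ 0 := by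
      rintro ξ hξ rfl; simp at hξ
    have hc : ContinuousOn H (Metric.sphere 0 1) := hH.contDiffOn.continuousOn.mono hs
    obtain ⟨x, hx, hmin⟩ := (isCompact_sphere 0 1).exists_isMinOn hne hc
    obtain ⟨y, hy, hmax⟩ := (isCompact_sphere 0 1).exists_isMaxOn hne hc
    refine ⟨H x, hH.pos (hs x hx), H y, hH.pos (hs y hy), fun ξ => ?_⟩
    by_cases hξ : ξ = 0
    · simp [hξ, hH.map_zero]
    · have hm : ‖ξ‖⁻¹ • ξ ∈ Metric.sphere (0 : EuclideanSpace ℝ (Fin N)) 1 := by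
        simp [norm_smul, hξ]
      rw [hH.eq_norm_mul ξ, mul_comm _ ‖ξ‖, mul_comm _ ‖ξ‖]
      exact ⟨mul_le_mul_of_nonneg_left (hmin hm) (norm_nonneg _),
        mul_le_mul_of_nonneg_left (hmax hm) (norm_nonneg _)⟩
  -- An empty unit sphere means that the space is trivial, and any constants will do.
  · refine ⟨1, one_pos, 1, one_pos, fun ξ => ?_⟩
    have : ξ = 0 := by
      by_contra hξ
      exact hne ⟨‖ξ‖⁻¹ • ξ, by simp [norm_smul, hξ]⟩
    simp [this, hH.map_zero]

/-- A real supremum defaults to 0 on an unbounded family, so boundedness is needed before `dualNorm`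
can be used as a supremum. -/
lemma bddAbove (hH : IsFinslerNorm H) (x : EuclideanSpace ℝ (Fin N)) :
    BddAbove (range fun ξ : {ξ : EuclideanSpace ℝ (Fin N) // ξ ≠ 0} =>
      inner ℝ (ξ : EuclideanSpace ℝ (Fin N)) x / H ξ) := by
  obtain ⟨c, hc, C, -, h⟩ := hH.exists_bounds
  refine ⟨‖x‖ / c, ?_⟩
  rintro _ ⟨⟨ξ, hξ⟩, rfl⟩
  rw [div_le_div_iff₀ (hH.pos hξ) hc]
  have h1 := real_inner_le_norm ξ x
  have h2 := (h ξ).1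
  have := norm_nonneg x
  calc inner ℝ ξ x * c ≤ (‖ξ‖ * ‖x‖) * c := by gcongr
    _ = ‖x‖ * (c * ‖ξ‖) := by ring
    _ ≤ ‖x‖ * H ξ := by gcongr

lemma inner_le (hH : IsFinslerNorm H) (ξ x : EuclideanSpace ℝ (Fin N)) :
    inner ℝ ξ x ≤ H ξ * dualNorm H x := by
  by_cases hξ : ξ = 0
  · simp [hξ, hH.map_zero]
  · have := le_ciSup (hH.bddAbove x) ⟨ξ, hξ⟩
    rw [mul_comm, ← div_le_iff₀ (hH.pos hξ)]
    exact this

/-- Testing the supremum with ξ = x gives ‖x‖² ≤ H(x)H⁰(x) ≤ C‖x‖H⁰(x). -/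
lemma norm_le_dualNorm (hH : IsFinslerNorm H) :
    ∃ C > 0, ∀ x, ‖x‖ ≤ C * dualNorm H x := by
  obtain ⟨c, hc, C, hC, h⟩ := hH.exists_bounds
  refine ⟨C, hC, fun x => ?_⟩
  by_cases hx : x = 0
  · subst hx
    rw [norm_zero]
    refine mul_nonneg hC.le (Real.iSup_nonneg fun ξ => ?_)
    simp
  · have h1 := hH.inner_le x x
    rw [real_inner_self_eq_norm_sq] at h1
    have hF : 0 < dualNorm H x := by
      have h0 : 0 < ‖x‖ ^ 2 := pow_pos (norm_pos_iff.2 hx) 2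
      exact (pos_iff_pos_of_mul_pos (h0.trans_le h1)).1 (hH.pos hx)
    have h2 : ‖x‖ * ‖x‖ ≤ ‖x‖ * (C * dualNorm H x) := by
      have := mul_le_mul_of_nonneg_right (h x).2 hF.le
      nlinarith
    exact le_of_mul_le_mul_left h2 (norm_pos_iff.2 hx)

lemma dualNorm_nonneg (hH : IsFinslerNorm H) (x : EuclideanSpace ℝ (Fin N)) :
    0 ≤ dualNorm H x := by
  obtain ⟨C, hC, h⟩ := hH.norm_le_dualNorm
  exact (mul_nonneg_iff_of_pos_left hC).1 ((norm_nonneg x).trans (h x))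

lemma dualNorm_pos (hH : IsFinslerNorm H) {x : EuclideanSpace ℝ (Fin N)} (hx : x ≠ 0) :
    0 < dualNorm H x := by
  obtain ⟨C, hC, h⟩ := hH.norm_le_dualNorm
  exact (mul_pos_iff_of_pos_left hC).1 ((norm_pos_iff.2 hx).trans_le (h x))

lemma dualNorm_smul (_hH : IsFinslerNorm H) {t : ℝ} (ht : 0 ≤ t) (x : EuclideanSpace ℝ (Fin N)) :
    dualNorm H (t • x) = t * dualNorm H x := by
  rw [dualNorm, dualNorm, Real.mul_iSup_of_nonneg ht]
  refine iSup_congr fun ξ => ?_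
  rw [inner_smul_right, mul_div_assoc]

@[simp] lemma dualNorm_zero : dualNorm H 0 = 0 := by simp [dualNorm]

lemma dualNorm_le (hH : IsFinslerNorm H) {x : EuclideanSpace ℝ (Fin N)} {a : ℝ} (ha : 0 ≤ a)
    (h : ∀ ξ, inner ℝ ξ x ≤ a * H ξ) : dualNorm H x ≤ a :=
  Real.iSup_le (fun ξ => (div_le_iff₀ (hH.pos ξ.2)).2 (h ξ)) ha

lemma dualNorm_add_le (hH : IsFinslerNorm H) (x y : EuclideanSpace ℝ (Fin N)) :
    dualNorm H (x + y) ≤ dualNorm H x + dualNorm H y := by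
  refine hH.dualNorm_le (add_nonneg (hH.dualNorm_nonneg x) (hH.dualNorm_nonneg y)) fun ξ => ?_
  rw [inner_add_right]
  nlinarith [hH.inner_le ξ x, hH.inner_le ξ y]

lemma exists_dualNorm_le (hH : IsFinslerNorm H) :
    ∃ K : NNReal, ∀ x, dualNorm H x ≤ K * ‖x‖ := by
  obtain ⟨c, hc, C, hC, h⟩ := hH.exists_bounds
  refine ⟨c⁻¹.toNNReal, fun x => ?_⟩
  rw [Real.coe_toNNReal _ (inv_pos.2 hc).le]
  refine hH.dualNorm_le (by positivity) fun ξ => ?_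
  have h1 := real_inner_le_norm ξ x
  have h2 : ‖ξ‖ ≤ c⁻¹ * H ξ := by rw [inv_mul_eq_div, le_div_iff₀ hc, mul_comm]; exact (h ξ).1
  calc inner ℝ ξ x ≤ ‖ξ‖ * ‖x‖ := h1
    _ ≤ (c⁻¹ * H ξ) * ‖x‖ := by gcongr
    _ = c⁻¹ * ‖x‖ * H ξ := by ring

/-- Subadditivity together with the bound by the Euclidean norm; this makes Rademacher's theorem
available for the dual norm. -/
lemma exists_lipschitzWith (hH : IsFinslerNorm H) : ∃ K : NNReal, LipschitzWith K (dualNorm H) := by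
  obtain ⟨K, hK⟩ := hH.exists_dualNorm_le
  refine ⟨K, LipschitzWith.of_le_add_mul K fun x y => ?_⟩
  have := hH.dualNorm_add_le y (x - y)
  rw [add_sub_cancel] at this
  rw [dist_eq_norm]
  linarith [hK (x - y)]

lemma continuous_dualNorm (hH : IsFinslerNorm H) : Continuous (dualNorm H) :=
  let ⟨_, hK⟩ := hH.exists_lipschitzWith
  hK.continuous

/-- The quotient in the supremum is homogeneous of degree 0, so it attains its maximum on the
compact unit sphere; rescaling the maximizer normalizes `H`. -/
lemma exists_dual (hH : IsFinslerNorm H) {x : EuclideanSpace ℝ (Fin N)} (hx : x ≠ 0) :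
    ∃ ξ, H ξ = 1 ∧ inner ℝ ξ x = dualNorm H x := by
  have hne : (Metric.sphere (0 : EuclideanSpace ℝ (Fin N)) 1).Nonempty :=
    ⟨‖x‖⁻¹ • x, by simp [norm_smul, hx]⟩
  have hs : ∀ ξ ∈ Metric.sphere (0 : EuclideanSpace ℝ (Fin N)) 1, ξ ≠ 0 := by
    rintro ξ hξ rfl; simp at hξ
  have hc : ContinuousOn (fun ξ => inner ℝ ξ x / H ξ) (Metric.sphere 0 1) := by
    refine ContinuousOn.div (by fun_prop) (hH.contDiffOn.continuousOn.mono hs) fun ξ hξ => ?_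
    exact (hH.pos (hs ξ hξ)).ne'
  obtain ⟨ξ, hξ, hmax⟩ := (isCompact_sphere 0 1).exists_isMaxOn hne hc
  have hpos := hH.pos (hs ξ hξ)
  have hle : dualNorm H x ≤ inner ℝ ξ x / H ξ := by
    have : Nonempty {ξ : EuclideanSpace ℝ (Fin N) // ξ ≠ 0} := ⟨⟨x, hx⟩⟩
    refine ciSup_le fun ζ => ?_
    obtain ⟨ζ, hζ⟩ := ζ
    have hn : 0 < ‖ζ‖ := norm_pos_iff.2 hζ
    have hm : ‖ζ‖⁻¹ • ζ ∈ Metric.sphere (0 : EuclideanSpace ℝ (Fin N)) 1 := by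
      simp [norm_smul, hζ]
    refine le_trans (le_of_eq ?_) (hmax hm)
    change inner ℝ ζ x / H ζ = inner ℝ (‖ζ‖⁻¹ • ζ) x / H (‖ζ‖⁻¹ • ζ)
    rw [hH.homogeneous, abs_of_pos (inv_pos.2 hn), inner_smul_left]
    have := hH.pos hζ
    simp only [conj_trivial]
    field_simp
  refine ⟨(H ξ)⁻¹ • ξ, ?_, ?_⟩
  · rw [hH.homogeneous, abs_of_pos (inv_pos.2 hpos), inv_mul_cancel₀ hpos.ne']
  · refine le_antisymm ?_ ?_
    · refine (hH.inner_le _ x).trans (le_of_eq ?_)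
      rw [hH.homogeneous, abs_of_pos (inv_pos.2 hpos), inv_mul_cancel₀ hpos.ne', one_mul]
    · rw [inner_smul_left, conj_trivial, inv_mul_eq_div]; exact hle

/-- The eikonal equation satisfied by the dual norm. -/
lemma eikonal (hH : IsFinslerNorm H) {x : EuclideanSpace ℝ (Fin N)} (hx : x ≠ 0)
    (hd : DifferentiableAt ℝ (dualNorm H) x) : H (gradient (dualNorm H) x) = 1 := by
  obtain ⟨ξ, h1, h2⟩ := hH.exists_dual hx
  have hg := hd.hasGradientAt.hasFDerivAt
  -- The linear function given by the dual vector ξ touches H⁰ from below at `x`. Where H⁰ is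
  -- differentiable, its gradient must then be ξ, and H(ξ) = 1.
  have hmin : IsLocalMin (fun z => dualNorm H z - inner ℝ ξ z) x := by
    refine Eventually.of_forall fun z => ?_
    have := hH.inner_le ξ z
    rw [h1, one_mul] at this
    simp only [h2, sub_self]
    linarith
  have hd2 : HasFDerivAt (fun z => dualNorm H z - inner ℝ ξ z)
      (InnerProductSpace.toDual ℝ _ (gradient (dualNorm H) x) -
        InnerProductSpace.toDual ℝ _ ξ) x :=
    hg.sub ((InnerProductSpace.toDual ℝ (EuclideanSpace ℝ (Fin N)) ξ).hasFDerivAt)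
  have h0 := hmin.hasFDerivAt_eq_zero hd2
  rw [sub_eq_zero] at h0
  rw [(InnerProductSpace.toDual ℝ _).injective h0, h1]

lemma isOpen_wulffBall (hH : IsFinslerNorm H) (R : ℝ) : IsOpen (wulffBall H R) :=
  isOpen_lt hH.continuous_dualNorm continuous_const

lemma isBounded_wulffBall (hH : IsFinslerNorm H) (R : ℝ) : Bornology.IsBounded (wulffBall H R) := by
  obtain ⟨C, hC, h⟩ := hH.norm_le_dualNorm
  refine (Metric.isBounded_closedBall (x := 0) (r := C * R)).subset fun x hx => ?_
  rw [mem_closedBall_zero_iff]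
  exact (h x).trans (mul_le_mul_of_nonneg_left (le_of_lt hx) hC.le)

lemma isCompact_dualNorm_le (hH : IsFinslerNorm H) (R : ℝ) :
    IsCompact {x | dualNorm H x ≤ R} := by
  refine Metric.isCompact_of_isClosed_isBounded
    (isClosed_le hH.continuous_dualNorm continuous_const) ?_
  exact (hH.isBounded_wulffBall (R + 1)).subset fun x (hx : dualNorm H x ≤ R) =>
    show dualNorm H x < R + 1 by linarith

lemma measure_wulffBall_lt_top (hH : IsFinslerNorm H) (R : ℝ) :
    volume (wulffBall H R) < ⊤ := (hH.isBounded_wulffBall R).measure_lt_top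

end IsFinslerNorm

/-! ### Polar coordinates for the dual norm. -/

namespace IsFinslerNorm

variable {N : ℕ} {H : EuclideanSpace ℝ (Fin N) → ℝ}

lemma wulffBall_mono {r s : ℝ} (h : r ≤ s) : wulffBall H r ⊆ wulffBall H s :=
  fun x (hx : dualNorm H x < r) => show dualNorm H x < s from hx.trans_le h

lemma wulffVolume_nonneg : 0 ≤ wulffVolume H := measureReal_nonneg

lemma wulffVolume_pos (hH : IsFinslerNorm H) : 0 < wulffVolume H := by
  refine ENNReal.toReal_pos ?_ (hH.measure_wulffBall_lt_top 1).ne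
  refine ((hH.isOpen_wulffBall 1).measure_pos volume ⟨0, ?_⟩).ne'
  change dualNorm H 0 < 1
  simp

open scoped Pointwise in
-- The Wulff ball of radius `r` is the dilation of the unit one by `r`.
lemma volume_dualNorm_lt (hH : IsFinslerNorm H) {r : ℝ} (hr : 0 < r) :
    volume (wulffBall H r) = ENNReal.ofReal (wulffVolume H * r ^ N) := by
  have hset : wulffBall H r = r • wulffBall H 1 := by
    ext x
    rw [mem_smul_set_iff_inv_smul_mem₀ hr.ne']
    change dualNorm H x < r ↔ dualNorm H (r⁻¹ • x) < 1
    rw [hH.dualNorm_smul (inv_pos.2 hr).le, inv_mul_lt_one₀ hr]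
  rw [hset, Measure.addHaar_smul, finrank_euclideanSpace, Fintype.card_fin,
    abs_of_pos (pow_pos hr N), mul_comm (wulffVolume H), ENNReal.ofReal_mul (pow_pos hr N).le,
    wulffVolume, ofReal_measureReal (hH.measure_wulffBall_lt_top 1).ne]

lemma integral_density {a R : ℝ} (hN : 2 ≤ N) :
    ∫ r in a..R, (N * wulffVolume H * r ^ ((N : ℝ) - 1)) = wulffVolume H * (R ^ N - a ^ N) := by
  have hN' : (2 : ℝ) ≤ N := by exact_mod_cast hN
  rw [intervalIntegral.integral_const_mul, integral_rpow (Or.inl (by linarith)), sub_add_cancel,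
    Real.rpow_natCast, Real.rpow_natCast]
  field_simp

/-- The image of Lebesgue measure on a Wulff ball under the dual norm. -/
lemma map_dualNorm (hH : IsFinslerNorm H) (hN : 2 ≤ N) {R : ℝ} (hR : 0 < R) :
    (volume.restrict (wulffBall H R)).map (dualNorm H) =
      (volume.restrict (Ioo 0 R)).withDensity
        (fun r => ENNReal.ofReal (N * wulffVolume H * r ^ ((N : ℝ) - 1))) := by
  have hN' : (2 : ℝ) ≤ N := by exact_mod_cast hN
  have : IsFiniteMeasure (volume.restrict (wulffBall H R)) :=
    ⟨by simpa using hH.measure_wulffBall_lt_top R⟩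
  have : IsFiniteMeasure ((volume.restrict (wulffBall H R)).map (dualNorm H)) :=
    Measure.isFiniteMeasure_map _ _
  -- Finite measures on the line are determined by closed right half-lines. For negative `a` nothing
  -- changes when `a` is replaced by 0, hence the maximum below.
  refine Measure.ext_of_Ici _ _ fun a => ?_
  rw [Measure.map_apply hH.continuous_dualNorm.measurable measurableSet_Ici,
    Measure.restrict_apply (hH.continuous_dualNorm.measurable measurableSet_Ici),
    withDensity_apply _ measurableSet_Ici, Measure.restrict_restrict measurableSet_Ici]
  set b := max a 0 with hb
  have hb0 : 0 ≤ b := le_max_right _ _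
  have hset1 : dualNorm H ⁻¹' Ici a ∩ wulffBall H R = wulffBall H R \ wulffBall H b := by
    ext x
    change a ≤ dualNorm H x ∧ dualNorm H x < R ↔ dualNorm H x < R ∧ ¬ dualNorm H x < b
    rw [not_lt, hb, max_le_iff]
    have := hH.dualNorm_nonneg x
    tauto
  have hset2 : (Ici a ∩ Ioo 0 R : Set ℝ) =ᵐ[volume] (Ioc b R : Set ℝ) := by
    have h1 : (Ioc b R : Set ℝ) =ᵐ[volume] (Ioo b R : Set ℝ) := Ioo_ae_eq_Ioc.symm
    refine EventuallyEq.trans ?_ h1.symm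
    have h2 : ∀ᵐ x : ℝ, x ≠ b := by simp [ae_iff]
    filter_upwards [h2] with x hx
    refine propext ?_
    change (a ≤ x ∧ 0 < x ∧ x < R) ↔ (b < x ∧ x < R)
    constructor
    · rintro ⟨h3, h4, h5⟩
      exact ⟨lt_of_le_of_ne (max_le h3 h4.le) (Ne.symm hx), h5⟩
    · rintro ⟨h3, h4⟩
      exact ⟨(le_max_left a 0).trans h3.le, lt_of_le_of_lt hb0 h3, h4⟩
  rw [hset1, Measure.restrict_congr_set hset2]
  have hvb : volume (wulffBall H b) = ENNReal.ofReal (wulffVolume H * b ^ N) := by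
    rcases hb0.eq_or_lt with h | h
    · have : wulffBall H b = ∅ := by
        ext x
        simp only [wulffBall, mem_ofPred_eq, mem_empty_iff_false, iff_false, not_lt, ← h]
        exact hH.dualNorm_nonneg x
      rw [this, ← h, zero_pow (by omega)]; simp
    · exact hH.volume_dualNorm_lt h
  rcases le_total b R with hbR | hbR
  · rw [measure_sdiff (wulffBall_mono hbR)
      (hH.isOpen_wulffBall b).measurableSet.nullMeasurableSet (hH.measure_wulffBall_lt_top b).ne,
      hvb, hH.volume_dualNorm_lt hR, ← ENNReal.ofReal_sub _
        (mul_nonneg wulffVolume_nonneg (pow_nonneg hb0 N)), ← mul_sub,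
      ← integral_density hN, intervalIntegral.integral_of_le hbR,
      ofReal_integral_eq_lintegral_ofReal]
    · have := (intervalIntegral.intervalIntegrable_rpow' (a := b) (b := R)
        (show -1 < (N : ℝ) - 1 by linarith)).const_mul (N * wulffVolume H)
      exact this.1
    · refine (ae_restrict_mem measurableSet_Ioc).mono fun r hr => ?_
      have : 0 ≤ r := hb0.trans hr.1.le
      exact mul_nonneg (mul_nonneg (by positivity) wulffVolume_nonneg) (Real.rpow_nonneg this _)
  · rw [Ioc_eq_empty (not_lt.2 hbR), sdiff_eq_empty.2
      (wulffBall_mono hbR)]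
    simp

lemma measurable_density : Measurable
    (fun r : ℝ => ENNReal.ofReal (N * wulffVolume H * r ^ ((N : ℝ) - 1))) := by fun_prop

/-- A property of `r` that holds a.e. on `(0, R)` holds for a.e. value of the dual norm. -/
lemma ae_dualNorm (hH : IsFinslerNorm H) (hN : 2 ≤ N) {R : ℝ} (hR : 0 < R) {P : ℝ → Prop}
    (h : ∀ᵐ r ∂(volume.restrict (Ioo 0 R)), P r) :
    ∀ᵐ y ∂(volume.restrict (wulffBall H R)), P (dualNorm H y) := by
  have h1 : ∀ᵐ r ∂((volume.restrict (wulffBall H R)).map (dualNorm H)), P r := by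
    rw [hH.map_dualNorm hN hR]
    exact (withDensity_absolutelyContinuous _ _).ae_le h
  exact ae_of_ae_map hH.continuous_dualNorm.measurable.aemeasurable h1

/-- The radii where the two functions differ form an open set; its preimage under H⁰ is open, and
nonempty if that set is, so it would have positive measure. -/
lemma eqOn_of_ae_eq_dualNorm (hH : IsFinslerNorm H) (hN : 2 ≤ N) {R : ℝ} {V₁ V₂ : ℝ → ℝ}
    (h₁ : ContinuousOn V₁ (Ioo 0 R)) (h₂ : ContinuousOn V₂ (Ioo 0 R))
    (h : ∀ᵐ y ∂(volume.restrict (wulffBall H R)), V₁ (dualNorm H y) = V₂ (dualNorm H y)) :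
    EqOn V₁ V₂ (Ioo 0 R) := by
  intro r hr
  by_contra hcon
  have hopen : IsOpen (Ioo 0 R ∩ (fun s => V₁ s - V₂ s) ⁻¹' {0}ᶜ) :=
    (h₁.sub h₂).isOpen_inter_preimage isOpen_Ioo isOpen_compl_singleton
  set U := dualNorm H ⁻¹' (Ioo 0 R ∩ (fun s => V₁ s - V₂ s) ⁻¹' {0}ᶜ) with hU
  have hUo : IsOpen U := hopen.preimage hH.continuous_dualNorm
  have hne : U.Nonempty := by
    have : Nontrivial (EuclideanSpace ℝ (Fin N)) := by
      have : Nontrivial (Fin N) := Fin.nontrivial_iff_two_le.2 hN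
      infer_instance
    obtain ⟨x, hx⟩ := exists_ne (0 : EuclideanSpace ℝ (Fin N))
    have hF := hH.dualNorm_pos hx
    refine ⟨(r / dualNorm H x) • x, ?_⟩
    have hr0 := hr.1
    have : dualNorm H ((r / dualNorm H x) • x) = r := by
      rw [hH.dualNorm_smul (by positivity), div_mul_cancel₀ _ hF.ne']
    have hm : dualNorm H ((r / dualNorm H x) • x) ∈
        Ioo 0 R ∩ (fun s => V₁ s - V₂ s) ⁻¹' {0}ᶜ := by
      rw [this]; exact ⟨hr, sub_ne_zero.2 hcon⟩
    exact hm
  have hpos := hUo.measure_pos volume hne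
  rw [ae_restrict_iff' (hH.isOpen_wulffBall R).measurableSet, ae_iff] at h
  refine hpos.ne' (measure_mono_null ?_ h)
  intro x hx hcon
  exact sub_ne_zero.1 hx.2 (hcon hx.1.2)

lemma lintegral_dualNorm (hH : IsFinslerNorm H) (hN : 2 ≤ N) {R : ℝ} (hR : 0 < R)
    {h : ℝ → ENNReal} (hh : AEMeasurable h (volume.restrict (Ioo 0 R))) :
    ∫⁻ y in wulffBall H R, h (dualNorm H y) =
      ∫⁻ r in Ioo 0 R, ENNReal.ofReal (N * wulffVolume H * r ^ ((N : ℝ) - 1)) * h r := by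
  have hle : (volume.restrict (wulffBall H R)).map (dualNorm H) ≪ volume.restrict (Ioo 0 R) := by
    rw [hH.map_dualNorm hN hR]
    exact withDensity_absolutelyContinuous _ _
  rw [← lintegral_map' (f := h) (hh.mono_ac hle) hH.continuous_dualNorm.measurable.aemeasurable,
    hH.map_dualNorm hN hR, lintegral_withDensity_eq_lintegral_mul₀ measurable_density.aemeasurable hh]
  rfl

lemma integrable_dualNorm_iff (hH : IsFinslerNorm H) (hN : 2 ≤ N) {R : ℝ} (hR : 0 < R)
    {h : ℝ → ℝ} (hh : AEStronglyMeasurable h (volume.restrict (Ioo 0 R))) :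
    IntegrableOn (fun y => h (dualNorm H y)) (wulffBall H R) ↔
      IntegrableOn (fun r => N * wulffVolume H * r ^ ((N : ℝ) - 1) * h r) (Ioo 0 R) := by
  have hle : (volume.restrict (wulffBall H R)).map (dualNorm H) ≪ volume.restrict (Ioo 0 R) := by
    rw [hH.map_dualNorm hN hR]
    exact withDensity_absolutelyContinuous _ _
  have h1 := integrable_map_measure (f := dualNorm H) (g := h) (hh.mono_ac hle)
    hH.continuous_dualNorm.measurable.aemeasurable
  rw [hH.map_dualNorm hN hR, integrable_withDensity_iff_integrable_smul'
    measurable_density (ae_of_all _ fun _ => ENNReal.ofReal_lt_top)] at h1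
  rw [IntegrableOn, IntegrableOn]
  refine h1.symm.trans (integrable_congr ?_)
  refine (ae_restrict_mem measurableSet_Ioo).mono fun r hr => ?_
  simp only [smul_eq_mul]
  rw [ENNReal.toReal_ofReal]
  exact mul_nonneg (mul_nonneg (by positivity) wulffVolume_nonneg) (Real.rpow_nonneg hr.1.le _)

lemma integral_dualNorm (hH : IsFinslerNorm H) (hN : 2 ≤ N) {R : ℝ} (hR : 0 < R)
    {h : ℝ → ℝ} (hh : AEStronglyMeasurable h (volume.restrict (Ioo 0 R))) :
    ∫ y in wulffBall H R, h (dualNorm H y) =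
      ∫ r in Ioo 0 R, N * wulffVolume H * r ^ ((N : ℝ) - 1) * h r := by
  have hle : (volume.restrict (wulffBall H R)).map (dualNorm H) ≪ volume.restrict (Ioo 0 R) := by
    rw [hH.map_dualNorm hN hR]
    exact withDensity_absolutelyContinuous _ _
  rw [← integral_map (f := h) hH.continuous_dualNorm.measurable.aemeasurable (hh.mono_ac hle),
    hH.map_dualNorm hN hR, integral_withDensity_eq_integral_toReal_smul measurable_density
      (ae_of_all _ fun _ => ENNReal.ofReal_lt_top)]
  refine setIntegral_congr_fun measurableSet_Ioo fun r hr => ?_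
  simp only [smul_eq_mul]
  rw [ENNReal.toReal_ofReal]
  exact mul_nonneg (mul_nonneg (by positivity) wulffVolume_nonneg) (Real.rpow_nonneg hr.1.le _)

end IsFinslerNorm

/-! ### Approximation by test functions and weak gradients. -/

section Lp

variable {X E : Type*} [MeasurableSpace X] [NormedAddCommGroup E] {μ : Measure X}

lemma eLpNorm_ofReal_eq {p : ℝ} (hp : 1 < p) (f : X → E) :
    eLpNorm f (ENNReal.ofReal p) μ = (∫⁻ x, ‖f x‖ₑ ^ p ∂μ) ^ (1 / p) := by
  rw [eLpNorm_eq_lintegral_rpow_enorm_toReal (ENNReal.ofReal_pos.2 (by linarith)).ne'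
    ENNReal.ofReal_ne_top, ENNReal.toReal_ofReal (by linarith)]

lemma tendsto_eLpNorm_ofReal_iff {ι : Type*} {l : Filter ι} {p : ℝ} (hp : 1 < p) (f : ι → X → E) :
    Tendsto (fun i => eLpNorm (f i) (ENNReal.ofReal p) μ) l (𝓝 0) ↔
      Tendsto (fun i => ∫⁻ x, ‖f i x‖ₑ ^ p ∂μ) l (𝓝 0) := by
  have hp0 : 0 < p := by linarith
  simp only [eLpNorm_ofReal_eq hp]
  constructor
  · intro h
    have h2 := (ENNReal.continuous_rpow_const (y := p)).tendsto 0 |>.comp h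
    rw [ENNReal.zero_rpow_of_pos hp0] at h2
    refine h2.congr fun i => ?_
    simp only [Function.comp]
    rw [← ENNReal.rpow_mul, one_div_mul_cancel hp0.ne', ENNReal.rpow_one]
  · intro h
    have h2 := (ENNReal.continuous_rpow_const (y := 1 / p)).tendsto 0 |>.comp h
    rwa [ENNReal.zero_rpow_of_pos (by positivity)] at h2

/-- Bounded convergence in `L^p` on a finite measure space. -/
lemma tendsto_eLpNorm_of_bounded [IsFiniteMeasure μ] {p : ℝ} (hp : 1 < p) {f : ℕ → X → E} {C : ℝ}
    (hm : ∀ n, AEStronglyMeasurable (f n) μ) (hC : ∀ n, ∀ᵐ x ∂μ, ‖f n x‖ ≤ C)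
    (hlim : ∀ᵐ x ∂μ, Tendsto (fun n => f n x) atTop (𝓝 0)) :
    Tendsto (fun n => eLpNorm (f n) (ENNReal.ofReal p) μ) atTop (𝓝 0) := by
  have hp0 : 0 < p := by linarith
  rw [tendsto_eLpNorm_ofReal_iff hp]
  have h := tendsto_lintegral_of_dominated_convergence' (μ := μ)
    (F := fun n x => ‖f n x‖ₑ ^ p) (f := fun _ => 0) (fun _ => ENNReal.ofReal C ^ p)
    (fun n => (hm n).enorm.pow_const p) (fun n => ?_) ?_ ?_
  · simpa using h
  · filter_upwards [hC n] with x hx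
    rw [← ofReal_norm]
    gcongr
  · rw [lintegral_const]
    exact ENNReal.mul_ne_top (ENNReal.rpow_ne_top_of_nonneg hp0.le ENNReal.ofReal_ne_top)
      (measure_ne_top _ _)
  · filter_upwards [hlim] with x hx
    have h2 := (ENNReal.continuous_rpow_const (y := p)).tendsto 0
    rw [ENNReal.zero_rpow_of_pos hp0] at h2
    refine h2.comp ?_
    have h3 := hx.enorm
    rwa [enorm_zero] at h3

end Lp

variable {N : ℕ}

lemma norm_gradient_sub (f g : EuclideanSpace ℝ (Fin N) → ℝ) (x : EuclideanSpace ℝ (Fin N)) :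
    ‖gradient f x - gradient g x‖ = ‖fderiv ℝ f x - fderiv ℝ g x‖ := by
  rw [gradient, gradient, ← map_sub, LinearIsometryEquiv.norm_map]

lemma measurable_gradient (f : EuclideanSpace ℝ (Fin N) → ℝ) : Measurable (gradient f) :=
  (InnerProductSpace.toDual ℝ (EuclideanSpace ℝ (Fin N))).symm.continuous.measurable.comp (measurable_fderiv ℝ f)

/-- The derivative of a mollification of a Lipschitz function. -/
lemma hasFDerivAt_mollify {w : EuclideanSpace ℝ (Fin N) → ℝ} {K : NNReal} (hw : LipschitzWith K w)
    (ψ : ContDiffBump (0 : EuclideanSpace ℝ (Fin N))) (x : EuclideanSpace ℝ (Fin N)) :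
    HasFDerivAt (convolution (ψ.normed volume) w (ContinuousLinearMap.lsmul ℝ ℝ) volume)
      (convolution (ψ.normed volume) (fderiv ℝ w) (ContinuousLinearMap.lsmul ℝ ℝ) volume x) x := by
  have hψi : Integrable (ψ.normed volume) := ψ.integrable_normed
  have hψc : Continuous (ψ.normed volume) := ψ.continuous_normed
  have hqmp : Measure.QuasiMeasurePreserving (fun t : EuclideanSpace ℝ (Fin N) => x - t) volume volume :=
    quasiMeasurePreserving_sub_left volume x
  -- For fixed `x`, Rademacher's theorem gives differentiability at x - t for almost every `t`,
  -- which is enough to differentiate under the integral sign; the Lipschitz constant supplies the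
  -- dominating function.
  have hd : ∀ᵐ t : EuclideanSpace ℝ (Fin N), DifferentiableAt ℝ w (x - t) := hqmp.ae hw.ae_differentiableAt
  have key := hasFDerivAt_integral_of_dominated_loc_of_lip (μ := volume) (𝕜 := ℝ) (s := univ)
    (F := fun (y : EuclideanSpace ℝ (Fin N)) (t : EuclideanSpace ℝ (Fin N)) => ψ.normed volume t * w (y - t)) (x₀ := x)
    (F' := fun t : EuclideanSpace ℝ (Fin N) => ψ.normed volume t • fderiv ℝ w (x - t))
    (bound := fun t => ψ.normed volume t * K) univ_mem
    (Eventually.of_forall fun y => ?_) ?_ ?_ ?_ (hψi.mul_const _) ?_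
  · exact key.2
  · exact (hψc.mul (hw.continuous.comp (by fun_prop))).aestronglyMeasurable
  · exact (hψc.mul (hw.continuous.comp (by fun_prop))).integrable_of_hasCompactSupport
      ψ.hasCompactSupport_normed.mul_right
  · exact (hψc.measurable.smul ((measurable_fderiv ℝ w).comp (by fun_prop))).aestronglyMeasurable
  · refine ae_of_all _ fun t => ?_
    refine LipschitzWith.lipschitzOnWith (LipschitzWith.of_dist_le_mul fun y z => ?_)
    have h1 := hw.dist_le_mul (y - t) (z - t)
    rw [dist_sub_right] at h1
    have h2 := ψ.nonneg_normed (μ := volume) t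
    rw [Real.dist_eq, ← mul_sub, abs_mul, abs_of_nonneg h2, Real.coe_nnabs,
      abs_of_nonneg (mul_nonneg h2 K.coe_nonneg), mul_assoc]
    exact mul_le_mul_of_nonneg_left h1 h2
  · filter_upwards [hd] with t ht
    have h1 : HasFDerivAt (fun y => w (y - t)) (fderiv ℝ w (x - t)) x := by
      have h2 := ht.hasFDerivAt.comp x ((hasFDerivAt_id x).sub_const t)
      rw [ContinuousLinearMap.comp_id] at h2
      exact h2
    exact h1.const_mul _

/-- Compactly supported Lipschitz functions are limits of test functions in `W^{1,p}`. -/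
lemma exists_testFunction_tendsto {Ω : Set (EuclideanSpace ℝ (Fin N))} (hΩ : IsOpen Ω) (hfin : volume Ω < ⊤) {w : EuclideanSpace ℝ (Fin N) → ℝ}
    {K : NNReal} (hw : LipschitzWith K w) (hc : HasCompactSupport w) (hs : tsupport w ⊆ Ω) {p : ℝ}
    (hp : 1 < p) :
    ∃ φ : ℕ → EuclideanSpace ℝ (Fin N) → ℝ, (∀ n, IsTestFunction Ω (φ n)) ∧
      Tendsto (fun n => eLpNorm (fun x => φ n x - w x) (ENNReal.ofReal p) (volume.restrict Ω))
        atTop (𝓝 0) ∧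
      Tendsto (fun n => eLpNorm (fun x => gradient (φ n) x - gradient w x) (ENNReal.ofReal p)
        (volume.restrict Ω)) atTop (𝓝 0) := by
  have : IsFiniteMeasure (volume.restrict Ω) := ⟨by simpa using hfin⟩
  -- Mollification radii at most δ keep all supports inside the open set.
  obtain ⟨δ, hδ, hδΩ⟩ := hc.isCompact.exists_cthickening_subset_open hΩ hs
  set ρ : ℕ → ℝ := fun n => δ / ((n : ℝ) + 1) with hρ
  have hρpos : ∀ n, 0 < ρ n := fun n => by positivity
  have hρle : ∀ n, ρ n ≤ δ := fun n => by
    rw [hρ]; exact div_le_self hδ.le (by have : (0:ℝ) ≤ n := n.cast_nonneg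
                                         linarith)
  have hρlim : Tendsto ρ atTop (𝓝 0) := by
    have := (tendsto_one_div_add_atTop_nhds_zero_nat (𝕜 := ℝ)).const_mul δ
    simpa [hρ, div_eq_mul_inv] using this
  set ψ : ℕ → ContDiffBump (0 : EuclideanSpace ℝ (Fin N)) := fun n =>
    ⟨ρ n / 2, ρ n, by have := hρpos n; positivity, by have := hρpos n; linarith⟩ with hψ
  set φ : ℕ → EuclideanSpace ℝ (Fin N) → ℝ := fun n =>
    convolution ((ψ n).normed volume) w (ContinuousLinearMap.lsmul ℝ ℝ) volume with hφ
  have hwli : LocallyIntegrable w volume := hw.continuous.locallyIntegrable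
  have hφs : ∀ n, ContDiff ℝ ∞ (φ n) := fun n =>
    (ψ n).hasCompactSupport_normed.contDiff_convolution_left _ (ψ n).contDiff_normed hwli
  have hφsupp : ∀ n, tsupport (φ n) ⊆ Metric.cthickening δ (tsupport w) := by
    intro n
    refine closure_minimal ?_ Metric.isClosed_cthickening
    refine (support_convolution_subset _).trans ?_
    rintro _ ⟨y, hy, z, hz, rfl⟩
    rw [(ψ n).support_normed_eq, mem_ball_zero_iff] at hy
    refine Metric.mem_cthickening_of_dist_le _ z δ _ (subset_tsupport w hz) ?_
    simp only [dist_eq_norm, add_sub_cancel_right]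
    exact hy.le.trans (hρle n)
  have hφt : ∀ n, IsTestFunction Ω (φ n) := fun n =>
    ⟨hφs n, (hc.isCompact.cthickening).of_isClosed_subset (isClosed_tsupport _) (hφsupp n),
      (hφsupp n).trans hδΩ⟩
  have hfd : ∀ n x, fderiv ℝ (φ n) x = convolution ((ψ n).normed volume) (fderiv ℝ w)
      (ContinuousLinearMap.lsmul ℝ ℝ) volume x := fun n x => (hasFDerivAt_mollify hw (ψ n) x).fderiv
  have hDb : ∀ x, ‖fderiv ℝ w x‖ ≤ K := fun x => norm_fderiv_le_of_lipschitz ℝ hw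
  have hDm : Measurable (fderiv ℝ w) := measurable_fderiv ℝ w
  have hDli : LocallyIntegrable (fderiv ℝ w) volume := by
    refine (locallyIntegrable_const (K : ℝ)).mono hDm.aestronglyMeasurable (ae_of_all _ fun x => ?_)
    rw [Real.norm_of_nonneg K.coe_nonneg]; exact hDb x
  refine ⟨φ, hφt, ?_, ?_⟩
  · refine tendsto_eLpNorm_of_bounded hp (C := K * δ)
      (fun n => ((hφs n).continuous.sub hw.continuous).aestronglyMeasurable) (fun n => ?_) ?_
    · refine ae_of_all _ fun x => ?_
      rw [← dist_eq_norm]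
      refine (ψ n).dist_normed_convolution_le hw.continuous.aestronglyMeasurable fun y hy => ?_
      refine (hw.dist_le_mul y x).trans ?_
      exact mul_le_mul_of_nonneg_left ((le_of_lt hy).trans (hρle n)) K.coe_nonneg
    · refine ae_of_all _ fun x => ?_
      have := ContDiffBump.convolution_tendsto_right_of_continuous (μ := volume) (φ := ψ)
        hρlim hw.continuous x
      have h2 := this.sub_const (w x)
      rwa [sub_self] at h2
  · refine tendsto_eLpNorm_of_bounded hp (C := 2 * K)
      (fun n => ((measurable_gradient _).sub (measurable_gradient _)).aestronglyMeasurable)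
      (fun n => ?_) ?_
    · refine ae_of_all _ fun x => ?_
      rw [norm_gradient_sub, hfd, ← dist_eq_norm]
      refine (ψ n).dist_normed_convolution_le hDm.aestronglyMeasurable fun y _ => ?_
      rw [dist_eq_norm]
      refine (norm_sub_le _ _).trans ?_
      linarith [hDb x, hDb y]
    -- The gradient is merely bounded and measurable, so convergence holds only almost everywhere.
    -- The constant 2 is the ratio of the outer to the inner radius of the bumps.
    · have h := ContDiffBump.ae_convolution_tendsto_right_of_locallyIntegrable (μ := volume)
        (φ := ψ) (l := atTop) (K := 2) hρlim
        (Eventually.of_forall fun n => by simp only [hψ]; linarith) hDli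
      refine (ae_restrict_of_ae h).mono fun x hx => ?_
      rw [tendsto_zero_iff_norm_tendsto_zero]
      have h2 := tendsto_iff_norm_sub_tendsto_zero.1 hx
      refine h2.congr fun n => ?_
      rw [norm_gradient_sub, hfd]

variable {N : ℕ}

lemma inner_gradient_eq (f : EuclideanSpace ℝ (Fin N) → ℝ) (x e : EuclideanSpace ℝ (Fin N)) : inner ℝ e (gradient f x) = fderiv ℝ f x e := by
  rw [real_inner_comm, gradient, InnerProductSpace.toDual_symm_apply]

lemma IsTestFunction.continuous_gradient {Ω : Set (EuclideanSpace ℝ (Fin N))} {φ : EuclideanSpace ℝ (Fin N) → ℝ} (h : IsTestFunction Ω φ) :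
    Continuous (gradient φ) :=
  (InnerProductSpace.toDual ℝ (EuclideanSpace ℝ (Fin N))).symm.continuous.comp (h.contDiff.continuous_fderiv (by simp))

lemma IsTestFunction.hasCompactSupport_gradient {Ω : Set (EuclideanSpace ℝ (Fin N))} {φ : EuclideanSpace ℝ (Fin N) → ℝ} (h : IsTestFunction Ω φ) :
    HasCompactSupport (gradient φ) := by
  have h1 := h.hasCompactSupport.fderiv (𝕜 := ℝ)
  refine h1.comp_left (g := (InnerProductSpace.toDual ℝ (EuclideanSpace ℝ (Fin N))).symm) (map_zero _)

lemma IsTestFunction.eq_zero {Ω : Set (EuclideanSpace ℝ (Fin N))} {φ : EuclideanSpace ℝ (Fin N) → ℝ} (h : IsTestFunction Ω φ) {x : EuclideanSpace ℝ (Fin N)}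
    (hx : x ∉ Ω) : φ x = 0 :=
  image_eq_zero_of_notMem_tsupport fun h' => hx (h.tsupport_subset h')

/-- Integration by parts for test functions. -/
lemma IsTestFunction.integral_smul_gradient {Ω : Set (EuclideanSpace ℝ (Fin N))} {φ ψ : EuclideanSpace ℝ (Fin N) → ℝ} (hφ : IsTestFunction Ω φ)
    (hψ : IsTestFunction Ω ψ) :
    ∫ x in Ω, φ x • gradient ψ x = -∫ x in Ω, ψ x • gradient φ x := by
  rw [setIntegral_eq_integral_of_forall_compl_eq_zero fun x hx => by rw [hφ.eq_zero hx, zero_smul],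
    setIntegral_eq_integral_of_forall_compl_eq_zero fun x hx => by rw [hψ.eq_zero hx, zero_smul]]
  have i1 : Integrable (fun x => φ x • gradient ψ x) :=
    (hφ.contDiff.continuous.smul hψ.continuous_gradient).integrable_of_hasCompactSupport
      hφ.hasCompactSupport.smul_right
  have i2 : Integrable (fun x => ψ x • gradient φ x) :=
    (hψ.contDiff.continuous.smul hφ.continuous_gradient).integrable_of_hasCompactSupport
      hψ.hasCompactSupport.smul_right
  have hφd : Differentiable ℝ φ := hφ.contDiff.differentiable (by simp)
  have hψd : Differentiable ℝ ψ := hψ.contDiff.differentiable (by simp)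
  have hφc := hφ.contDiff.continuous
  have hψc := hψ.contDiff.continuous
  have hφf : ∀ e : EuclideanSpace ℝ (Fin N), Continuous fun x => fderiv ℝ φ x e := fun e =>
    (hφ.contDiff.continuous_fderiv (by simp)).clm_apply continuous_const
  have hψf : ∀ e : EuclideanSpace ℝ (Fin N), Continuous fun x => fderiv ℝ ψ x e := fun e =>
    (hψ.contDiff.continuous_fderiv (by simp)).clm_apply continuous_const
  -- Pairing with each vector `e` reduces the identity to scalar integration by parts in the
  -- direction `e`.
  refine ext_inner_left ℝ fun e => ?_
  rw [inner_neg_right, ← integral_inner i1, ← integral_inner i2]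
  simp only [inner_smul_right, inner_gradient_eq]
  rw [integral_mul_fderiv_eq_neg_fderiv_mul_of_integrable (𝕜 := ℝ)]
  · simp only [mul_comm]
  · exact ((hφf e).mul hψc).integrable_of_hasCompactSupport hψ.hasCompactSupport.mul_left
  · exact (hφc.mul (hψf e)).integrable_of_hasCompactSupport hφ.hasCompactSupport.mul_right
  · exact (hφc.mul hψc).integrable_of_hasCompactSupport hφ.hasCompactSupport.mul_right
  · exact fun x _ => hφd x
  · exact fun x _ => hψd x

/-- On a finite measure space, L^p convergence implies L¹ convergence; this passes to the limit in
the integration by parts formula. -/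
lemma tendsto_integral_of_norm_sub_le {X F G : Type*} [MeasurableSpace X] {μ : Measure X}
    [IsFiniteMeasure μ] [NormedAddCommGroup F] [NormedAddCommGroup G] [NormedSpace ℝ G] {p : ℝ}
    (hp : 1 < p) {f : ℕ → X → F} {g : ℕ → X → G} {h : X → G} {C : ℝ}
    (hg : ∀ n, Integrable (g n) μ) (hh : Integrable h μ)
    (hf : ∀ n, AEStronglyMeasurable (f n) μ)
    (hC : ∀ n x, ‖g n x - h x‖ ≤ C * ‖f n x‖)
    (hlim : Tendsto (fun n => eLpNorm (f n) (ENNReal.ofReal p) μ) atTop (𝓝 0)) :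
    Tendsto (fun n => ∫ x, g n x ∂μ) atTop (𝓝 (∫ x, h x ∂μ)) := by
  refine tendsto_integral_of_L1 h hh.1 (Eventually.of_forall hg) ?_
  have h1 : ∀ n, ∫⁻ x, ‖g n x - h x‖ₑ ∂μ ≤ ENNReal.ofReal C * (eLpNorm (f n) (ENNReal.ofReal p) μ *
      μ univ ^ (1 / (1 : ENNReal).toReal - 1 / (ENNReal.ofReal p).toReal)) := by
    intro n
    calc ∫⁻ x, ‖g n x - h x‖ₑ ∂μ ≤ ∫⁻ x, ENNReal.ofReal C * ‖f n x‖ₑ ∂μ := by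
          refine lintegral_mono fun x => ?_
          rcases le_total 0 C with h0 | h0
          · rw [← ofReal_norm, ← ofReal_norm, ← ENNReal.ofReal_mul h0]
            exact ENNReal.ofReal_le_ofReal (hC n x)
          · have : ‖g n x - h x‖ = 0 := le_antisymm ((hC n x).trans
              (mul_nonpos_of_nonpos_of_nonneg h0 (norm_nonneg _))) (norm_nonneg _)
            rw [← ofReal_norm, this]; simp
      _ = ENNReal.ofReal C * eLpNorm (f n) 1 μ := by
          rw [lintegral_const_mul' _ _ ENNReal.ofReal_ne_top, eLpNorm_one_eq_lintegral_enorm]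
      _ ≤ _ := by
          gcongr
          refine eLpNorm_le_eLpNorm_mul_rpow_measure_univ ?_ (hf n)
          rw [← ENNReal.ofReal_one]
          exact ENNReal.ofReal_le_ofReal hp.le
  have h2 : Tendsto (fun n => ENNReal.ofReal C * (eLpNorm (f n) (ENNReal.ofReal p) μ *
      μ univ ^ (1 / (1 : ENNReal).toReal - 1 / (ENNReal.ofReal p).toReal))) atTop (𝓝 0) := by
    have hT : μ univ ^ (1 / (1 : ENNReal).toReal - 1 / (ENNReal.ofReal p).toReal) ≠ ⊤ := by
      refine ENNReal.rpow_ne_top_of_nonneg ?_ (measure_ne_top _ _)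
      rw [ENNReal.toReal_ofReal (by linarith), ENNReal.toReal_one, div_one, sub_nonneg,
        div_le_one (by linarith)]
      exact hp.le
    have h3 := ENNReal.Tendsto.mul_const hlim (Or.inr hT)
    have h4 := ENNReal.Tendsto.const_mul h3 (Or.inr (ENNReal.ofReal_ne_top (r := C)))
    simpa using h4
  exact tendsto_of_tendsto_of_tendsto_of_le_of_le tendsto_const_nhds h2 (fun _ => zero_le) h1

/-- A limit of test functions in `W^{1,p}` is weakly differentiable. -/
lemma hasWeakGradient_of_tendsto {Ω : Set (EuclideanSpace ℝ (Fin N))} (hfin : volume Ω < ⊤) {p : ℝ}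
    (hp : 1 < p) {v : EuclideanSpace ℝ (Fin N) → ℝ} {g : EuclideanSpace ℝ (Fin N) → EuclideanSpace ℝ (Fin N)} (hv : MemLp v (ENNReal.ofReal p) (volume.restrict Ω))
    (hg : MemLp g (ENNReal.ofReal p) (volume.restrict Ω)) {φ : ℕ → EuclideanSpace ℝ (Fin N) → ℝ}
    (hφ : ∀ n, IsTestFunction Ω (φ n))
    (h1 : Tendsto (fun n => eLpNorm (fun x => φ n x - v x) (ENNReal.ofReal p) (volume.restrict Ω))
      atTop (𝓝 0))
    (h2 : Tendsto (fun n => eLpNorm (fun x => gradient (φ n) x - g x) (ENNReal.ofReal p)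
        (volume.restrict Ω)) atTop (𝓝 0)) :
    HasWeakGradient Ω v g := by
  have : IsFiniteMeasure (volume.restrict Ω) := ⟨by simpa using hfin⟩
  have hp1 : 1 ≤ ENNReal.ofReal p := by
    rw [← ENNReal.ofReal_one]; exact ENNReal.ofReal_le_ofReal hp.le
  have hvi : IntegrableOn v Ω := hv.integrable hp1
  have hgi : IntegrableOn g Ω := hg.integrable hp1
  refine ⟨hvi.locallyIntegrableOn, hgi.locallyIntegrableOn, fun ψ hψ => ?_⟩
  obtain ⟨C, hC⟩ := hψ.continuous_gradient.bounded_above_of_compact_support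
    hψ.hasCompactSupport_gradient
  obtain ⟨C', hC'⟩ := hψ.contDiff.continuous.bounded_above_of_compact_support
    hψ.hasCompactSupport
  have hA : Tendsto (fun n => ∫ x in Ω, φ n x • gradient ψ x) atTop
      (𝓝 (∫ x in Ω, v x • gradient ψ x)) := by
    refine tendsto_integral_of_norm_sub_le hp (C := C) (fun n => ?_) ?_
      (fun n => (hφ n).contDiff.continuous.aestronglyMeasurable.sub hv.1) (fun n x => ?_) h1
    · exact ((((hφ n).contDiff.continuous.smul
        hψ.continuous_gradient).integrable_of_hasCompactSupport
        (hφ n).hasCompactSupport.smul_right)).integrableOn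
    · exact hvi.smul_bdd _ hψ.continuous_gradient.aestronglyMeasurable (ae_of_all _ hC)
    · rw [← sub_smul, norm_smul, mul_comm]
      exact mul_le_mul_of_nonneg_right (hC x) (norm_nonneg _)
  have hB : Tendsto (fun n => ∫ x in Ω, ψ x • gradient (φ n) x) atTop
      (𝓝 (∫ x in Ω, ψ x • g x)) := by
    refine tendsto_integral_of_norm_sub_le hp (C := C') (fun n => ?_) ?_
      (fun n => (hφ n).continuous_gradient.aestronglyMeasurable.sub hg.1) (fun n x => ?_) h2
    · exact ((hψ.contDiff.continuous.smul
        (hφ n).continuous_gradient).integrable_of_hasCompactSupport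
        hψ.hasCompactSupport.smul_right).integrableOn
    · exact hgi.bdd_smul _ hψ.contDiff.continuous.aestronglyMeasurable (ae_of_all _ hC')
    · rw [← smul_sub, norm_smul]
      exact mul_le_mul_of_nonneg_right (hC' x) (norm_nonneg _)
  refine tendsto_nhds_unique hA (hB.neg.congr fun n => ?_)
  rw [← (hφ n).integral_smul_gradient hψ]

/-- Uniqueness of the weak gradient. -/
lemma HasWeakGradient.ae_eq {Ω : Set (EuclideanSpace ℝ (Fin N))} (hΩ : IsOpen Ω) {v : EuclideanSpace ℝ (Fin N) → ℝ} {g g' : EuclideanSpace ℝ (Fin N) → EuclideanSpace ℝ (Fin N)}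
    (h : HasWeakGradient Ω v g) (h' : HasWeakGradient Ω v g') :
    g =ᵐ[volume.restrict Ω] g' := by
  -- Fundamental lemma of the calculus of variations, applied to the difference of the two
  -- gradients.
  have hz := hΩ.ae_eq_zero_of_integral_contDiff_smul_eq_zero (μ := volume) (f := fun x => g x - g' x)
    (h.locallyIntegrableOn_grad.sub h'.locallyIntegrableOn_grad) fun φ h1 h2 h3 => ?_
  · rw [Filter.EventuallyEq, ae_restrict_iff' hΩ.measurableSet]
    filter_upwards [hz] with x hx hxΩ using sub_eq_zero.1 (hx hxΩ)
  · have hφ : IsTestFunction Ω φ := ⟨h1, h2, h3⟩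
    rw [← setIntegral_eq_integral_of_forall_compl_eq_zero (s := Ω)
      fun x hx => by rw [hφ.eq_zero hx, zero_smul]]
    have hi : ∀ u : EuclideanSpace ℝ (Fin N) → EuclideanSpace ℝ (Fin N), LocallyIntegrableOn u Ω → IntegrableOn (fun x => φ x • u x) Ω := by
      intro u hu
      have hK : IntegrableOn u (tsupport φ) := hu.integrableOn_compact_subset h3 h2.isCompact
      obtain ⟨C, hC⟩ := h1.continuous.bounded_above_of_compact_support h2
      have hK2 : IntegrableOn (fun x => φ x • u x) (tsupport φ) :=
        hK.bdd_smul _ h1.continuous.aestronglyMeasurable (ae_of_all _ hC)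
      refine (integrableOn_iff_integrable_of_support_subset ?_).1 hK2 |>.integrableOn
      intro x hx
      refine subset_tsupport φ fun h0 => hx ?_
      simp only [h0, zero_smul]
    simp only [smul_sub]
    rw [integral_sub (hi g h.locallyIntegrableOn_grad) (hi g' h'.locallyIntegrableOn_grad)]
    have e1 := h.integral_eq φ hφ
    have e2 := h'.integral_eq φ hφ
    rw [e1] at e2
    rw [sub_eq_zero]
    exact neg_injective e2

/-- The set of `W^{1,p}`-limits of test functions is closed. -/
lemma exists_testFunction_tendsto_of_tendsto {Ω : Set (EuclideanSpace ℝ (Fin N))} {p : ℝ}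
    (hp : 1 < p) {v : EuclideanSpace ℝ (Fin N) → ℝ} {g : EuclideanSpace ℝ (Fin N) → EuclideanSpace ℝ (Fin N)} (hv : AEStronglyMeasurable v (volume.restrict Ω))
    (hg : AEStronglyMeasurable g (volume.restrict Ω)) {w : ℕ → EuclideanSpace ℝ (Fin N) → ℝ} {G : ℕ → EuclideanSpace ℝ (Fin N) → EuclideanSpace ℝ (Fin N)}
    (hw : ∀ k, AEStronglyMeasurable (w k) (volume.restrict Ω))
    (hG : ∀ k, AEStronglyMeasurable (G k) (volume.restrict Ω))
    (happ : ∀ k, ∃ φ : ℕ → EuclideanSpace ℝ (Fin N) → ℝ, (∀ n, IsTestFunction Ω (φ n)) ∧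
      Tendsto (fun n => eLpNorm (fun x => φ n x - w k x) (ENNReal.ofReal p) (volume.restrict Ω))
        atTop (𝓝 0) ∧
      Tendsto (fun n => eLpNorm (fun x => gradient (φ n) x - G k x) (ENNReal.ofReal p)
        (volume.restrict Ω)) atTop (𝓝 0))
    (h1 : Tendsto (fun n => eLpNorm (fun x => w n x - v x) (ENNReal.ofReal p) (volume.restrict Ω))
      atTop (𝓝 0))
    (h2 : Tendsto (fun n => eLpNorm (fun x => G n x - g x) (ENNReal.ofReal p) (volume.restrict Ω))
      atTop (𝓝 0)) :
    ∃ φ : ℕ → EuclideanSpace ℝ (Fin N) → ℝ, (∀ n, IsTestFunction Ω (φ n)) ∧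
      Tendsto (fun n => eLpNorm (fun x => φ n x - v x) (ENNReal.ofReal p) (volume.restrict Ω))
        atTop (𝓝 0) ∧
      Tendsto (fun n => eLpNorm (fun x => gradient (φ n) x - g x) (ENNReal.ofReal p)
        (volume.restrict Ω)) atTop (𝓝 0) := by
  have hp1 : 1 ≤ ENNReal.ofReal p := by
    rw [← ENNReal.ofReal_one]; exact ENNReal.ofReal_le_ofReal hp.le
  -- Diagonal choice: for each `k`, one test function within 1/(k+1) of the k-th approximant in both
  -- norms.
  have hsel : ∀ k : ℕ, ∃ φ : EuclideanSpace ℝ (Fin N) → ℝ, IsTestFunction Ω φ ∧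
      eLpNorm (fun x => φ x - w k x) (ENNReal.ofReal p) (volume.restrict Ω) ≤ ((k : ENNReal) + 1)⁻¹ ∧
      eLpNorm (fun x => gradient φ x - G k x) (ENNReal.ofReal p) (volume.restrict Ω) ≤
        ((k : ENNReal) + 1)⁻¹ := by
    intro k
    obtain ⟨φ, ht, ha, hb⟩ := happ k
    have hpos : (0 : ENNReal) < ((k : ENNReal) + 1)⁻¹ := by
      rw [ENNReal.inv_pos]; finiteness
    obtain ⟨n, hn1, hn2⟩ := ((ha.eventually_le_const hpos).and (hb.eventually_le_const hpos)).exists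
    exact ⟨φ n, ht n, hn1, hn2⟩
  choose φ hφ ha hb using hsel
  have hinv : Tendsto (fun k : ℕ => ((k : ENNReal) + 1)⁻¹) atTop (𝓝 0) := by
    have := (tendsto_add_atTop_iff_nat 1).2 ENNReal.tendsto_inv_nat_nhds_zero
    simpa using this
  refine ⟨φ, hφ, ?_, ?_⟩
  · have h3 := hinv.add h1
    rw [add_zero] at h3
    refine tendsto_of_tendsto_of_tendsto_of_le_of_le tendsto_const_nhds h3
      (fun _ => zero_le) fun k => ?_
    have h4 := eLpNorm_add_le ((hφ k).contDiff.continuous.aestronglyMeasurable.sub (hw k))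
      ((hw k).sub hv) hp1
    have h5 : (φ k - w k) + (w k - v) = fun x => φ k x - v x := by ext x; simp
    rw [h5] at h4
    exact h4.trans (add_le_add (ha k) le_rfl)
  · have h3 := hinv.add h2
    rw [add_zero] at h3
    refine tendsto_of_tendsto_of_tendsto_of_le_of_le tendsto_const_nhds h3
      (fun _ => zero_le) fun k => ?_
    have h4 := eLpNorm_add_le ((hφ k).continuous_gradient.aestronglyMeasurable.sub (hG k))
      ((hG k).sub hg) hp1
    have h5 : (gradient (φ k) - G k) + (G k - g) = fun x => gradient (φ k) x - g x := by
      ext x; simp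
    rw [h5] at h4
    exact h4.trans (add_le_add (hb k) le_rfl)

/-! ### Weighted Hölder and Hardy estimates for radial primitives. -/

section Hardy

variable {N : ℕ} {p R : ℝ}

/-- The weighted energy `∫₀ᴿ h(r)^p r^{N-1} dr`. -/
def radialEnergy (N : ℕ) (p R : ℝ) (h : ℝ → ENNReal) : ENNReal :=
  ∫⁻ r in Ioo 0 R, ENNReal.ofReal (r ^ ((N : ℝ) - 1)) * h r ^ p

/-- Hölder's inequality after inserting s^{(N-1)/p} and its inverse. The dual factor is at most
∫_r^∞ s^{-m} ds with m = (N-1)/(p-1), which is greater than 1 because p < N; raised to the power p-1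
it contributes r^{p-N}. -/
lemma radial_holder (hp1 : 1 < p) (hpN : p < N) {h : ℝ → ENNReal} (hh : Measurable h) {r : ℝ}
    (hr : 0 < r) :
    (∫⁻ s in Ioo r R, h s) ^ p ≤ radialEnergy N p R h *
      ENNReal.ofReal ((((N : ℝ) - p) / (p - 1)) ^ (1 - p) * r ^ (p - N)) := by
  set m : ℝ := ((N : ℝ) - 1) / (p - 1) with hm
  have hp0 : 0 < p := by linarith
  have hp10 : 0 < p - 1 := by linarith
  have hm1 : m - 1 = ((N : ℝ) - p) / (p - 1) := by rw [hm]; field_simp; ring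
  have hβ : 0 < ((N : ℝ) - p) / (p - 1) := div_pos (by linarith) hp10
  have hpq : p.HolderConjugate (p / (p - 1)) := Real.HolderConjugate.conjExponent hp1
  have hsplit : ∫⁻ s in Ioo r R, h s = ∫⁻ s in Ioo r R,
      ((fun s => ENNReal.ofReal (s ^ (((N : ℝ) - 1) / p)) * h s) *
        (fun s => ENNReal.ofReal (s ^ (-(((N : ℝ) - 1) / p))))) s := by
    refine setLIntegral_congr_fun measurableSet_Ioo fun s hs => ?_
    have hs0 : 0 < s := hr.trans hs.1
    simp only [Pi.mul_apply]
    rw [mul_right_comm, ← ENNReal.ofReal_mul (by positivity), ← Real.rpow_add hs0, add_neg_cancel,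
      Real.rpow_zero, ENNReal.ofReal_one, one_mul]
  have hH := ENNReal.lintegral_mul_le_Lp_mul_Lq (volume.restrict (Ioo r R)) hpq
    (f := fun s => ENNReal.ofReal (s ^ (((N : ℝ) - 1) / p)) * h s)
    (g := fun s => ENNReal.ofReal (s ^ (-(((N : ℝ) - 1) / p))))
    (by fun_prop) (by fun_prop)
  rw [← hsplit] at hH
  have h1 : ∫⁻ s in Ioo r R, (ENNReal.ofReal (s ^ (((N : ℝ) - 1) / p)) * h s) ^ p ≤
      radialEnergy N p R h := by
    refine le_trans (le_of_eq ?_) (lintegral_mono_set (Ioo_subset_Ioo_left hr.le))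
    refine setLIntegral_congr_fun measurableSet_Ioo fun s hs => ?_
    have hs0 : 0 < s := hr.trans hs.1
    rw [ENNReal.mul_rpow_of_nonneg _ _ hp0.le, ENNReal.ofReal_rpow_of_nonneg (by positivity) hp0.le,
      ← Real.rpow_mul hs0.le, div_mul_cancel₀ _ hp0.ne']
  have h2 : ∫⁻ s in Ioo r R, ENNReal.ofReal (s ^ (-(((N : ℝ) - 1) / p))) ^ (p / (p - 1)) ≤
      ENNReal.ofReal (r ^ (1 - m) / (m - 1)) := by
    have e : ∫ s in Ioi r, s ^ (-m) = r ^ (1 - m) / (m - 1) := by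
      rw [integral_Ioi_rpow_of_lt (by linarith) hr, neg_add_eq_sub, ← neg_sub m 1, div_neg, neg_div,
        neg_neg]
    rw [← e, ofReal_integral_eq_lintegral_ofReal (integrableOn_Ioi_rpow_of_lt (by linarith) hr)
      ((ae_restrict_mem measurableSet_Ioi).mono fun s (hs : r < s) =>
        Real.rpow_nonneg (hr.trans hs).le _)]
    refine le_trans (le_of_eq ?_) (lintegral_mono_set (s := Ioo r R) Ioo_subset_Ioi_self)
    refine setLIntegral_congr_fun measurableSet_Ioo fun s hs => ?_
    have hs0 : 0 < s := hr.trans hs.1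
    rw [ENNReal.ofReal_rpow_of_nonneg (by positivity) (by positivity), ← Real.rpow_mul hs0.le]
    congr 2
    rw [hm]; field_simp
  calc (∫⁻ s in Ioo r R, h s) ^ p
      ≤ (radialEnergy N p R h ^ (1 / p) *
          ENNReal.ofReal (r ^ (1 - m) / (m - 1)) ^ (1 / (p / (p - 1)))) ^ p := by
        refine ENNReal.rpow_le_rpow (hH.trans ?_) hp0.le
        gcongr
    _ = radialEnergy N p R h * ENNReal.ofReal ((((N : ℝ) - p) / (p - 1)) ^ (1 - p) * r ^ (p - N)) := by
        rw [ENNReal.mul_rpow_of_nonneg _ _ hp0.le, ← ENNReal.rpow_mul, ← ENNReal.rpow_mul,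
          one_div_mul_cancel hp0.ne', ENNReal.rpow_one]
        have e1 : 1 / (p / (p - 1)) * p = p - 1 := by field_simp
        have hpos : 0 < r ^ (1 - m) / (m - 1) := by rw [hm1]; positivity
        rw [e1, ENNReal.ofReal_rpow_of_pos hpos, hm1, Real.div_rpow (by positivity) hβ.le,
          ← Real.rpow_mul hr.le, show (1 : ℝ) - p = -(p - 1) by ring, Real.rpow_neg hβ.le]
        have e2 : (1 - m) * (p - 1) = p - N := by rw [hm]; field_simp; ring
        rw [e2, div_eq_mul_inv, mul_comm (r ^ _)]

/-- Hardy's inequality for radial functions on a Wulff ball. -/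
lemma IsFinslerNorm.exists_hardy {H : EuclideanSpace ℝ (Fin N) → ℝ} (hH : IsFinslerNorm H)
    (hN : 2 ≤ N) (hp1 : 1 < p) (hpN : p < N) (hR : 0 < R) :
    ∃ C : ENNReal, C ≠ ⊤ ∧ ∀ h : ℝ → ENNReal, Measurable h →
      ∫⁻ y in wulffBall H R, (∫⁻ s in Ioo (dualNorm H y) R, h s) ^ p ≤
        C * radialEnergy N p R h := by
  set c : ℝ := (((N : ℝ) - p) / (p - 1)) ^ (1 - p) with hc
  have hc0 : 0 ≤ c := Real.rpow_nonneg (div_nonneg (by linarith) (by linarith)) _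
  refine ⟨∫⁻ y in wulffBall H R, ENNReal.ofReal (c * dualNorm H y ^ (p - N)), ?_, fun h hh => ?_⟩
  · have hm : Measurable fun r : ℝ => ENNReal.ofReal (c * r ^ (p - N)) := by fun_prop
    rw [hH.lintegral_dualNorm hN hR hm.aemeasurable]
    -- The polar Jacobian r^{N-1} turns the pointwise bound r^{p-N} into r^{p-1}, which is
    -- integrable at 0.
    have hi : IntegrableOn (fun r : ℝ => N * wulffVolume H * c * r ^ (p - 1)) (Ioo 0 R) := by
      have := (intervalIntegral.intervalIntegrable_rpow' (a := 0) (b := R)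
        (show -1 < p - 1 by linarith)).const_mul (N * wulffVolume H * c)
      rw [intervalIntegrable_iff_integrableOn_Ioo_of_le hR.le] at this
      exact this
    refine ne_of_lt (lt_of_le_of_lt (lintegral_mono_ae ?_) hi.lintegral_lt_top)
    refine (ae_restrict_mem measurableSet_Ioo).mono fun r hr => le_of_eq ?_
    have hr0 : 0 < r := hr.1
    have hκ : 0 ≤ wulffVolume H := wulffVolume_nonneg
    rw [← ENNReal.ofReal_mul (by positivity)]
    congr 1
    have : r ^ (p - 1) = r ^ ((N : ℝ) - 1) * r ^ (p - N) := by
      rw [← Real.rpow_add hr0]; congr 1; ring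
    rw [this]; ring
  · rw [mul_comm, ← lintegral_const_mul _ (by
      have := hH.continuous_dualNorm.measurable
      fun_prop)]
    refine lintegral_mono_ae (ae_restrict_of_ae ?_)
    have : Nontrivial (Fin N) := Fin.nontrivial_iff_two_le.2 hN
    have hne : ∀ᵐ y : EuclideanSpace ℝ (Fin N), y ≠ 0 := by simp [ae_iff]
    filter_upwards [hne] with y hy
    exact radial_holder hp1 hpN hh (hH.dualNorm_pos hy)

lemma integrableOn_of_radialEnergy (hp1 : 1 < p) (hpN : p < N) {f : ℝ → ℝ} (hf : Measurable f)
    (hE : radialEnergy N p R (fun r => ‖f r‖ₑ) ≠ ⊤) {r : ℝ} (hr : 0 < r) :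
    IntegrableOn f (Ioo r R) := by
  refine ⟨hf.aestronglyMeasurable, ?_⟩
  have h := radial_holder (R := R) hp1 hpN hf.enorm hr
  have h2 : (∫⁻ s in Ioo r R, ‖f s‖ₑ) ^ p < ⊤ :=
    lt_of_le_of_lt h (ENNReal.mul_lt_top hE.lt_top ENNReal.ofReal_lt_top)
  exact (ENNReal.rpow_lt_top_iff_of_pos (by linarith)).1 h2

lemma enorm_integral_le_lintegral {f : ℝ → ℝ} {r : ℝ} (hr : r ≤ R) :
    ‖∫ s in r..R, f s‖ₑ ≤ ∫⁻ s in Ioo r R, ‖f s‖ₑ := by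
  rw [intervalIntegral.integral_of_le hr, integral_Ioc_eq_integral_Ioo]
  exact enorm_integral_le_lintegral_enorm _

end Hardy

/-! ### Radial primitives of finite energy belong to W₀^{1,p}. -/

section RadialChainRule

variable {N : ℕ} {p R : ℝ} {H : EuclideanSpace ℝ (Fin N) → ℝ}

lemma continuousOn_integral_left {f : ℝ → ℝ} (hf : ∀ r, 0 < r → IntegrableOn f (Ioo r R)) :
    ContinuousOn (fun r => ∫ s in r..R, f s) (Ioo 0 R) := by
  intro x hx
  have hx2 : 0 < x / 2 := half_pos hx.1
  have hxR : x / 2 ≤ R := by linarith [hx.1, hx.2]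
  have hi : IntegrableOn f (uIcc (x / 2) R) := by
    rw [uIcc_of_le hxR, integrableOn_Icc_iff_integrableOn_Ioo]
    exact hf _ hx2
  have hc := intervalIntegral.continuousOn_primitive_interval_left hi
  rw [uIcc_of_le hxR] at hc
  exact (hc.continuousAt (Icc_mem_nhds (half_lt_self hx.1) hx.2)).continuousWithinAt

lemma lipschitzWith_integral_left {f : ℝ → ℝ} {C : ℝ} (hf : Measurable f) (hC : ∀ r, |f r| ≤ C) :
    LipschitzWith C.toNNReal (fun r => ∫ s in r..R, f s) := by
  have hi : ∀ a b, IntervalIntegrable f volume a b := fun a b =>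
    (intervalIntegrable_const (c := C)).mono_fun hf.aestronglyMeasurable
      (Eventually.of_forall fun r => by
        exact (hC r).trans (le_abs_self C))
  refine LipschitzWith.of_dist_le' fun x y => ?_
  rw [Real.dist_eq, ← intervalIntegral.integral_add_adjacent_intervals (hi x y) (hi y R),
    add_sub_cancel_right, dist_comm, Real.dist_eq, ← Real.norm_eq_abs]
  exact intervalIntegral.norm_integral_le_of_norm_le_const fun r _ => hC r

/-- A radial function with bounded radial derivative supported away from the boundary. -/
lemma IsFinslerNorm.lipschitz_radial (hH : IsFinslerNorm H) (hN : 2 ≤ N) (hR : 0 < R) {f : ℝ → ℝ}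
    (hf : Measurable f) {C ε : ℝ} (hC : ∀ r, |f r| ≤ C) (hε : 0 < ε)
    (hs : ∀ r, R - ε < r → f r = 0) :
    ∃ K : NNReal, LipschitzWith K (fun y => ∫ s in dualNorm H y..R, f s) ∧
      HasCompactSupport (fun y => ∫ s in dualNorm H y..R, f s) ∧
      tsupport (fun y => ∫ s in dualNorm H y..R, f s) ⊆ wulffBall H R ∧
      ∀ᵐ y ∂(volume.restrict (wulffBall H R)),
        gradient (fun y => ∫ s in dualNorm H y..R, f s) y =
          -f (dualNorm H y) • gradient (dualNorm H) y := by
  obtain ⟨K, hK⟩ := hH.exists_lipschitzWith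
  -- The point `y` may lie outside the ball, where the interval of integration is reversed; the
  -- integral still vanishes, because `f` is zero beyond R - ε.
  have hsub : tsupport (fun y => ∫ s in dualNorm H y..R, f s) ⊆ {y | dualNorm H y ≤ R - ε} := by
    refine closure_minimal (fun y hy => ?_) (isClosed_le hH.continuous_dualNorm continuous_const)
    by_contra hcon
    replace hcon : R - ε < dualNorm H y := not_le.1 hcon
    refine hy (intervalIntegral.integral_zero_ae (Eventually.of_forall fun s hs' => hs s ?_))
    rw [mem_uIoc] at hs'
    rcases hs' with h | h <;> linarith [h.1, h.2]
  refine ⟨_, (lipschitzWith_integral_left hf hC).comp hK,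
    (hH.isCompact_dualNorm_le (R - ε)).of_isClosed_subset (isClosed_tsupport _) hsub,
    fun y hy => lt_of_le_of_lt (hsub hy) (show R - ε < R by linarith), ?_⟩
  have hloc : LocallyIntegrable f := by
    refine (locallyIntegrable_const C).mono hf.aestronglyMeasurable
      (Eventually.of_forall fun r => ?_)
    exact (hC r).trans (le_abs_self C)
  have hd : ∀ᵐ r ∂(volume.restrict (Ioo 0 R)),
      HasDerivAt (fun r => ∫ s in r..R, f s) (-f r) r := by
    refine ae_restrict_of_ae ?_
    filter_upwards [_root_.LocallyIntegrable.ae_hasDerivAt_integral hloc] with r hr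
    rw [show (fun r => ∫ s in r..R, f s) = fun r => -∫ s in R..r, f s from
      funext fun r => intervalIntegral.integral_symm R r]
    exact (hr R).neg
  -- The chain rule holds where H⁰ is differentiable and the primitive is differentiable at H⁰(y).
  -- The exceptional radii are null, so by polar coordinates so are the points of the ball over
  -- them.
  filter_upwards [hH.ae_dualNorm hN hR hd, ae_restrict_of_ae hK.ae_differentiableAt] with y h1 h2
  have h3 := h1.comp_hasFDerivAt y h2.hasFDerivAt
  rw [gradient, gradient, ← map_smul]
  congr 1
  exact h3.fderiv

/-- The truncation of `f` at height `k` and at distance `1 / (k + 1)` from `0` and `R`. -/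
def radialTrunc (R : ℝ) (f : ℝ → ℝ) (k : ℕ) : ℝ → ℝ :=
  ({r | r ≤ R - 1 / ((k : ℝ) + 1)} ∩ {r | |f r| ≤ k}).indicator f

lemma measurable_radialTrunc {f : ℝ → ℝ} (hf : Measurable f) (k : ℕ) :
    Measurable (radialTrunc R f k) :=
  hf.indicator (measurableSet_Iic.inter (measurableSet_le hf.abs measurable_const))

lemma abs_radialTrunc_le {f : ℝ → ℝ} (k : ℕ) (r : ℝ) : |radialTrunc R f k r| ≤ k := by
  by_cases h : r ∈ {r | r ≤ R - 1 / ((k : ℝ) + 1)} ∩ {r | |f r| ≤ k}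
  · rw [radialTrunc, indicator_of_mem h]; exact h.2
  · rw [radialTrunc, indicator_of_notMem h, abs_zero]; positivity

lemma enorm_sub_radialTrunc_le {f : ℝ → ℝ} (k : ℕ) (r : ℝ) :
    ‖f r - radialTrunc R f k r‖ₑ ≤ ‖f r‖ₑ := by
  by_cases h : r ∈ {r | r ≤ R - 1 / ((k : ℝ) + 1)} ∩ {r | |f r| ≤ k}
  · rw [radialTrunc, indicator_of_mem h]; simp
  · rw [radialTrunc, indicator_of_notMem h, sub_zero]

lemma eventually_radialTrunc_eq {f : ℝ → ℝ} {r : ℝ} (hr : r < R) :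
    ∀ᶠ k in atTop, radialTrunc R f k r = f r := by
  have h1 : Tendsto (fun k : ℕ => R - 1 / ((k : ℝ) + 1)) atTop (𝓝 R) := by
    simpa using tendsto_one_div_add_atTop_nhds_zero_nat.const_sub R
  filter_upwards [h1.eventually (lt_mem_nhds hr),
    tendsto_natCast_atTop_atTop.eventually_ge_atTop |f r|] with k hk1 hk2
  exact indicator_of_mem (show r ∈ _ ∩ _ from ⟨hk1.le, hk2⟩) f

/-- Dominated convergence: at a fixed r < R the truncation eventually equals `f`, since it removes
only large values and radii close to R. -/
lemma tendsto_radialEnergy_sub (hp1 : 1 < p) {f : ℝ → ℝ} (hf : Measurable f)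
    (hE : radialEnergy N p R (fun r => ‖f r‖ₑ) ≠ ⊤) :
    Tendsto (fun k => radialEnergy N p R (fun r => ‖f r - radialTrunc R f k r‖ₑ)) atTop (𝓝 0) := by
  have hp0 : 0 < p := by linarith
  have h := tendsto_lintegral_of_dominated_convergence (μ := volume.restrict (Ioo 0 R))
    (F := fun k r => ENNReal.ofReal (r ^ ((N : ℝ) - 1)) * ‖f r - radialTrunc R f k r‖ₑ ^ p)
    (f := fun _ => 0) (fun r => ENNReal.ofReal (r ^ ((N : ℝ) - 1)) * ‖f r‖ₑ ^ p)
    (fun k => by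
      have := measurable_radialTrunc (R := R) hf k
      fun_prop) (fun k => Eventually.of_forall fun r => ?_) hE ?_
  · simpa [radialEnergy] using h
  · have := enorm_sub_radialTrunc_le (R := R) (f := f) k r
    dsimp only
    gcongr
  · refine (ae_restrict_mem measurableSet_Ioo).mono fun r hr => ?_
    refine tendsto_const_nhds.congr' ?_
    filter_upwards [eventually_radialTrunc_eq (f := f) hr.2] with k hk
    rw [hk, sub_self, enorm_zero, ENNReal.zero_rpow_of_pos hp0, mul_zero]


/-- The gradient of H⁰ is bounded by its Lipschitz constant; polar coordinates do the rest. -/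
lemma IsFinslerNorm.exists_lintegral_gradient_le (hH : IsFinslerNorm H) (hN : 2 ≤ N)
    (hp1 : 1 < p) (hR : 0 < R) :
    ∃ C : ENNReal, C ≠ ⊤ ∧ ∀ h : ℝ → ℝ, Measurable h →
      ∫⁻ y in wulffBall H R, ‖h (dualNorm H y) • gradient (dualNorm H) y‖ₑ ^ p ≤
        C * radialEnergy N p R (fun r => ‖h r‖ₑ) := by
  obtain ⟨K, hK⟩ := hH.exists_lipschitzWith
  have hp0 : 0 < p := by linarith
  refine ⟨(K : ENNReal) ^ p * ENNReal.ofReal (N * wulffVolume H), ENNReal.mul_ne_top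
    (ENNReal.rpow_ne_top_of_nonneg hp0.le ENNReal.coe_ne_top) ENNReal.ofReal_ne_top,
    fun h hh => ?_⟩
  have hm : Measurable fun r : ℝ => ‖h r‖ₑ ^ p := by fun_prop
  have hFm := hH.continuous_dualNorm.measurable
  calc ∫⁻ y in wulffBall H R, ‖h (dualNorm H y) • gradient (dualNorm H) y‖ₑ ^ p
      ≤ ∫⁻ y in wulffBall H R, (K : ENNReal) ^ p * ‖h (dualNorm H y)‖ₑ ^ p := by
        refine lintegral_mono fun y => ?_
        rw [enorm_smul, ENNReal.mul_rpow_of_nonneg _ _ hp0.le, mul_comm]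
        gcongr
        rw [gradient, enorm_eq_nnnorm, LinearIsometryEquiv.nnnorm_map]
        exact_mod_cast norm_fderiv_le_of_lipschitz ℝ hK
    _ = (K : ENNReal) ^ p * ENNReal.ofReal (N * wulffVolume H) *
          radialEnergy N p R (fun r => ‖h r‖ₑ) := by
        rw [lintegral_const_mul _ (by fun_prop), hH.lintegral_dualNorm hN hR hm.aemeasurable,
          mul_assoc, radialEnergy,
          ← lintegral_const_mul (ENNReal.ofReal (N * wulffVolume H)) (by fun_prop)]
        congr 1
        refine setLIntegral_congr_fun measurableSet_Ioo fun r hr => ?_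
        have hκ : 0 ≤ wulffVolume H := wulffVolume_nonneg
        rw [ENNReal.ofReal_mul (by positivity), mul_assoc]

/-- A radial function whose radial derivative has finite energy is in `W₀^{1,p}`. -/
theorem IsFinslerNorm.memSobolevZero_radial (hH : IsFinslerNorm H) (hN : 2 ≤ N) (hp1 : 1 < p)
    (hpN : p < N) (hR : 0 < R) {f : ℝ → ℝ} (hf : Measurable f)
    (hE : radialEnergy N p R (fun r => ‖f r‖ₑ) ≠ ⊤) :
    MemSobolevZero (wulffBall H R) p (fun y => ∫ s in dualNorm H y..R, f s) ∧
      HasWeakGradient (wulffBall H R) (fun y => ∫ s in dualNorm H y..R, f s)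
        (fun y => -f (dualNorm H y) • gradient (dualNorm H) y) := by
  have hp0 : 0 < p := by linarith
  have hFm := hH.continuous_dualNorm.measurable
  have hgm := measurable_gradient (dualNorm H)
  have hnt : Nontrivial (Fin N) := Fin.nontrivial_iff_two_le.2 hN
  have hne : ∀ᵐ y : EuclideanSpace ℝ (Fin N), y ≠ 0 := by simp [ae_iff]
  have hΩm : MeasurableSet (wulffBall H R) := (hH.isOpen_wulffBall R).measurableSet
  have hfin := hH.measure_wulffBall_lt_top R
  obtain ⟨C₁, hC₁, hardy⟩ := hH.exists_hardy hN hp1 hpN hR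
  obtain ⟨C₂, hC₂, hgrad⟩ := hH.exists_lintegral_gradient_le hN hp1 hR
  have hfi : ∀ r, 0 < r → IntegrableOn f (Ioo r R) := fun r hr =>
    integrableOn_of_radialEnergy hp1 hpN hf hE hr
  have hvm : AEStronglyMeasurable (fun y => ∫ s in dualNorm H y..R, f s)
      (volume.restrict (wulffBall H R)) := by
    have h1 : AEStronglyMeasurable (fun r => ∫ s in r..R, f s) (volume.restrict (Ioo 0 R)) :=
      (continuousOn_integral_left hfi).aestronglyMeasurable measurableSet_Ioo
    refine (h1.mono_ac ?_).comp_measurable hFm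
    rw [hH.map_dualNorm hN hR]
    exact withDensity_absolutelyContinuous _ _
  have hG : AEStronglyMeasurable (fun y => -f (dualNorm H y) • gradient (dualNorm H) y)
      (volume.restrict (wulffBall H R)) := by
    have : Measurable (fun y => -f (dualNorm H y) • gradient (dualNorm H) y) := by fun_prop
    exact this.aestronglyMeasurable
  have hvL : MemLp (fun y => ∫ s in dualNorm H y..R, f s) (ENNReal.ofReal p)
      (volume.restrict (wulffBall H R)) := by
    refine ⟨hvm, ?_⟩
    rw [eLpNorm_ofReal_eq hp1]
    refine ENNReal.rpow_lt_top_of_nonneg (by positivity) (ne_of_lt (lt_of_le_of_lt ?_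
      (ENNReal.mul_lt_top hC₁.lt_top hE.lt_top)))
    refine le_trans (setLIntegral_mono' hΩm fun y hy => ?_) (hardy _ hf.enorm)
    exact ENNReal.rpow_le_rpow (enorm_integral_le_lintegral (le_of_lt hy)) hp0.le
  have hgL : MemLp (fun y => -f (dualNorm H y) • gradient (dualNorm H) y) (ENNReal.ofReal p)
      (volume.restrict (wulffBall H R)) := by
    refine ⟨hG, ?_⟩
    rw [eLpNorm_ofReal_eq hp1]
    refine ENNReal.rpow_lt_top_of_nonneg (by positivity) (ne_of_lt (lt_of_le_of_lt
      (hgrad (fun r => -f r) hf.neg) ?_))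
    simp only [enorm_neg]
    exact ENNReal.mul_lt_top hC₂.lt_top hE.lt_top
  -- Truncations are bounded and vanish near R, so their primitives are compactly supported
  -- Lipschitz functions.
  have htr := fun k : ℕ => hH.lipschitz_radial hN hR (measurable_radialTrunc (R := R) hf k)
    (fun r => abs_radialTrunc_le k r) (show (0 : ℝ) < 1 / ((k : ℝ) + 1) by positivity)
    (fun r hr => indicator_of_notMem (fun h => (not_lt.2 h.1) hr) f)
  choose K hK1 hK2 hK3 hK4 using htr
  have hlim := tendsto_radialEnergy_sub (N := N) (R := R) hp1 hf hE
  -- Hardy's inequality bounds the error of the functions by the energy of f minus its truncation;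
  -- the gradients are controlled directly by the same energy.
  have hw1 : Tendsto (fun k => eLpNorm (fun y => (∫ s in dualNorm H y..R, radialTrunc R f k s) -
      ∫ s in dualNorm H y..R, f s) (ENNReal.ofReal p) (volume.restrict (wulffBall H R)))
      atTop (𝓝 0) := by
    rw [tendsto_eLpNorm_ofReal_iff hp1]
    have hlim1 := ENNReal.Tendsto.const_mul (a := C₁) hlim (Or.inr hC₁)
    rw [mul_zero] at hlim1
    refine tendsto_of_tendsto_of_tendsto_of_le_of_le tendsto_const_nhds hlim1
      (fun k => zero_le) fun k => ?_
    have hm := measurable_radialTrunc (R := R) hf k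
    refine le_trans (lintegral_mono_ae ?_) (hardy (fun r => ‖f r - radialTrunc R f k r‖ₑ)
      (by fun_prop))
    filter_upwards [ae_restrict_mem hΩm, ae_restrict_of_ae hne] with y hy hy0
    have hy' : dualNorm H y < R := hy
    refine ENNReal.rpow_le_rpow ?_ hp0.le
    have i1 : IntervalIntegrable f volume (dualNorm H y) R := by
      rw [intervalIntegrable_iff_integrableOn_Ioo_of_le hy'.le]
      exact hfi _ (hH.dualNorm_pos hy0)
    have i2 : IntervalIntegrable (radialTrunc R f k) volume (dualNorm H y) R :=
      (intervalIntegrable_const (c := (k : ℝ))).mono_fun hm.aestronglyMeasurable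
        (Eventually.of_forall fun r => (abs_radialTrunc_le k r).trans (le_abs_self _))
    rw [← intervalIntegral.integral_sub i2 i1]
    refine (enorm_integral_le_lintegral hy'.le).trans (le_of_eq ?_)
    simp only [← enorm_neg (f _ - _), neg_sub]
  have hw2 : Tendsto (fun k => eLpNorm (fun y =>
      gradient (fun y => ∫ s in dualNorm H y..R, radialTrunc R f k s) y -
        -f (dualNorm H y) • gradient (dualNorm H) y) (ENNReal.ofReal p)
          (volume.restrict (wulffBall H R))) atTop (𝓝 0) := by
    rw [tendsto_eLpNorm_ofReal_iff hp1]
    have hlim1 := ENNReal.Tendsto.const_mul (a := C₂) hlim (Or.inr hC₂)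
    rw [mul_zero] at hlim1
    refine tendsto_of_tendsto_of_tendsto_of_le_of_le tendsto_const_nhds hlim1
      (fun k => zero_le) fun k => ?_
    have hm := measurable_radialTrunc (R := R) hf k
    refine le_trans (le_of_eq (lintegral_congr_ae ?_))
      (hgrad (fun r => f r - radialTrunc R f k r) (hf.sub hm))
    filter_upwards [hK4 k] with y hy
    rw [hy, ← sub_smul]
    congr 3
    ring
  obtain ⟨φ, hφ, h1, h2⟩ := exists_testFunction_tendsto_of_tendsto hp1 hvm hG
    (w := fun k y => ∫ s in dualNorm H y..R, radialTrunc R f k s)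
    (G := fun k => gradient (fun y => ∫ s in dualNorm H y..R, radialTrunc R f k s))
    (fun k => (hK1 k).continuous.aestronglyMeasurable)
    (fun k => (measurable_gradient _).aestronglyMeasurable)
    (fun k => exists_testFunction_tendsto (hH.isOpen_wulffBall R) hfin (hK1 k) (hK2 k) (hK3 k) hp1)
    hw1 hw2
  have hw := hasWeakGradient_of_tendsto hfin hp1 hvL hgL hφ h1 h2
  exact ⟨⟨hvL, _, hw, hgL, φ, hφ, h1, h2⟩, hw⟩

end RadialChainRule

/-! ### Recovering the radial derivative from a single ray. -/

section Rays

variable {N : ℕ} {p R : ℝ} {H : EuclideanSpace ℝ (Fin N) → ℝ}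

lemma lintegral_Ioi_comp_div {c : ℝ} (hc : 0 < c) {k : ℝ → ENNReal} (hk : Measurable k) :
    ∫⁻ r in Ioi 0, k (r / c) = ENNReal.ofReal c * ∫⁻ r in Ioi 0, k r := by
  have h1 : ∀ k : ℝ → ENNReal, ∫⁻ r in Ioi 0, k r = ∫⁻ r, (Ioi 0).indicator k r := fun k =>
    (lintegral_indicator measurableSet_Ioi k).symm
  have hm : Measurable ((Ioi (0 : ℝ)).indicator k) := hk.indicator measurableSet_Ioi
  rw [h1, h1]
  conv_rhs => rw [← Real.smul_map_volume_mul_left (inv_ne_zero hc.ne'), lintegral_smul_measure,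
    lintegral_map hm (measurable_const_mul _)]
  rw [smul_eq_mul, ← mul_assoc, ← ENNReal.ofReal_mul hc.le, abs_of_pos (inv_pos.2 hc),
    mul_inv_cancel₀ hc.ne', ENNReal.ofReal_one, one_mul]
  refine lintegral_congr fun r => ?_
  simp only [indicator, mem_Ioi, inv_mul_eq_div, div_pos_iff_of_pos_right hc]

/-- An integrable function on `ℝ^N` is integrable, with the polar weight, along some ray. -/
lemma exists_ray (hN : 2 ≤ N) {h : EuclideanSpace ℝ (Fin N) → ENNReal} (hh : Measurable h)
    (hfin : ∫⁻ y, h y ≠ ⊤) :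
    ∃ θ : EuclideanSpace ℝ (Fin N), θ ≠ 0 ∧
      ∫⁻ r in Ioi (0 : ℝ), ENNReal.ofReal (r ^ ((N : ℝ) - 1)) * h (r • θ) ≠ ⊤ := by
  have hnt : Nontrivial (Fin N) := Fin.nontrivial_iff_two_le.2 hN
  have hmp := (volume : Measure (EuclideanSpace ℝ (Fin N))).measurePreserving_homeomorphUnitSphereProd
  set ν := (volume : Measure (EuclideanSpace ℝ (Fin N))).toSphere with hν
  have hsymm : Measurable fun z : Metric.sphere (0 : EuclideanSpace ℝ (Fin N)) 1 × Ioi (0 : ℝ) =>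
      h (z.2.1 • z.1.1) := by fun_prop
  have e1 : ∫⁻ z, h (z.2.1 • z.1.1) ∂(ν.prod (Measure.volumeIoiPow
      (Module.finrank ℝ (EuclideanSpace ℝ (Fin N)) - 1))) ≤ ∫⁻ y, h y := by
    rw [← hmp.lintegral_comp hsymm]
    calc _ = ∫⁻ y : ({0}ᶜ : Set (EuclideanSpace ℝ (Fin N))), h y
          ∂(Measure.comap Subtype.val volume) := by
          refine lintegral_congr fun y => ?_
          congr 1
          have := (homeomorphUnitSphereProd (EuclideanSpace ℝ (Fin N))).symm_apply_apply y
          exact congrArg Subtype.val this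
      _ = ∫⁻ y in ({0}ᶜ : Set (EuclideanSpace ℝ (Fin N))), h y :=
          lintegral_subtype_comap (measurableSet_singleton _).compl _
      _ ≤ _ := setLIntegral_le_lintegral _ _
  rw [lintegral_prod _ hsymm.aemeasurable] at e1
  have h2 := ae_lt_top hsymm.lintegral_prod_right' (ne_top_of_le_ne_top hfin e1)
  -- By Fubini almost every direction works, and the sphere has nonzero measure, so some direction
  -- does.
  have : NeBot (ae ν) := ae_neBot.2 (Measure.toSphere_ne_zero _)
  obtain ⟨θ, hθ⟩ := h2.exists
  refine ⟨θ.1, fun h0 => ?_, ?_⟩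
  · have := θ.2
    rw [h0] at this
    simp at this
  · refine ne_of_eq_of_ne ?_ hθ.ne
    rw [Measure.volumeIoiPow, lintegral_withDensity_eq_lintegral_mul _ (by fun_prop) (by fun_prop)]
    rw [← lintegral_subtype_comap measurableSet_Ioi]
    refine lintegral_congr fun r => ?_
    simp only [Pi.mul_apply, finrank_euclideanSpace, Fintype.card_fin]
    rw [← Real.rpow_natCast, Nat.cast_sub (by omega), Nat.cast_one]

/-- Rescaling the direction to H⁰(e) = 1 makes the parameter of the ray equal to the dual norm of
the point. -/
lemma IsFinslerNorm.exists_ray (hH : IsFinslerNorm H) (hN : 2 ≤ N)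
    {h : EuclideanSpace ℝ (Fin N) → ENNReal} (hh : Measurable h) (hfin : ∫⁻ y, h y ≠ ⊤) :
    ∃ e : EuclideanSpace ℝ (Fin N), dualNorm H e = 1 ∧
      ∫⁻ r in Ioi (0 : ℝ), ENNReal.ofReal (r ^ ((N : ℝ) - 1)) * h (r • e) ≠ ⊤ := by
  obtain ⟨θ, hθ, hi⟩ := _root_.exists_ray hN hh hfin
  have hc := hH.dualNorm_pos hθ
  set c := dualNorm H θ with hcdef
  refine ⟨c⁻¹ • θ, ?_, ?_⟩
  · rw [hH.dualNorm_smul (inv_pos.2 hc).le, ← hcdef, inv_mul_cancel₀ hc.ne']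
  · have hm : Measurable fun r : ℝ => ENNReal.ofReal (r ^ ((N : ℝ) - 1)) * h (r • θ) := by fun_prop
    have h1 := lintegral_Ioi_comp_div hc hm
    have h2 : ∫⁻ r in Ioi (0 : ℝ), ENNReal.ofReal (r ^ ((N : ℝ) - 1)) * h (r • c⁻¹ • θ) =
        ENNReal.ofReal (c ^ ((N : ℝ) - 1)) *
          ∫⁻ r in Ioi (0 : ℝ), ENNReal.ofReal ((r / c) ^ ((N : ℝ) - 1)) * h ((r / c) • θ) := by
      rw [← lintegral_const_mul _ (by fun_prop)]
      refine setLIntegral_congr_fun measurableSet_Ioi fun r (hr : 0 < r) => ?_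
      rw [← mul_assoc, ← ENNReal.ofReal_mul (by positivity), ← Real.mul_rpow hc.le (by positivity),
        mul_div_cancel₀ _ hc.ne', smul_smul, div_eq_mul_inv]
    rw [h2, h1]
    exact ENNReal.mul_ne_top ENNReal.ofReal_ne_top (ENNReal.mul_ne_top ENNReal.ofReal_ne_top hi)

lemma tendsto_of_enorm_rpow {F : Type*} [NormedAddCommGroup F] {q : ℝ} (hq : 0 < q) {x : ℕ → F}
    {y : F} (h : Tendsto (fun n => ‖x n - y‖ₑ ^ q) atTop (𝓝 0)) : Tendsto x atTop (𝓝 y) := by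
  rw [tendsto_iff_edist_tendsto_0]
  have h2 := (ENNReal.continuous_rpow_const (y := 1 / q)).tendsto 0 |>.comp h
  rw [ENNReal.zero_rpow_of_pos (by positivity)] at h2
  refine h2.congr fun i => ?_
  rw [edist_eq_enorm_sub, Function.comp_apply, ← ENNReal.rpow_mul, mul_one_div_cancel hq.ne',
    ENNReal.rpow_one]

/-- Choose terms below 2^{-n}. Summable errors are what allow one ray to serve the whole
subsequence. -/
lemma exists_subseq_tsum_ne_top {a : ℕ → ENNReal} (ha : Tendsto a atTop (𝓝 0)) :
    ∃ σ : ℕ → ℕ, ∑' n, a (σ n) ≠ ⊤ := by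
  obtain ⟨σ, -, hσ⟩ := extraction_forall_of_eventually
    (P := fun n k => a k ≤ (2⁻¹ : ENNReal) ^ n) fun n =>
      (ha.eventually_le_const (pos_iff_ne_zero.2 (pow_ne_zero n (by simp))))
  refine ⟨σ, ne_top_of_le_ne_top ?_ (ENNReal.tsum_le_tsum hσ)⟩
  rw [ENNReal.tsum_geometric]
  simp

/-- The ray leaves the Wulff ball at parameter R, where the test function vanishes. -/
lemma IsTestFunction.eq_integral_ray (hH : IsFinslerNorm H) {φ : EuclideanSpace ℝ (Fin N) → ℝ}
    (hφ : IsTestFunction (wulffBall H R) φ) (hR : 0 < R) {e : EuclideanSpace ℝ (Fin N)}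
    (he : dualNorm H e = 1) (r : ℝ) :
    φ (r • e) = ∫ s in r..R, -inner ℝ e (gradient φ (s • e)) := by
  have hd : ∀ s : ℝ, HasDerivAt (fun s : ℝ => φ (s • e)) (inner ℝ e (gradient φ (s • e))) s := by
    intro s
    rw [inner_gradient_eq]
    have h1 : HasDerivAt (fun s : ℝ => s • e) e s := by
      simpa using (hasDerivAt_id s).smul_const e
    have h2 : HasFDerivAt φ (fderiv ℝ φ (s • e)) (s • e) :=
      (hφ.contDiff.differentiable (by simp) _).hasFDerivAt
    exact h2.comp_hasDerivAt s h1
  have hc : Continuous fun s : ℝ => inner ℝ e (gradient φ (s • e)) := by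
    have := hφ.continuous_gradient
    fun_prop
  have h0 : φ (R • e) = 0 := hφ.eq_zero (by
    intro (h : dualNorm H (R • e) < R)
    rw [hH.dualNorm_smul hR.le, he, mul_one] at h
    exact lt_irrefl _ h)
  rw [intervalIntegral.integral_neg, intervalIntegral.integral_eq_sub_of_hasDerivAt
    (fun s _ => hd s) (hc.intervalIntegrable _ _), h0, zero_sub, neg_neg]

/-- A Finsler radial function of `W₀^{1,p}` is the primitive of a function with finite energy. -/
theorem IsFinslerNorm.exists_radial_derivative (hH : IsFinslerNorm H) (hN : 2 ≤ N) (hp1 : 1 < p)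
    (hpN : p < N) (hR : 0 < R) {v : EuclideanSpace ℝ (Fin N) → ℝ}
    (hv : MemSobolevZero (wulffBall H R) p v) (hrad : IsFinslerRadial H R v) :
    ∃ f : ℝ → ℝ, Measurable f ∧ radialEnergy N p R (fun r => ‖f r‖ₑ) ≠ ⊤ ∧
      ∀ᵐ y ∂(volume.restrict (wulffBall H R)), v y = ∫ s in dualNorm H y..R, f s := by
  have hp0 : 0 < p := by linarith
  obtain ⟨hvL, g, -, hgL, φ, hφ, h1, h2⟩ := hv
  obtain ⟨V, hV⟩ := hrad
  set Ω := wulffBall H R with hΩdef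
  have hΩm : MeasurableSet Ω := (hH.isOpen_wulffBall R).measurableSet
  set v' := hvL.1.mk v with hv'
  set g' := hgL.1.mk g with hg'
  have hv'm : Measurable v' := hvL.1.stronglyMeasurable_mk.measurable
  have hg'm : Measurable g' := hgL.1.stronglyMeasurable_mk.measurable
  have hvv : v =ᵐ[volume.restrict Ω] v' := hvL.1.ae_eq_mk
  have hgg : g =ᵐ[volume.restrict Ω] g' := hgL.1.ae_eq_mk
  have hφm : ∀ n, Measurable (φ n) := fun n => (hφ n).contDiff.continuous.measurable
  have hφg : ∀ n, Measurable (gradient (φ n)) := fun n => measurable_gradient _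
  rw [tendsto_eLpNorm_ofReal_iff hp1] at h1 h2
  have h1' : Tendsto (fun n => ∫⁻ y in Ω, ‖φ n y - v' y‖ₑ ^ p) atTop (𝓝 0) :=
    h1.congr fun n => lintegral_congr_ae (hvv.mono fun y hy => by simp only [hy])
  have h2' : Tendsto (fun n => ∫⁻ y in Ω, ‖gradient (φ n) y - g' y‖ₑ ^ p) atTop (𝓝 0) :=
    h2.congr fun n => lintegral_congr_ae (hgg.mono fun y hy => by simp only [hy])
  have h12 : Tendsto (fun n => ∫⁻ y in Ω, (‖φ n y - v' y‖ₑ ^ p + ‖gradient (φ n) y - g' y‖ₑ ^ p))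
      atTop (𝓝 0) := by
    have := h1'.add h2'
    rw [add_zero] at this
    refine this.congr fun n => ?_
    rw [lintegral_add_left (by fun_prop)]
  obtain ⟨σ, hσ⟩ := exists_subseq_tsum_ne_top h12
  have hbad : volume {y | y ∈ Ω ∧ v' y ≠ V (dualNorm H y)} = 0 := by
    have : ∀ᵐ y ∂(volume.restrict Ω), v' y = V (dualNorm H y) := by
      filter_upwards [hvv, hV] with y h1 h2
      rw [← h1, h2]
    rw [ae_restrict_iff' hΩm, ae_iff] at this
    convert this using 2
    ext y
    simp
  -- The profile `V` is not assumed measurable, so the exceptional set is first enlarged to a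
  -- measurable null set.
  obtain ⟨B, hBsub, hBm, hB0⟩ := exists_measurable_superset_of_null hbad
  set S : EuclideanSpace ℝ (Fin N) → ENNReal := fun y =>
    ∑' n, (‖φ (σ n) y - v' y‖ₑ ^ p + ‖gradient (φ (σ n)) y - g' y‖ₑ ^ p) with hS
  have hSm : Measurable S := Measurable.tsum fun n => by
    have := hφm (σ n)
    have := hφg (σ n)
    fun_prop
  have hgfin : ∫⁻ y in Ω, ‖g' y‖ₑ ^ p ≠ ⊤ := by
    have h3 := hgL.2
    rw [eLpNorm_ofReal_eq hp1] at h3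
    have h4 := (ENNReal.rpow_lt_top_iff_of_pos (by positivity)).1 h3
    refine ne_of_eq_of_ne (lintegral_congr_ae ?_) h4.ne
    exact hgg.mono fun y hy => by simp only [hy]
  have hSfin : ∫⁻ y in Ω, S y ≠ ⊤ := by
    rw [hS, lintegral_tsum fun n => by
      have := hφm (σ n)
      have := hφg (σ n)
      fun_prop]
    exact hσ
  -- Adding the value ∞ on `B` does not change the integral over space. Finiteness along the chosen
  -- ray then forces the ray to avoid `B` at almost every radius in (0, R), besides controlling the
  -- gradient and all approximation errors.
  obtain ⟨e, he, hray⟩ := hH.exists_ray hN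
    (h := fun y => Ω.indicator (fun y => S y + ‖g' y‖ₑ ^ p) y + B.indicator (fun _ => ⊤) y)
    (by
      have : Measurable fun y => S y + ‖g' y‖ₑ ^ p := by fun_prop
      exact (this.indicator hΩm).add (measurable_const.indicator hBm))
    (by
      rw [lintegral_add_right _ (measurable_const.indicator hBm), lintegral_indicator hΩm,
        lintegral_indicator hBm, lintegral_add_left hSm, setLIntegral_measure_zero _ _ hB0,
        add_zero]
      exact ENNReal.add_ne_top.2 ⟨hSfin, hgfin⟩)
  have hFe : ∀ r, 0 < r → dualNorm H (r • e) = r := fun r hr => by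
    rw [hH.dualNorm_smul hr.le, he, mul_one]
  have hmem : ∀ r ∈ Ioo 0 R, r • e ∈ Ω := fun r hr => by
    change dualNorm H (r • e) < R
    rw [hFe r hr.1]
    exact hr.2
  set w : ℝ → ENNReal := fun r => ENNReal.ofReal (r ^ ((N : ℝ) - 1)) with hwdef
  have hwm : Measurable w := by fun_prop
  have hint : ∫⁻ r in Ioo 0 R, w r * (S (r • e) + ‖g' (r • e)‖ₑ ^ p +
      B.indicator (fun _ => ⊤) (r • e)) ≠ ⊤ := by
    refine ne_top_of_le_ne_top hray (le_trans (le_of_eq ?_)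
      (lintegral_mono_set (s := Ioo 0 R) Ioo_subset_Ioi_self))
    refine setLIntegral_congr_fun measurableSet_Ioo fun r hr => ?_
    simp only [indicator_of_mem (hmem r hr), hwdef]
  have hsm : Measurable fun r : ℝ => r • e := by fun_prop
  have hSem : Measurable fun r : ℝ => S (r • e) := hSm.comp hsm
  have hgem : Measurable fun r : ℝ => g' (r • e) := hg'm.comp hsm
  have hBem : Measurable fun r : ℝ => B.indicator (fun _ => (⊤ : ENNReal)) (r • e) :=
    (measurable_const.indicator hBm).comp hsm
  have hwpos : ∀ r ∈ Ioo 0 R, w r ≠ 0 := fun r hr => by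
    have : 0 < r := hr.1
    exact (ENNReal.ofReal_pos.2 (by positivity)).ne'
  have hae : ∀ᵐ r ∂(volume.restrict (Ioo 0 R)), v' (r • e) = V r ∧ S (r • e) ≠ ⊤ := by
    filter_upwards [ae_lt_top (by fun_prop) hint, ae_restrict_mem measurableSet_Ioo] with r h1 hr
    have h3 : S (r • e) + ‖g' (r • e)‖ₑ ^ p + B.indicator (fun _ => ⊤) (r • e) ≠ ⊤ := fun h => by
      rw [h, ENNReal.mul_top (hwpos r hr)] at h1
      exact lt_irrefl _ h1
    have h4 := ENNReal.add_ne_top.1 h3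
    refine ⟨?_, (ENNReal.add_ne_top.1 h4.1).1⟩
    by_contra hcon
    have : r • e ∈ B := hBsub ⟨hmem r hr, by rwa [hFe r hr.1]⟩
    rw [indicator_of_mem this] at h4
    exact h4.2 rfl
  have hSray : ∑' n, ∫⁻ r in Ioo 0 R, w r * ‖gradient (φ (σ n)) (r • e) - g' (r • e)‖ₑ ^ p ≠ ⊤ := by
    rw [← lintegral_tsum fun n => by
      have := (hφg (σ n)).comp hsm
      fun_prop]
    refine ne_top_of_le_ne_top hint (lintegral_mono fun r => ?_)
    rw [ENNReal.tsum_mul_left]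
    gcongr
    refine le_trans ?_ (le_add_right (le_add_right le_rfl))
    exact ENNReal.tsum_le_tsum fun n => le_add_left le_rfl
  have hgradlim := ENNReal.tendsto_atTop_zero_of_tsum_ne_top hSray
  -- Minus the derivative along the ray, so that integrating from `r` to `R` recovers the function.
  set f : ℝ → ℝ := fun r => -inner ℝ e (g' (r • e)) with hf
  have hfm : Measurable f := by fun_prop
  have hbound : ∀ k : ℝ → EuclideanSpace ℝ (Fin N), Measurable k →
      radialEnergy N p R (fun r => ‖inner ℝ e (k r)‖ₑ) ≤
        ‖e‖ₑ ^ p * ∫⁻ r in Ioo 0 R, w r * ‖k r‖ₑ ^ p := by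
    intro k hk
    rw [← lintegral_const_mul _ (by fun_prop), radialEnergy]
    refine lintegral_mono fun r => ?_
    rw [mul_left_comm, ← ENNReal.mul_rpow_of_nonneg _ _ hp0.le]
    gcongr
    rw [enorm_eq_nnnorm, enorm_eq_nnnorm, enorm_eq_nnnorm]
    exact_mod_cast nnnorm_inner_le_nnnorm (𝕜 := ℝ) e (k r)
  have hep : ‖e‖ₑ ^ p ≠ ⊤ := ENNReal.rpow_ne_top_of_nonneg hp0.le enorm_ne_top
  have hE : radialEnergy N p R (fun r => ‖f r‖ₑ) ≠ ⊤ := by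
    simp only [hf, enorm_neg]
    refine ne_top_of_le_ne_top (ENNReal.mul_ne_top hep ?_) (hbound _ hgem)
    refine ne_top_of_le_ne_top hint (lintegral_mono fun r => ?_)
    gcongr
    exact le_add_right (le_add_left le_rfl)
  refine ⟨f, hfm, hE, ?_⟩
  -- Each test function is the integral of its own ray derivative, and `radial_holder` bounds the
  -- difference by the gradient error on the ray.
  have hconv : ∀ r ∈ Ioo 0 R, Tendsto (fun n => φ (σ n) (r • e)) atTop (𝓝 (∫ s in r..R, f s)) := by
    intro r hr
    refine tendsto_of_enorm_rpow hp0 ?_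
    set C := ENNReal.ofReal ((((N : ℝ) - p) / (p - 1)) ^ (1 - p) * r ^ (p - N)) with hC
    have hlim := ENNReal.Tendsto.mul_const (b := C)
      (ENNReal.Tendsto.const_mul (a := ‖e‖ₑ ^ p) hgradlim (Or.inr hep)) (Or.inr ENNReal.ofReal_ne_top)
    rw [mul_zero, zero_mul] at hlim
    refine tendsto_of_tendsto_of_tendsto_of_le_of_le tendsto_const_nhds hlim
      (fun n => zero_le) fun n => ?_
    have hkm : Measurable fun s : ℝ => gradient (φ (σ n)) (s • e) - g' (s • e) :=
      ((hφg (σ n)).comp hsm).sub hgem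
    have hfi : IntervalIntegrable f volume r R := by
      rw [intervalIntegrable_iff_integrableOn_Ioo_of_le hr.2.le]
      exact integrableOn_of_radialEnergy hp1 hpN hfm hE hr.1
    have hφi : IntervalIntegrable (fun s => -inner ℝ e (gradient (φ (σ n)) (s • e))) volume r R := by
      have := (hφ (σ n)).continuous_gradient
      exact Continuous.intervalIntegrable (by fun_prop) _ _
    dsimp only
    rw [(hφ (σ n)).eq_integral_ray hH hR he, ← intervalIntegral.integral_sub hφi hfi]
    have heq : ∀ s : ℝ, -inner ℝ e (gradient (φ (σ n)) (s • e)) - f s =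
        -inner ℝ e (gradient (φ (σ n)) (s • e) - g' (s • e)) := fun s => by
      rw [hf, inner_sub_right]; ring
    simp only [heq]
    calc _ ≤ (∫⁻ s in Ioo r R, ‖-inner ℝ e (gradient (φ (σ n)) (s • e) - g' (s • e))‖ₑ) ^ p :=
          ENNReal.rpow_le_rpow (enorm_integral_le_lintegral hr.2.le) hp0.le
      _ ≤ _ := radial_holder hp1 hpN (by fun_prop) hr.1
      _ ≤ _ := by
        simp only [enorm_neg]
        gcongr
        exact hbound _ hkm
  -- At almost every radius the test functions converge both to the value of `v`, because the errors
  -- are summable there, and to the primitive of `f`.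
  have hfinal : ∀ᵐ r ∂(volume.restrict (Ioo 0 R)), V r = ∫ s in r..R, f s := by
    filter_upwards [hae, ae_restrict_mem measurableSet_Ioo] with r h hr
    rw [← h.1]
    refine tendsto_nhds_unique (tendsto_of_enorm_rpow hp0 ?_) (hconv r hr)
    refine tendsto_of_tendsto_of_tendsto_of_le_of_le tendsto_const_nhds
      (ENNReal.tendsto_atTop_zero_of_tsum_ne_top h.2) (fun n => zero_le) fun n => ?_
    exact le_add_right le_rfl
  filter_upwards [hV, hH.ae_dualNorm hN hR hfinal] with y h1 h2
  rw [h1, h2]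

end Rays

/-! ### The change of variable onto the half-line. -/

/-- The variable `r^{-β} - R^{-β}`, which maps `(0, R)` onto `(0, ∞)`. -/
def radialCoord (β R r : ℝ) : ℝ := r ^ (-β) - R ^ (-β)

/-- The inverse of `radialCoord`. -/
def radialCoordInv (β R t : ℝ) : ℝ := (t + R ^ (-β)) ^ (-(1 / β))

/-- The radial derivative `f` on `(0, R)`, transported to `(0, ∞)` by `radialCoord`. -/
def radialPullback (β R : ℝ) (f : ℝ → ℝ) (t : ℝ) : ℝ :=
  f (radialCoordInv β R t) * (radialCoordInv β R t ^ (β + 1) / β)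

section ChangeOfVariables

variable {β R : ℝ}

lemma radialCoordInv_radialCoord (hβ : 0 < β) {r : ℝ} (hr : 0 < r) :
    radialCoordInv β R (radialCoord β R r) = r := by
  rw [radialCoordInv, radialCoord, sub_add_cancel, ← Real.rpow_mul hr.le, neg_mul_neg,
    mul_one_div_cancel hβ.ne', Real.rpow_one]

lemma radialCoord_radialCoordInv (hβ : 0 < β) (hR : 0 < R) {t : ℝ} (ht : 0 < t) :
    radialCoord β R (radialCoordInv β R t) = t := by
  rw [radialCoordInv, radialCoord, ← Real.rpow_mul (by positivity), neg_mul_neg,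
    one_div_mul_cancel hβ.ne', Real.rpow_one, add_sub_cancel_right]

lemma radialCoordInv_pos (hR : 0 < R) {t : ℝ} (ht : 0 < t) : 0 < radialCoordInv β R t :=
  Real.rpow_pos_of_pos (by positivity) _

lemma radialCoord_strictAntiOn (hβ : 0 < β) : StrictAntiOn (radialCoord β R) (Ioi 0) :=
  fun _ hr _ _ hrs => sub_lt_sub_right (Real.rpow_lt_rpow_of_neg hr hrs (neg_lt_zero.2 hβ)) _

lemma radialCoord_pos (hβ : 0 < β) {r : ℝ} (hr : r ∈ Ioo 0 R) : 0 < radialCoord β R r :=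
  sub_pos.2 (Real.rpow_lt_rpow_of_neg hr.1 hr.2 (neg_lt_zero.2 hβ))

lemma radialCoordInv_mem (hβ : 0 < β) (hR : 0 < R) {t : ℝ} (ht : 0 < t) :
    radialCoordInv β R t ∈ Ioo 0 R := by
  refine ⟨radialCoordInv_pos hR ht, ?_⟩
  by_contra! hcon
  have h := (radialCoord_strictAntiOn (R := R) hβ).antitoneOn (mem_Ioi.2 hR)
    (mem_Ioi.2 (radialCoordInv_pos (β := β) hR ht)) hcon
  rw [radialCoord_radialCoordInv hβ hR ht, radialCoord, sub_self] at h
  exact not_lt.2 h ht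

lemma image_radialCoord (hβ : 0 < β) (hR : 0 < R) : radialCoord β R '' Ioo 0 R = Ioi 0 := by
  ext t
  refine ⟨?_, fun ht => ⟨_, radialCoordInv_mem hβ hR ht, radialCoord_radialCoordInv hβ hR ht⟩⟩
  rintro ⟨r, hr, rfl⟩
  exact radialCoord_pos hβ hr

lemma image_radialCoord_Ioo (hβ : 0 < β) {ρ : ℝ} (hρ : ρ ∈ Ioo 0 R) :
    radialCoord β R '' Ioo ρ R = Ioo 0 (radialCoord β R ρ) := by
  have hR : 0 < R := hρ.1.trans hρ.2
  have hanti := radialCoord_strictAntiOn (R := R) hβ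
  ext t
  constructor
  · rintro ⟨r, hr, rfl⟩
    have hr0 : 0 < r := hρ.1.trans hr.1
    exact ⟨radialCoord_pos hβ ⟨hr0, hr.2⟩, hanti hρ.1 hr0 hr.1⟩
  · intro ht
    have hm := radialCoordInv_mem hβ hR ht.1
    have he := radialCoord_radialCoordInv hβ hR ht.1
    refine ⟨_, ⟨?_, hm.2⟩, he⟩
    by_contra! hcon
    have h := hanti.antitoneOn (mem_Ioi.2 hm.1) (mem_Ioi.2 hρ.1) hcon
    rw [he] at h
    exact not_lt.2 h ht.2

lemma hasDerivAt_radialCoord {r : ℝ} (hr : 0 < r) :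
    HasDerivAt (radialCoord β R) (-(β * r ^ (-β - 1))) r := by
  rw [← neg_mul]
  exact (Real.hasDerivAt_rpow_const (Or.inl hr.ne')).sub_const _

lemma abs_deriv_radialCoord (hβ : 0 < β) {r : ℝ} (hr : 0 < r) :
    |-(β * r ^ (-β - 1))| = β * r ^ (-β - 1) := by
  rw [abs_neg, abs_of_pos (by positivity)]

lemma integral_Ioi_radialCoord (hβ : 0 < β) (hR : 0 < R) (G : ℝ → ℝ) :
    ∫ t in Ioi 0, G t = ∫ r in Ioo 0 R, β * r ^ (-β - 1) * G (radialCoord β R r) := by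
  rw [← image_radialCoord hβ hR, integral_image_eq_integral_abs_deriv_smul measurableSet_Ioo
    (fun r hr => (hasDerivAt_radialCoord hr.1).hasDerivWithinAt)
    ((radialCoord_strictAntiOn hβ).injOn.mono fun r hr => hr.1)]
  refine setIntegral_congr_fun measurableSet_Ioo fun r hr => ?_
  rw [abs_deriv_radialCoord hβ hr.1, smul_eq_mul]

lemma integrableOn_Ioi_radialCoord (hβ : 0 < β) (hR : 0 < R) (G : ℝ → ℝ) :
    IntegrableOn G (Ioi 0) ↔
      IntegrableOn (fun r => β * r ^ (-β - 1) * G (radialCoord β R r)) (Ioo 0 R) := by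
  rw [← image_radialCoord hβ hR, integrableOn_image_iff_integrableOn_abs_deriv_smul
    measurableSet_Ioo (fun r hr => (hasDerivAt_radialCoord hr.1).hasDerivWithinAt)
    ((radialCoord_strictAntiOn hβ).injOn.mono fun r hr => hr.1)]
  refine integrableOn_congr_fun (fun r hr => ?_) measurableSet_Ioo
  rw [abs_deriv_radialCoord hβ hr.1, smul_eq_mul]

/-- The coordinate is decreasing and sends R to 0. Integrating outward from t = 0 thus matches
integrating from `r` up to R, and with the absolute value of the Jacobian no sign appears in the
pullback. -/
lemma deriv_mul_radialPullback (hβ : 0 < β) (f : ℝ → ℝ) {r : ℝ} (hr : 0 < r) :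
    β * r ^ (-β - 1) * radialPullback β R f (radialCoord β R r) = f r := by
  rw [radialPullback, radialCoordInv_radialCoord hβ hr]
  have : r ^ (-β - 1) * r ^ (β + 1) = 1 := by
    rw [← Real.rpow_add hr]; ring_nf; exact Real.rpow_zero r
  field_simp
  linear_combination f r * this

lemma integral_radialPullback (hβ : 0 < β) (f : ℝ → ℝ) {r : ℝ} (hr : r ∈ Ioo 0 R) :
    ∫ t in (0 : ℝ)..radialCoord β R r, radialPullback β R f t = ∫ s in r..R, f s := by
  rw [intervalIntegral.integral_of_le (radialCoord_pos hβ hr).le,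
    intervalIntegral.integral_of_le hr.2.le, integral_Ioc_eq_integral_Ioo,
    integral_Ioc_eq_integral_Ioo, ← image_radialCoord_Ioo hβ hr,
    integral_image_eq_integral_abs_deriv_smul measurableSet_Ioo
    (fun s hs => (hasDerivAt_radialCoord (hr.1.trans hs.1)).hasDerivWithinAt)
    ((radialCoord_strictAntiOn hβ).injOn.mono fun s hs => hr.1.trans hs.1)]
  refine setIntegral_congr_fun measurableSet_Ioo fun s hs => ?_
  have hs0 : 0 < s := hr.1.trans hs.1
  rw [abs_deriv_radialCoord hβ hs0, smul_eq_mul, deriv_mul_radialPullback hβ f hs0]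

lemma measurable_radialPullback {f : ℝ → ℝ} (hf : Measurable f) :
    Measurable (radialPullback β R f) := by
  have : Measurable (radialCoordInv β R) := by unfold radialCoordInv; fun_prop
  unfold radialPullback
  fun_prop

/-- The integrand of the energy under the change of variables. -/
lemma deriv_mul_abs_radialPullback_rpow (hβ : 0 < β) (f : ℝ → ℝ) {p r : ℝ} (hr : 0 < r) :
    β * r ^ (-β - 1) * |radialPullback β R f (radialCoord β R r)| ^ p =
      β ^ (1 - p) * (r ^ ((β + 1) * (p - 1)) * |f r| ^ p) := by
  rw [radialPullback, radialCoordInv_radialCoord hβ hr, abs_mul,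
    abs_of_pos (show 0 < r ^ (β + 1) / β by positivity), Real.mul_rpow (abs_nonneg _) (by positivity), Real.div_rpow (by positivity) hβ.le,
    ← Real.rpow_mul hr.le]
  have e1 : r ^ ((β + 1) * (p - 1)) = r ^ (-β - 1) * r ^ ((β + 1) * p) := by
    rw [← Real.rpow_add hr]; congr 1; ring
  rw [e1, Real.rpow_sub hβ, Real.rpow_one]
  ring

/-- The integrand of the critical term under the change of variables. -/
lemma deriv_mul_blissWeight (hβ : 0 < β) {p α m : ℝ}
    (h1 : (p * (1 + α) - α) * β - β - 1 = m) (u : ℝ → ℝ) {r : ℝ} (hr : r ∈ Ioo 0 R) :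
    β * r ^ (-β - 1) * blissWeight p α u (radialCoord β R r) =
      β * (r ^ m * (u (radialCoord β R r) ^ (p * (1 + α)) /
        (1 - (r / R) ^ β) ^ (p * (1 + α) - α))) := by
  have hr0 : 0 < r := hr.1
  have hR : 0 < R := hr0.trans hr.2
  -- This factorization produces the singular weight: a negative power of the coordinate splits into
  -- a power of `r` and a power of 1 - (r/R)^β.
  have hfac : radialCoord β R r = r ^ (-β) * (1 - (r / R) ^ β) := by
    rw [radialCoord, Real.div_rpow hr0.le hR.le, Real.rpow_neg hr0.le, Real.rpow_neg hR.le]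
    have := Real.rpow_pos_of_pos hr0 β
    have := Real.rpow_pos_of_pos hR β
    field_simp
  have hX : 0 < 1 - (r / R) ^ β := by
    have := radialCoord_pos hβ hr
    rw [hfac] at this
    exact pos_of_mul_pos_right this (by positivity)
  have e1 : radialCoord β R r ^ (α - p * (1 + α)) =
      r ^ (-β * (α - p * (1 + α))) * ((1 - (r / R) ^ β) ^ (p * (1 + α) - α))⁻¹ := by
    rw [hfac, Real.mul_rpow (by positivity) hX.le, ← Real.rpow_mul hr0.le, ← Real.rpow_neg hX.le,
      neg_sub]
  have e2 : r ^ m = r ^ (-β - 1) * r ^ (-β * (α - p * (1 + α))) := by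
    rw [← Real.rpow_add hr0, ← h1]; congr 1; ring
  rw [blissWeight, e1, e2]
  ring

end ChangeOfVariables

/-! ### Identification of the constants. -/

lemma sphereArea_eq {N : ℕ} (hN : 2 ≤ N) :
    sphereArea N = N * Real.pi ^ ((N : ℝ) / 2) / Real.Gamma (1 + N / 2) := by
  have : Nonempty (Fin N) := ⟨⟨0, by omega⟩⟩
  rw [sphereArea, Measure.toSphere_real_apply_univ, finrank_euclideanSpace, Fintype.card_fin,
    measureReal_def, EuclideanSpace.volume_ball, Fintype.card_fin]
  simp only [ENNReal.ofReal_one, one_pow, one_mul]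
  rw [ENNReal.toReal_ofReal (by
    have := Real.Gamma_pos_of_pos (show (0 : ℝ) < N / 2 + 1 by positivity)
    positivity), add_comm (1 : ℝ), Real.sqrt_eq_rpow, ← Real.rpow_natCast, ← Real.rpow_mul
    Real.pi_pos.le, one_div_mul_eq_div, mul_div_assoc]

/-- For α = p/(N-p) the beta value in Bliss' constant is Γ(N/p')Γ(N/p)/Γ(N). The remaining factors
in π, Γ(1+N/2) and the sphere area cancel by the volume formula for the Euclidean ball; κ enters
only through the polar Jacobian. -/
lemma finslerSobolevConst_eq {N : ℕ} {H : EuclideanSpace ℝ (Fin N) → ℝ} (hN : 2 ≤ N) {p : ℝ}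
    (hp1 : 1 < p) (hpN : p < N) (hκ : 0 < wulffVolume H) :
    finslerSobolevConst H p *
        (N * wulffVolume H * (((N : ℝ) - p) / (p - 1))⁻¹) ^ (p / sobolevExponent N p) =
      N * wulffVolume H * (((N : ℝ) - p) / (p - 1)) ^ (p - 1) * blissConst p (p / (N - p)) := by
  have hp0 : 0 < p := by linarith
  have hp10 : 0 < p - 1 := by linarith
  have hNp : 0 < (N : ℝ) - p := by linarith
  have hN0 : (0 : ℝ) < N := by linarith
  set β := ((N : ℝ) - p) / (p - 1) with hβdef
  have hβ : 0 < β := by positivity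
  set θ := p / (N : ℝ) with hθ
  have hpq : p / sobolevExponent N p = 1 - θ := by
    rw [sobolevExponent, hθ]; field_simp
  have hα1 : 1 + p / ((N : ℝ) - p) = N / (N - p) := by field_simp; ring
  set G1 := Real.Gamma (N / p) with hG1d
  set G2 := Real.Gamma (N / (p / (p - 1))) with hG2d
  set G3 := Real.Gamma (N : ℝ) with hG3d
  set G4 := Real.Gamma (1 + (N : ℝ) / 2) with hG4d
  have hG1 : 0 < G1 := Real.Gamma_pos_of_pos (by positivity)
  have hG2 : 0 < G2 := Real.Gamma_pos_of_pos (by positivity)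
  have hG3 : 0 < G3 := Real.Gamma_pos_of_pos hN0
  have hG4 : 0 < G4 := Real.Gamma_pos_of_pos (by positivity)
  have hG2' : Real.Gamma (1 + N / (p / (p - 1))) = N / (p / (p - 1)) * G2 := by
    rw [add_comm, Real.Gamma_add_one (by positivity)]
  have hbliss : blissConst p (p / (N - p)) =
      N / β * (G2 * G1 / G3 / (p / (N - p))) ^ θ := by
    rw [blissConst, hα1]
    have e1 : (N : ℝ) / (N - p) / (p / (N - p)) = N / p := by field_simp
    have e2 : p / ((N : ℝ) - p) / (N / (N - p)) = θ := by rw [hθ]; field_simp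
    have e3 : (p - 1) * ((N : ℝ) / p) = N / (p / (p - 1)) := by field_simp
    have e4 : (N : ℝ) / (p / (p - 1)) + N / p = N := by field_simp; ring
    rw [e1, e2, e3, ProbabilityTheory.beta, e4]
    congr 1
    rw [hβdef]; field_simp
  have hS : sobolevConst N p = Real.pi ^ (p / 2) * N * β ^ (p - 1) *
      (G1 * (N / (p / (p - 1)) * G2) / (G3 * G4)) ^ θ := by
    rw [sobolevConst, hG2']
  have hπ := Real.pi_pos
  rw [finslerSobolevConst, hpq, hS, hbliss, sphereArea_eq hN, ← hG4d]
  set A := (N : ℝ) * wulffVolume H with hA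
  have hA0 : 0 < A := by positivity
  -- Since θ = p/N, the power -θ of the sphere area yields exactly the inverse of the factor π^{p/2}
  -- in the Sobolev constant.
  have e5 : (N * Real.pi ^ ((N : ℝ) / 2) / G4 / A) ^ (1 - θ - 1) =
      ((N : ℝ) ^ θ)⁻¹ * (Real.pi ^ (p / 2))⁻¹ * G4 ^ θ * A ^ θ := by
    rw [show 1 - θ - 1 = -θ by ring, Real.rpow_neg (by positivity),
      Real.div_rpow (by positivity) hA0.le, Real.div_rpow (by positivity) hG4.le,
      Real.mul_rpow hN0.le (by positivity), ← Real.rpow_mul hπ.le]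
    have : (N : ℝ) / 2 * θ = p / 2 := by rw [hθ]; field_simp
    rw [this]
    have := Real.rpow_pos_of_pos hN0 θ
    have := Real.rpow_pos_of_pos hG4 θ
    have := Real.rpow_pos_of_pos hA0 θ
    have := Real.rpow_pos_of_pos hπ (p / 2)
    field_simp
  have e6 : (A * β⁻¹) ^ (1 - θ) = A * β⁻¹ * (A ^ θ)⁻¹ * β ^ θ := by
    rw [Real.rpow_sub (by positivity), Real.rpow_one, Real.mul_rpow hA0.le (by positivity),
      Real.inv_rpow hβ.le]
    have := Real.rpow_pos_of_pos hβ θ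
    have := Real.rpow_pos_of_pos hA0 θ
    field_simp
  have e7 : (G1 * (N / (p / (p - 1)) * G2) / (G3 * G4)) ^ θ =
      (G2 * G1 / G3 / (p / (N - p))) ^ θ * (N : ℝ) ^ θ * (G4 ^ θ)⁻¹ * (β ^ θ)⁻¹ := by
    rw [← Real.inv_rpow hG4.le, ← Real.inv_rpow hβ.le, ← Real.mul_rpow (by positivity) (by positivity),
      ← Real.mul_rpow (by positivity) (by positivity), ← Real.mul_rpow (by positivity) (by positivity)]
    congr 1
    rw [hβdef]; field_simp
  rw [e5, e6, e7]
  have := Real.rpow_pos_of_pos hN0 θ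
  have := Real.rpow_pos_of_pos hG4 θ
  have := Real.rpow_pos_of_pos hβ θ
  have := Real.rpow_pos_of_pos hA0 θ
  have := Real.rpow_pos_of_pos hπ (p / 2)
  field_simp

/-! ### Translation of the energy and the critical integral to one variable. -/

section Radial

variable {N : ℕ} {p R : ℝ} {H : EuclideanSpace ℝ (Fin N) → ℝ}

lemma radialEnergy_ne_top_iff (hp0 : 0 < p) {f : ℝ → ℝ} (hf : Measurable f) :
    radialEnergy N p R (fun r => ‖f r‖ₑ) ≠ ⊤ ↔
      IntegrableOn (fun r => r ^ ((N : ℝ) - 1) * |f r| ^ p) (Ioo 0 R) := by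
  have hm : Measurable fun r => r ^ ((N : ℝ) - 1) * |f r| ^ p := by fun_prop
  have he : radialEnergy N p R (fun r => ‖f r‖ₑ) =
      ∫⁻ r in Ioo 0 R, ‖r ^ ((N : ℝ) - 1) * |f r| ^ p‖ₑ := by
    refine setLIntegral_congr_fun measurableSet_Ioo fun r hr => ?_
    have hr0 : 0 < r := hr.1
    rw [enorm_mul, Real.enorm_eq_ofReal (by positivity), Real.enorm_eq_ofReal (by positivity),
      ← ENNReal.ofReal_rpow_of_nonneg (abs_nonneg _) hp0.le, ← Real.enorm_eq_ofReal_abs]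
  rw [he, ← lt_top_iff_ne_top]
  exact ⟨fun h => ⟨hm.aestronglyMeasurable, h⟩, fun h => h.2⟩

lemma HasWeakGradient.congr {Ω : Set (EuclideanSpace ℝ (Fin N))}
    {v v' : EuclideanSpace ℝ (Fin N) → ℝ}
    {g : EuclideanSpace ℝ (Fin N) → EuclideanSpace ℝ (Fin N)} (h : HasWeakGradient Ω v g)
    (hv : v =ᵐ[volume.restrict Ω] v') (hi : LocallyIntegrableOn v' Ω) :
    HasWeakGradient Ω v' g := by
  refine ⟨hi, h.locallyIntegrableOn_grad, fun φ hφ => ?_⟩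
  rw [← h.integral_eq φ hφ]
  exact integral_congr_ae (hv.mono fun x hx => by simp only [hx])

lemma MemSobolevZero.congr {Ω : Set (EuclideanSpace ℝ (Fin N))} (hfin : volume Ω < ⊤)
    (hp1 : 1 < p) {v v' : EuclideanSpace ℝ (Fin N) → ℝ} (h : MemSobolevZero Ω p v)
    (hv : v =ᵐ[volume.restrict Ω] v') : MemSobolevZero Ω p v' := by
  have : IsFiniteMeasure (volume.restrict Ω) := ⟨by simpa using hfin⟩
  obtain ⟨hL, g, hw, hg, φ, hφ, h1, h2⟩ := h
  have hL' := hL.ae_eq hv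
  have hp : 1 ≤ ENNReal.ofReal p := by
    rw [← ENNReal.ofReal_one]; exact ENNReal.ofReal_le_ofReal hp1.le
  have hi : IntegrableOn v' Ω := hL'.integrable hp
  refine ⟨hL', g, hw.congr hv hi.locallyIntegrableOn, hg, φ, hφ, h1.congr fun n => ?_, h2⟩
  exact eLpNorm_congr_ae (hv.mono fun x hx => by simp only [hx])

namespace IsFinslerNorm

/-- On a Wulff ball the dual norm is a.e. in `(0, R)`. -/
lemma ae_dualNorm_mem (hH : IsFinslerNorm H) (hN : 2 ≤ N) (hR : 0 < R) :
    ∀ᵐ y ∂(volume.restrict (wulffBall H R)), dualNorm H y ∈ Ioo 0 R :=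
  hH.ae_dualNorm hN hR (ae_restrict_mem measurableSet_Ioo)

/-- Homogeneity and the eikonal equation, valid off the origin wherever H⁰ is differentiable, hence
almost everywhere. -/
lemma ae_dualNorm_eikonal (hH : IsFinslerNorm H) (hN : 2 ≤ N) (f : ℝ → ℝ) :
    ∀ᵐ y, H (-f (dualNorm H y) • gradient (dualNorm H) y) = |f (dualNorm H y)| := by
  obtain ⟨K, hK⟩ := hH.exists_lipschitzWith
  have hnt : Nontrivial (Fin N) := Fin.nontrivial_iff_two_le.2 hN
  have hne : ∀ᵐ y : EuclideanSpace ℝ (Fin N), y ≠ 0 := by simp [ae_iff]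
  filter_upwards [hK.ae_differentiableAt, hne] with y hy h0
  rw [hH.homogeneous, hH.eikonal h0 hy, mul_one, abs_neg]

/-- The exponent β is fixed by (β+1)(p-1) = N-1, for which the polar weight and the Jacobian of the
coordinate cancel. -/
lemma integral_abs_rpow_dualNorm (hH : IsFinslerNorm H) (hN : 2 ≤ N) (hp1 : 1 < p)
    (hpN : p < N) (hR : 0 < R) {f : ℝ → ℝ} (hf : Measurable f) :
    ∫ y in wulffBall H R, |f (dualNorm H y)| ^ p =
      N * wulffVolume H * (((N : ℝ) - p) / (p - 1)) ^ (p - 1) *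
        ∫ t in Ioi 0, |radialPullback (((N : ℝ) - p) / (p - 1)) R f t| ^ p := by
  have hp10 : 0 < p - 1 := by linarith
  set β := ((N : ℝ) - p) / (p - 1) with hβdef
  have hβ : 0 < β := div_pos (by linarith) hp10
  have hm : Measurable fun r => |f r| ^ p := by fun_prop
  rw [hH.integral_dualNorm hN hR hm.aestronglyMeasurable, integral_Ioi_radialCoord hβ hR,
    ← integral_const_mul]
  refine setIntegral_congr_fun measurableSet_Ioo fun r hr => ?_
  have e : (β + 1) * (p - 1) = N - 1 := by rw [hβdef]; field_simp; ring
  have hb : β ^ (p - 1) * β ^ (1 - p) = 1 := by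
    rw [← Real.rpow_add hβ, sub_add_sub_cancel, sub_self, Real.rpow_zero]
  simp only [deriv_mul_abs_radialPullback_rpow hβ f hr.1, e]
  linear_combination (-(N * wulffVolume H * r ^ ((N : ℝ) - 1) * |f r| ^ p)) * hb

lemma integrableOn_radialPullback (hp1 : 1 < p) (hpN : p < N) (hR : 0 < R) {f : ℝ → ℝ}
    (hf : Measurable f) :
    IntegrableOn (fun t => |radialPullback (((N : ℝ) - p) / (p - 1)) R f t| ^ p) (Ioi 0) ↔
      radialEnergy N p R (fun r => ‖f r‖ₑ) ≠ ⊤ := by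
  have hp10 : 0 < p - 1 := by linarith
  set β := ((N : ℝ) - p) / (p - 1) with hβdef
  have hβ : 0 < β := div_pos (by linarith) hp10
  rw [radialEnergy_ne_top_iff (by linarith) hf, integrableOn_Ioi_radialCoord hβ hR]
  have e : (β + 1) * (p - 1) = N - 1 := by rw [hβdef]; field_simp; ring
  rw [integrableOn_congr_fun (g := fun r => β ^ (1 - p) * (r ^ ((N : ℝ) - 1) * |f r| ^ p))
    (fun r hr => by simp only [deriv_mul_abs_radialPullback_rpow hβ f hr.1, e]) measurableSet_Ioo]
  exact integrable_const_mul_iff (IsUnit.mk0 _ (Real.rpow_pos_of_pos hβ _).ne') _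

/-- The critical integral in the variable `radialCoord`. -/
lemma integral_critical (hH : IsFinslerNorm H) (hN : 2 ≤ N) (hp1 : 1 < p) (hpN : p < N)
    (hR : 0 < R) {V u : ℝ → ℝ} (hV : ContinuousOn V (Ioo 0 R))
    (hu : ∀ r ∈ Ioo 0 R, u (radialCoord (((N : ℝ) - p) / (p - 1)) R r) = V r)
    (hi : IntegrableOn (blissWeight p (p / (N - p)) (fun t => |u t|)) (Ioi 0)) :
    IntegrableOn (fun y => |V (dualNorm H y)| ^ sobolevExponent N p / finslerWeight H p R y)
        (wulffBall H R) ∧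
      ∫ y in wulffBall H R, |V (dualNorm H y)| ^ sobolevExponent N p / finslerWeight H p R y =
        N * wulffVolume H * (((N : ℝ) - p) / (p - 1))⁻¹ *
          ∫ t in Ioi 0, blissWeight p (p / (N - p)) (fun t => |u t|) t := by
  have hp10 : 0 < p - 1 := by linarith
  have hNp : 0 < (N : ℝ) - p := by linarith
  set β := ((N : ℝ) - p) / (p - 1) with hβdef
  have hβ : 0 < β := div_pos (by linarith) hp10
  set α := p / ((N : ℝ) - p) with hα
  -- The value of α is dictated by three exponents at once: p* on the function, that of the singular
  -- weight, and N-1 on the radius.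
  have hq : sobolevExponent N p = p * (1 + α) := by
    rw [sobolevExponent, hα]; field_simp; ring
  have hw : p * ((N : ℝ) - 1) / (N - p) = p * (1 + α) - α := by rw [hα]; field_simp; ring
  have hm : (p * (1 + α) - α) * β - β - 1 = (N : ℝ) - 1 := by
    rw [hα, hβdef]; field_simp; ring
  set h : ℝ → ℝ := fun r => |V r| ^ (p * (1 + α)) / (1 - (r / R) ^ β) ^ (p * (1 + α) - α) with hh
  have hhm : AEStronglyMeasurable h (volume.restrict (Ioo 0 R)) := by
    have h1 : AEMeasurable V (volume.restrict (Ioo 0 R)) := hV.aemeasurable measurableSet_Ioo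
    have h2 : Measurable fun r : ℝ => (1 - (r / R) ^ β) ^ (p * (1 + α) - α) := by fun_prop
    exact ((h1.abs.pow_const _).div h2.aemeasurable).aestronglyMeasurable
  have hkey : ∀ r ∈ Ioo 0 R,
      β * r ^ (-β - 1) * blissWeight p α (fun t => |u t|) (radialCoord β R r) =
        β * (r ^ ((N : ℝ) - 1) * h r) := fun r hr => by
    rw [deriv_mul_blissWeight hβ hm _ hr, hu r hr]
  have hfun : (fun y => |V (dualNorm H y)| ^ sobolevExponent N p / finslerWeight H p R y) =
      fun y => h (dualNorm H y) := by
    funext y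
    rw [finslerWeight, hq, hw]
  rw [hfun]
  constructor
  · rw [hH.integrable_dualNorm_iff hN hR hhm]
    rw [integrableOn_Ioi_radialCoord hβ hR] at hi
    have h3 := Integrable.const_mul hi (N * wulffVolume H * β⁻¹)
    refine IntegrableOn.congr_fun (f := fun r => N * wulffVolume H * β⁻¹ *
      (β * r ^ (-β - 1) * blissWeight p α (fun t => |u t|) (radialCoord β R r))) h3
      (fun r hr => ?_) measurableSet_Ioo
    simp only [hkey r hr]
    field_simp
  · rw [hH.integral_dualNorm hN hR hhm, integral_Ioi_radialCoord hβ hR, ← integral_const_mul]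
    refine setIntegral_congr_fun measurableSet_Ioo fun r hr => ?_
    simp only [hkey r hr]
    field_simp

/-- The three exponents of the profile are -β, -α and -1/α. -/
lemma finslerProfile_eq (hpN : p < N) (a b : ℝ) (y : EuclideanSpace ℝ (Fin N)) :
    finslerProfile H p R a b y =
      blissExtremal (p / (N - p)) a b (radialCoord (((N : ℝ) - p) / (p - 1)) R (dualNorm H y)) := by
  have hNp : (N : ℝ) - p ≠ 0 := by linarith
  have hpN' : p - (N : ℝ) ≠ 0 := by linarith
  have e1 : (p - (N : ℝ)) / (p - 1) = -(((N : ℝ) - p) / (p - 1)) := by ring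
  have e2 : p / (p - (N : ℝ)) = -(p / ((N : ℝ) - p)) := by rw [← neg_sub (N : ℝ) p, div_neg]
  have e3 : (p - (N : ℝ)) / p = -(1 / (p / ((N : ℝ) - p))) := by rw [one_div_div]; ring
  rw [finslerProfile, blissExtremal, radialCoord, e1, e2, e3]

lemma continuousOn_blissExtremal_radialCoord {α β a b : ℝ} (hβ : 0 < β) (ha : 0 < a)
    (hb : 0 < b) :
    ContinuousOn (fun r => blissExtremal α a b (radialCoord β R r)) (Ioo 0 R) := by
  have h1 : ContinuousOn (radialCoord β R) (Ioo 0 R) := fun r hr =>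
    (hasDerivAt_radialCoord hr.1).continuousAt.continuousWithinAt
  have h2 : ∀ r ∈ Ioo 0 R, 0 < radialCoord β R r ^ (-α) := fun r hr =>
    Real.rpow_pos_of_pos (radialCoord_pos hβ hr) _
  refine ContinuousOn.rpow_const (continuousOn_const.add (continuousOn_const.mul
    (h1.rpow_const fun r hr => Or.inl (radialCoord_pos hβ hr).ne'))) fun r hr => Or.inl ?_
  have := h2 r hr
  positivity

/-- Both sides are continuous in the radius, so almost everywhere equality in the ball is equality
at every radius. -/
lemma forall_eq_iff_ae_eq (hH : IsFinslerNorm H) (hN : 2 ≤ N) (hR : 0 < R) {β : ℝ} (hβ : 0 < β)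
    {V u E : ℝ → ℝ} (hV : ContinuousOn V (Ioo 0 R))
    (hu : ∀ r ∈ Ioo 0 R, u (radialCoord β R r) = V r)
    (hE : ContinuousOn (fun r => E (radialCoord β R r)) (Ioo 0 R))
    {v : EuclideanSpace ℝ (Fin N) → ℝ}
    (hv : ∀ᵐ y ∂(volume.restrict (wulffBall H R)), v y = V (dualNorm H y)) :
    (∀ t > 0, u t = E t) ↔
      ∀ᵐ y ∂(volume.restrict (wulffBall H R)), v y = E (radialCoord β R (dualNorm H y)) := by
  constructor
  · intro h
    filter_upwards [hv, hH.ae_dualNorm_mem hN hR] with y h1 h2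
    rw [h1, ← hu _ h2, h _ (radialCoord_pos hβ h2)]
  · intro h t ht
    have heq := hH.eqOn_of_ae_eq_dualNorm hN hV hE (by
      filter_upwards [hv, h] with y h1 h2
      rw [← h1, ← h2])
    have hm := radialCoordInv_mem hβ hR ht
    have : V (radialCoordInv β R t) = E (radialCoord β R (radialCoordInv β R t)) := heq hm
    rw [← hu _ hm] at this
    rwa [radialCoord_radialCoordInv hβ hR ht] at this

end IsFinslerNorm

end Radial

/-! ### Assembly. -/

section Main

variable {N : ℕ} {p R : ℝ} {H : EuclideanSpace ℝ (Fin N) → ℝ}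

/-- The Sobolev inequality and its equality case for Finsler radial functions. -/
theorem IsFinslerNorm.radial_sobolev (hH : IsFinslerNorm H) (hN : 2 ≤ N) (hp1 : 1 < p)
    (hpN : p < N) (hR : 0 < R) {v : EuclideanSpace ℝ (Fin N) → ℝ}
    {g : EuclideanSpace ℝ (Fin N) → EuclideanSpace ℝ (Fin N)}
    (hv : MemSobolevZero (wulffBall H R) p v) (hrad : IsFinslerRadial H R v)
    (hg : HasWeakGradient (wulffBall H R) v g) :
    IntegrableOn (fun y => |v y| ^ sobolevExponent N p / finslerWeight H p R y)
        (wulffBall H R) volume ∧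
      IntegrableOn (fun y => H (g y) ^ p) (wulffBall H R) volume ∧
      finslerSobolevConst H p *
          (∫ y in wulffBall H R, |v y| ^ sobolevExponent N p / finslerWeight H p R y) ^
            (p / sobolevExponent N p)
        ≤ ∫ y in wulffBall H R, H (g y) ^ p ∧
      (¬ (∀ᵐ y ∂(volume.restrict (wulffBall H R)), v y = 0) →
        (finslerSobolevConst H p *
            (∫ y in wulffBall H R, |v y| ^ sobolevExponent N p / finslerWeight H p R y) ^
              (p / sobolevExponent N p)
          = ∫ y in wulffBall H R, H (g y) ^ p ↔
        ∃ a b : ℝ, 0 < a ∧ 0 < b ∧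
          ((∀ᵐ y ∂(volume.restrict (wulffBall H R)), v y = finslerProfile H p R a b y) ∨
           (∀ᵐ y ∂(volume.restrict (wulffBall H R)), v y = -finslerProfile H p R a b y)))) := by
  have hp0 : 0 < p := by linarith
  have hp10 : 0 < p - 1 := by linarith
  have hNp : 0 < (N : ℝ) - p := by linarith
  have hN0 : (0 : ℝ) < N := by linarith
  have hκ := hH.wulffVolume_pos
  obtain ⟨f, hf, hE, hvf⟩ := hH.exists_radial_derivative hN hp1 hpN hR hv hrad
  obtain ⟨-, hw0⟩ := hH.memSobolevZero_radial hN hp1 hpN hR hf hE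
  -- The given weak gradient is arbitrary; uniqueness identifies it with the radial one.
  have hgg := (hg.congr hvf hw0.locallyIntegrableOn).ae_eq (hH.isOpen_wulffBall R) hw0
  set V : ℝ → ℝ := fun r => ∫ s in r..R, f s with hV
  have hVc : ContinuousOn V (Ioo 0 R) := continuousOn_integral_left fun r hr =>
    integrableOn_of_radialEnergy hp1 hpN hf hE hr
  have hHg : (fun y => H (g y) ^ p) =ᵐ[volume.restrict (wulffBall H R)]
      fun y => |f (dualNorm H y)| ^ p := by
    filter_upwards [hgg, ae_restrict_of_ae (hH.ae_dualNorm_eikonal hN f)] with y h1 h2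
    rw [h1, h2]
  have hvV : (fun y => |v y| ^ sobolevExponent N p / finslerWeight H p R y)
      =ᵐ[volume.restrict (wulffBall H R)]
      fun y => |V (dualNorm H y)| ^ sobolevExponent N p / finslerWeight H p R y := by
    filter_upwards [hvf] with y h1
    rw [h1]
  rw [integral_congr_ae hHg, integral_congr_ae hvV, hH.integral_abs_rpow_dualNorm hN hp1 hpN hR hf,
    IntegrableOn, IntegrableOn, integrable_congr hHg, integrable_congr hvV]
  have hfint : IntegrableOn (fun y => |f (dualNorm H y)| ^ p) (wulffBall H R) := by
    have hm : Measurable fun r => |f r| ^ p := by fun_prop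
    rw [hH.integrable_dualNorm_iff hN hR hm.aestronglyMeasurable]
    have := ((radialEnergy_ne_top_iff hp0 hf).1 hE).const_mul (N * wulffVolume H)
    simpa only [mul_assoc, IntegrableOn] using this
  have hpull := (IsFinslerNorm.integrableOn_radialPullback hp1 hpN hR hf).2 hE
  set β := ((N : ℝ) - p) / (p - 1) with hβdef
  have hβ : 0 < β := by positivity
  set α := p / ((N : ℝ) - p) with hαdef
  have hα : 0 < α := by positivity
  obtain ⟨hB1, hB2, hB3⟩ := bliss_inequality hp1 hα
    (measurable_radialPullback (β := β) (R := R) hf).aestronglyMeasurable hpull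
  set u : ℝ → ℝ := fun t => ∫ s in (0 : ℝ)..t, radialPullback β R f s with hu
  have huV : ∀ r ∈ Ioo 0 R, u (radialCoord β R r) = V r := fun r hr =>
    integral_radialPullback hβ f hr
  obtain ⟨hC1, hC2⟩ := hH.integral_critical hN hp1 hpN hR hVc huV hB1
  have hpq : p / sobolevExponent N p = 1 / (1 + α) := by
    rw [sobolevExponent, hαdef]; field_simp; ring
  have hconst := finslerSobolevConst_eq hN hp1 hpN hκ
  rw [← hβdef, ← hαdef, hpq] at hconst
  set J := ∫ t in Ioi 0, blissWeight p α (fun t => |u t|) t with hJ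
  have hJ0 : 0 ≤ J := setIntegral_nonneg measurableSet_Ioi fun t (ht : 0 < t) => by
    rw [blissWeight]; positivity
  set D := N * wulffVolume H * β ^ (p - 1) with hD
  have hD0 : 0 < D := by positivity
  have hL : finslerSobolevConst H p *
      (N * wulffVolume H * β⁻¹ * J) ^ (1 / (1 + α)) = D * (blissConst p α * J ^ (1 / (1 + α))) := by
    rw [Real.mul_rpow (by positivity) hJ0, ← mul_assoc, hconst, mul_assoc]
  rw [hC2, hpq, hL]
  refine ⟨hC1, hfint, mul_le_mul_of_nonneg_left hB2 hD0.le, fun hne => ?_⟩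
  rw [mul_right_inj' hD0.ne', hB3 ?_]
  · refine exists_congr fun a => exists_congr fun b => and_congr_right fun ha =>
      and_congr_right fun hb => ?_
    have hEc := IsFinslerNorm.continuousOn_blissExtremal_radialCoord (α := α) (R := R) hβ ha hb
    simp only [IsFinslerNorm.finslerProfile_eq hpN]
    exact or_congr (hH.forall_eq_iff_ae_eq hN hR hβ hVc huV hEc hvf)
      (hH.forall_eq_iff_ae_eq (E := fun t => -blissExtremal α a b t) hN hR hβ hVc huV hEc.neg hvf)
  -- Bliss' equality case requires a nonzero primitive; if it vanished for all t > 0, so would `v`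
  -- almost everywhere.
  · by_contra! hcon
    refine hne ?_
    filter_upwards [hvf, hH.ae_dualNorm_mem hN hR] with y h1 h2
    rw [h1]
    exact (huV _ h2).symm.trans (hcon _ (radialCoord_pos hβ h2))

/-- The extremal profiles are in `W₀^{1,p}`. -/
theorem IsFinslerNorm.memSobolevZero_finslerProfile (hH : IsFinslerNorm H) (hN : 2 ≤ N)
    (hp1 : 1 < p) (hpN : p < N) (hR : 0 < R) {a b : ℝ} (ha : 0 < a) (hb : 0 < b) :
    MemSobolevZero (wulffBall H R) p (finslerProfile H p R a b) := by
  have hp10 : 0 < p - 1 := by linarith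
  have hNp : 0 < (N : ℝ) - p := by linarith
  set β := ((N : ℝ) - p) / (p - 1) with hβdef
  have hβ : 0 < β := by positivity
  set α := p / ((N : ℝ) - p) with hαdef
  have hα : 0 < α := by positivity
  -- Minus the radial derivative of the profile, so that its pullback is the derivative of the Bliss
  -- extremal, whose finite energy is already known.
  set f : ℝ → ℝ := fun r =>
    blissExtremalDeriv α a b (radialCoord β R r) * (β * r ^ (-β - 1)) with hfdef
  have hf : Measurable f := by
    simp only [hfdef, blissExtremalDeriv, radialCoord]
    fun_prop
  have hpb : ∀ t > 0, radialPullback β R f t = blissExtremalDeriv α a b t := fun t ht => by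
    have hr := radialCoordInv_pos (β := β) hR ht
    have h1 := deriv_mul_radialPullback (R := R) hβ f hr
    have h2 : 0 < β * radialCoordInv β R t ^ (-β - 1) := by positivity
    have h3 : f (radialCoordInv β R t) =
        blissExtremalDeriv α a b t * (β * radialCoordInv β R t ^ (-β - 1)) := by
      simp only [hfdef, radialCoord_radialCoordInv hβ hR ht]
    rw [h3, radialCoord_radialCoordInv hβ hR ht, mul_comm] at h1
    exact mul_right_cancel₀ h2.ne' h1
  have hE : radialEnergy N p R (fun r => ‖f r‖ₑ) ≠ ⊤ := by
    rw [← IsFinslerNorm.integrableOn_radialPullback hp1 hpN hR hf]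
    refine (bliss_extremal hp1 hα ha hb).1.congr_fun (fun t (ht : 0 < t) => ?_) measurableSet_Ioi
    rw [← hβdef, hpb t ht, abs_of_pos (blissExtremalDeriv_pos ha hb ht.le)]
  refine (hH.memSobolevZero_radial hN hp1 hpN hR hf hE).1.congr (hH.measure_wulffBall_lt_top R)
    hp1 ?_
  filter_upwards [hH.ae_dualNorm_mem hN hR] with y hy
  have ht := radialCoord_pos hβ hy
  rw [IsFinslerNorm.finslerProfile_eq hpN, ← integral_radialPullback hβ f hy,
    ← integral_blissExtremalDeriv hα ha hb ht]
  refine intervalIntegral.integral_congr_ae (Eventually.of_forall fun t ht' => ?_)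
  rw [uIoc_of_le ht.le] at ht'
  exact hpb t ht'.1

end Main

end

end

theorem theorem4p1 (N : ℕ) (hN : 2 ≤ N) (p : ℝ) (hp1 : 1 < p) (hpN : p < N)
    (H : EuclideanSpace ℝ (Fin N) → ℝ) (hH : IsFinslerNorm H) (R : ℝ) (hR : 0 < R) :
    (∀ (v : EuclideanSpace ℝ (Fin N) → ℝ)
        (g : EuclideanSpace ℝ (Fin N) → EuclideanSpace ℝ (Fin N)),
      MemSobolevZero (wulffBall H R) p v → IsFinslerRadial H R v →
      HasWeakGradient (wulffBall H R) v g →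
        IntegrableOn (fun y => |v y| ^ sobolevExponent N p / finslerWeight H p R y)
          (wulffBall H R) volume ∧
        IntegrableOn (fun y => H (g y) ^ p) (wulffBall H R) volume ∧
        finslerSobolevConst H p *
            (∫ y in wulffBall H R, |v y| ^ sobolevExponent N p / finslerWeight H p R y) ^
              (p / sobolevExponent N p)
          ≤ ∫ y in wulffBall H R, H (g y) ^ p ∧
        (¬ (∀ᵐ y ∂(volume.restrict (wulffBall H R)), v y = 0) →
          (finslerSobolevConst H p *
              (∫ y in wulffBall H R, |v y| ^ sobolevExponent N p / finslerWeight H p R y) ^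
                (p / sobolevExponent N p)
            = ∫ y in wulffBall H R, H (g y) ^ p ↔
          ∃ a b : ℝ, 0 < a ∧ 0 < b ∧
            ((∀ᵐ y ∂(volume.restrict (wulffBall H R)), v y = finslerProfile H p R a b y) ∨
             (∀ᵐ y ∂(volume.restrict (wulffBall H R)), v y = -finslerProfile H p R a b y))))) ∧
    (∀ a b : ℝ, 0 < a → 0 < b →
      MemSobolevZero (wulffBall H R) p (finslerProfile H p R a b) ∧
      IsFinslerRadial H R (finslerProfile H p R a b)) := by
  exact ⟨fun _ _ hv hrad hg => hH.radial_sobolev hN hp1 hpN hR hv hrad hg,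
    fun a b ha hb => ⟨hH.memSobolevZero_finslerProfile hN hp1 hpN hR ha hb,
      fun r => blissExtremal (p / (N - p)) a b (radialCoord ((N - p) / (p - 1)) R r),
      Eventually.of_forall fun _ => IsFinslerNorm.finslerProfile_eq hpN _ _ _⟩⟩
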